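/- Let $G$ be a compact Lie group with Lie algebra $\mathfrak g=T_1G$ (bracket of left-invariant vector fields), equipped with an $\mathrm{Ad}$-invariant positive definite inner product "$\cdot$", and let $(e_a)$ be an orthonormal basis of $\mathfrak g$, $f_{abc}=e_a\cdot[e_b,e_c]$; repeated indices are summed. For $\xi\in\mathfrak g$ let $\xi^L,\xi^R$ be the left- and right-invariant vector fields on $G$ with value $\xi$ at $1$, let $\theta^L,\theta^R$ be the left- and right-invariant Maurer–Cartan forms with components $\theta^L_a,\theta^R_a$ in the basis $(e_a)$, and let $\eta=\frac1{12}f_{abc}\,\theta^R_a\wedge\theta^R_b\wedge\theta^R_c\in\Omega^3(G)$. Let $M$ be a smooth $G$-manifold, with generating vector fields $\xi_M(m)=\frac{d}{dt}\big|_{t=0}\exp(-t\xi)\cdot m$, and let $\phi_M=\frac1{12}f_{abc}\,(e_a)_M\wedge(e_b)_M\wedge(e_c)_M$. For a bivector field $P$ and a 2-form $\omega$ on $M$ write $P^\sharp(a)(b)=P(a,b)$ and $\omega^\flat(v)=\omega(v,\cdot)$. The Schouten bracket $[\cdot,\cdot]$ is normalized by $[A\wedge B,C\wedge D]=[A,C]\wedge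 B\wedge D-[A,D]\wedge B\wedge C-[B,C]\wedge A\wedge D+[B,D]\wedge A\wedge C$ for vector fields $A,B,C,D$. For a map $\Phi:M\to G$: * $(M,P,\Phi)$ is a *Hamiltonian quasi-Poisson $G$-manifold* if $P$ is a smooth $G$-invariant bivector field with $[P,P]=\phi_M$, $\Phi$ is smooth and $\Phi(g\cdot m)=g\,\Phi(m)\,g^{-1}$, and $P^\sharp(d(\Phi^*f))=\frac12\,\Phi^*\big((e_a^L+e_a^R)f\big)\,(e_a)_M$ for all $f\in C^\infty(G,\mathbb R)$. It is *non-degenerate* if $\operatorname{im}(P^\sharp_m)+T_m(G\cdot m)=T_mM$ for all $m\in M$. * $(M,\omega,\Phi)$ is a *quasi-Hamiltonian $G$-space* if $\omega$ is a smooth $G$-invariant 2-form, $\Phi$ is smooth and $\Phi(g\cdot m)=g\,\Phi(m)\,g^{-1}$, and (a) $d\omega=\Phi^*\eta$; (b) $\iota((e_a)_M)\omega=\frac12\Phi^*(\theta^L_a+\theta^R_a)$ for all $a$; (c) for all $m\in M$, $\ker\omega_m=\{\xi_M(m) : \xi\in\mathfrak g,\ \xi+\mathrm{Ad}_{\Phi(m)}\xi=0\}$.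 **Theorem.** (1) If $(M,P,\Phi)$ is a non-degenerate Hamiltonian quasi-Poisson $G$-manifold, then there is a unique 2-form $\omega$ on $M$ such that $(M,\omega,\Phi)$ is a quasi-Hamiltonian $G$-space and $$P^\sharp\circ\omega^\flat=\mathrm{Id}_{TM}-\tfrac14\,(e_a)_M\otimes\Phi^*(\theta^L_a-\theta^R_a).\qquad(*)$$ (2) Conversely, if $(M,\omega,\Phi)$ is a quasi-Hamiltonian $G$-space, then there is a unique bivector field $P$ on $M$ such that $(M,P,\Phi)$ is a non-degenerate Hamiltonian quasi-Poisson $G$-manifold and $(*)$ holds. -/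

import Mathlib

open scoped Manifold ContDiff

noncomputable section

namespace QuasiPoisson

section LinearAlgebra

variable {V : Type*} [AddCommGroup V] [Module ℝ V] [TopologicalSpace V]

/-- `β₁ ∧ ⋯ ∧ βₖ` as an alternating form, `(v₁,…,vₖ) ↦ det (βⱼ(vᵢ))`. -/
def wedgeCovectors {k : ℕ} (β : Fin k → V →L[ℝ] ℝ) : V [⋀^Fin k]→ₗ[ℝ] ℝ :=
  Matrix.detRowAlternating.compLinearMap (LinearMap.pi fun j => (β j).toLinearMap)

/-- `v₁ ∧ ⋯ ∧ vₖ` as an alternating form on covectors, `(α₁,…,αₖ) ↦ det (αᵢ(vⱼ))`. -/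
def wedgeVectors {k : ℕ} (v : Fin k → V) : (V →L[ℝ] ℝ) [⋀^Fin k]→ₗ[ℝ] ℝ :=
  Matrix.detRowAlternating.compLinearMap
    (LinearMap.pi fun j =>
      { toFun := fun α => α (v j), map_add' := fun _ _ => rfl, map_smul' := fun _ _ => rfl })

/-- The bilinear form `(v, w) ↦ ω(v, w)` of an alternating 2-form. -/
def bilinOfAlt {W : Type*} [AddCommGroup W] [Module ℝ W] [TopologicalSpace W]
    (om : W [⋀^Fin 2]→L[ℝ] ℝ) : W →ₗ[ℝ] W →ₗ[ℝ] ℝ :=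
  LinearMap.mk₂ ℝ (fun v w => om ![v, w])
    (fun v v' w => om.toMultilinearMap.cons_add ![w] v v')
    (fun c v w => om.toMultilinearMap.cons_smul ![w] c v)
    (fun v w w' => by
      have h : ∀ x : W, Function.update ![v, 0] 1 x = ![v, x] := fun x => by
        ext i; fin_cases i <;> rfl
      have h' := om.toMultilinearMap.map_update_add ![v, 0] 1 w w'
      simp only [h] at h'
      exact h')
    (fun c v w => by
      have h : ∀ x : W, Function.update ![v, 0] 1 x = ![v, x] := fun x => by
        ext i; fin_cases i <;> rfl
      have h' := om.toMultilinearMap.map_update_smul ![v, 0] 1 c w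
      simp only [h] at h'
      exact h')

/-- `ω♭(v) = ι(v) ω = ω(v, ·)`. -/
def flat [IsTopologicalAddGroup V] [ContinuousSMul ℝ V] [T2Space V] [FiniteDimensional ℝ V]
    (om : V [⋀^Fin 2]→L[ℝ] ℝ) : V →ₗ[ℝ] V →L[ℝ] ℝ :=
  (LinearMap.toContinuousLinearMap (𝕜 := ℝ) (E := V) (F' := ℝ)).toLinearMap ∘ₗ bilinOfAlt om

/-- `P♯(a)` is the vector with `b(P♯(a)) = P(a, b)` for every covector `b`. -/
def sharp [IsTopologicalAddGroup V] [ContinuousSMul ℝ V] [T2Space V] [FiniteDimensional ℝ V]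
    (P : (V →L[ℝ] ℝ) [⋀^Fin 2]→L[ℝ] ℝ) : (V →L[ℝ] ℝ) →ₗ[ℝ] V :=
  (Module.evalEquiv ℝ V).symm.toLinearMap ∘ₗ
    (LinearMap.toContinuousLinearMap (𝕜 := ℝ) (E := V) (F' := ℝ)).toLinearMap.dualMap ∘ₗ
      bilinOfAlt P

theorem flat_apply [IsTopologicalAddGroup V] [ContinuousSMul ℝ V] [T2Space V]
    [FiniteDimensional ℝ V] (om : V [⋀^Fin 2]→L[ℝ] ℝ) (v w : V) : flat om v w = om ![v, w] := rfl

theorem apply_sharp [IsTopologicalAddGroup V] [ContinuousSMul ℝ V] [T2Space V]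
    [FiniteDimensional ℝ V] (P : (V →L[ℝ] ℝ) [⋀^Fin 2]→L[ℝ] ℝ) (a b : V →L[ℝ] ℝ) :
    b (sharp P a) = P ![a, b] := by
  have h := Module.apply_evalEquiv_symm_apply ℝ V b.toLinearMap
    ((LinearMap.toContinuousLinearMap (𝕜 := ℝ) (E := V) (F' := ℝ)).toLinearMap.dualMap
      (bilinOfAlt P a))
  exact h

end LinearAlgebra

section Fields

variable {F : Type*} [NormedAddCommGroup F] [NormedSpace ℝ F]
  {M : Type*} [TopologicalSpace M] [ChartedSpace F M]
  {F' : Type*} [NormedAddCommGroup F'] [NormedSpace ℝ F']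
  {N : Type*} [TopologicalSpace N] [ChartedSpace F' N]

/-- The tangent space of a (boundaryless) manifold modelled on `F`. -/
abbrev Tan (F : Type*) [NormedAddCommGroup F] [NormedSpace ℝ F]
    {M : Type*} [TopologicalSpace M] [ChartedSpace F M] (m : M) : Type _ :=
  TangentSpace 𝓘(ℝ, F) m

/-- The cotangent space. -/
abbrev Cotan (F : Type*) [NormedAddCommGroup F] [NormedSpace ℝ F]
    {M : Type*} [TopologicalSpace M] [ChartedSpace F M] (m : M) : Type _ :=
  Tan F m →L[ℝ] ℝ

instance (m : M) [FiniteDimensional ℝ F] : FiniteDimensional ℝ (Tan F m) :=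
  inferInstanceAs (FiniteDimensional ℝ F)

instance (m : M) : T2Space (Tan F m) := inferInstanceAs (T2Space F)

/-- Differential `k`-forms (not necessarily smooth). -/
abbrev FormField (F : Type*) [NormedAddCommGroup F] [NormedSpace ℝ F]
    (M : Type*) [TopologicalSpace M] [ChartedSpace F M] (k : ℕ) : Type _ :=
  ∀ m : M, Tan F m [⋀^Fin k]→L[ℝ] ℝ

/-- `k`-vector fields (not necessarily smooth); an element of `⋀ᵏ T_m M` is regarded as an
alternating form on the cotangent space. -/
abbrev MultivectorField (F : Type*) [NormedAddCommGroup F] [NormedSpace ℝ F]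
    (M : Type*) [TopologicalSpace M] [ChartedSpace F M] (k : ℕ) : Type _ :=
  ∀ m : M, Cotan F m [⋀^Fin k]→L[ℝ] ℝ

/-- The tangent map `T_m M → T_{h(m)} N`. -/
abbrev tmap (F F' : Type*) [NormedAddCommGroup F] [NormedSpace ℝ F]
    [NormedAddCommGroup F'] [NormedSpace ℝ F']
    {M : Type*} [TopologicalSpace M] [ChartedSpace F M]
    {N : Type*} [TopologicalSpace N] [ChartedSpace F' N]
    (h : M → N) (m : M) : Tan F m →L[ℝ] Tan F' (h m) :=
  mfderiv 𝓘(ℝ, F) 𝓘(ℝ, F') h m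

/-- The differential `df` at `m` of a real function. -/
def diff (f : M → ℝ) (m : M) : Cotan F m := tmap F ℝ f m

/-- `(h^* ω)_m`. -/
def pullForm {k : ℕ} (h : M → N) (om : FormField F' N k) (m : M) : Tan F m [⋀^Fin k]→L[ℝ] ℝ :=
  (om (h m)).compContinuousLinearMap (tmap F F' h m)

/-- The push-forward `(T_m h)(P_m)`, a `k`-vector at `h(m)`. -/
def pushMultivector {k : ℕ} (h : M → N) (P : MultivectorField F M k) (m : M) :
    Cotan F' (h m) [⋀^Fin k]→L[ℝ] ℝ :=
  (P m).compContinuousLinearMap (ContinuousLinearMap.precomp ℝ (tmap F F' h m))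

/-- The form `ω` in the chart around `m₀`, a form on an open subset of `F`. -/
def formInChart {k : ℕ} (om : FormField F M k) (m₀ : M) (y : F) : F [⋀^Fin k]→L[ℝ] ℝ :=
  pullForm (F := F) (M := F) (extChartAt 𝓘(ℝ, F) m₀).symm om y

/-- The `k`-vector field `P` in the chart around `m₀`. -/
def multivectorInChart {k : ℕ} (P : MultivectorField F M k) (m₀ : M) (y : F) :
    (F →L[ℝ] ℝ) [⋀^Fin k]→L[ℝ] ℝ :=
  pushMultivector (F' := F) (N := F) (extChartAt 𝓘(ℝ, F) m₀) P ((extChartAt 𝓘(ℝ, F) m₀).symm y)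

/-- Smoothness: all coordinate expressions are smooth. -/
def SmoothForm {k : ℕ} (om : FormField F M k) : Prop :=
  ∀ m₀ : M, ContDiffOn ℝ ∞ (formInChart om m₀) (extChartAt 𝓘(ℝ, F) m₀).target

/-- Smoothness: all coordinate expressions are smooth. -/
def SmoothMultivector {k : ℕ} (P : MultivectorField F M k) : Prop :=
  ∀ m₀ : M, ContDiffOn ℝ ∞ (multivectorInChart P m₀) (extChartAt 𝓘(ℝ, F) m₀).target

/-- The exterior derivative, computed at `m` in the chart around `m`. -/
def dForm {k : ℕ} (om : FormField F M k) : FormField F M (k + 1) := fun m =>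
  ContinuousAlternatingMap.compContinuousLinearMap
    (extDeriv (formInChart om m) (extChartAt 𝓘(ℝ, F) m m))
    (tmap F F (M := M) (N := F) (extChartAt 𝓘(ℝ, F) m) m)

/-- The Schouten bracket of two bivector fields on a vector space, as a trivector, in the
normalization in which `⟨v₁ ∧ v₂ ∧ v₃, α₁ ∧ α₂ ∧ α₃⟩ = det (αᵢ(vⱼ))` and
`[A ∧ B, C ∧ D] = [A, C] ∧ B ∧ D - [A, D] ∧ B ∧ C - [B, C] ∧ A ∧ D + [B, D] ∧ A ∧ C`. In
particular `[P, P](df, dg, dh) = 2 ({f, {g, h}} + {g, {h, f}} + {h, {f, g}})`, where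
`{f, g} = P(df, dg)`. -/
def schoutenModel [FiniteDimensional ℝ F] (P Q : F → (F →L[ℝ] ℝ) [⋀^Fin 2]→L[ℝ] ℝ) (x : F)
    (α : Fin 3 → F →L[ℝ] ℝ) : ℝ :=
  ∑ i : Fin 3,
    (fderiv ℝ (fun y => Q y ![α (i + 1), α (i + 2)]) x (sharp (P x) (α i)) +
      fderiv ℝ (fun y => P y ![α (i + 1), α (i + 2)]) x (sharp (Q x) (α i)))

/-- The Schouten bracket `[P, Q]_m` of bivector fields, evaluated on three covectors at `m` and
computed in the chart around `m`. -/
def schouten [FiniteDimensional ℝ F] (P Q : MultivectorField F M 2) (m : M)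
    (α : Fin 3 → Cotan F m) : ℝ :=
  schoutenModel (multivectorInChart P m) (multivectorInChart Q m) (extChartAt 𝓘(ℝ, F) m m)
    (fun i => ContinuousLinearMap.comp (α i)
      (tmap F F (M := F) (N := M) (extChartAt 𝓘(ℝ, F) m).symm (extChartAt 𝓘(ℝ, F) m m)))

end Fields

section LieGroups

variable {E : Type*} [NormedAddCommGroup E] [NormedSpace ℝ E]
  {G : Type*} [TopologicalSpace G] [ChartedSpace E G] [Group G]

/-- The Lie algebra `𝔤 = T_1 G`, with the bracket of left-invariant vector fields. -/
abbrev LieAlg (E : Type*) [NormedAddCommGroup E] [NormedSpace ℝ E]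
    (G : Type*) [TopologicalSpace G] [ChartedSpace E G] [Group G] : Type _ :=
  GroupLieAlgebra 𝓘(ℝ, E) G

/-- The adjoint action. -/
def Ad (g : G) : LieAlg E G →L[ℝ] LieAlg E G :=
  tmap E E (fun x : G => g * x * g⁻¹) 1

/-- The left-invariant vector field `ξ^L`. -/
def leftField (ξ : LieAlg E G) (g : G) : Tan E g :=
  tmap E E (fun x : G => g * x) 1 ξ

/-- The right-invariant vector field `ξ^R`. -/
def rightField (ξ : LieAlg E G) (g : G) : Tan E g :=
  tmap E E (fun x : G => x * g) 1 ξ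

/-- The left-invariant Maurer-Cartan form `θ^L`. -/
def thetaL (g : G) : Tan E g →L[ℝ] LieAlg E G :=
  tmap E E (fun x : G => g⁻¹ * x) g

/-- The right-invariant Maurer-Cartan form `θ^R`. -/
def thetaR (g : G) : Tan E g →L[ℝ] LieAlg E G :=
  tmap E E (fun x : G => x * g⁻¹) g

/-- An `Ad`-invariant (positive definite) inner product on `𝔤`. -/
structure IsInvariantInnerProduct (B : LinearMap.BilinForm ℝ (LieAlg E G)) : Prop where
  symm : ∀ ξ ζ, B ξ ζ = B ζ ξ
  pos : ∀ ξ, ξ ≠ 0 → 0 < B ξ ξ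
  invariant : ∀ (g : G) (ξ ζ), B (Ad g ξ) (Ad g ζ) = B ξ ζ

variable {ι : Type*}

/-- The basis `(e_a)` is orthonormal for `B`. -/
def IsOrthonormalBasis (B : LinearMap.BilinForm ℝ (LieAlg E G))
    (e : Module.Basis ι ℝ (LieAlg E G)) : Prop :=
  (∀ a, B (e a) (e a) = 1) ∧ ∀ a b, a ≠ b → B (e a) (e b) = 0

/-- `f_{abc} = e_a · [e_b, e_c]`. -/
def structureConst (B : LinearMap.BilinForm ℝ (LieAlg E G))
    (e : Module.Basis ι ℝ (LieAlg E G)) (a b c : ι) : ℝ :=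
  B (e a) ⁅e b, e c⁆

/-- The component `θ^L_a`. -/
def thetaLComp [FiniteDimensional ℝ E] (e : Module.Basis ι ℝ (LieAlg E G)) (a : ι) (g : G) :
    Cotan E g :=
  (LinearMap.toContinuousLinearMap (e.coord a)).comp (thetaL g)

/-- The component `θ^R_a`. -/
def thetaRComp [FiniteDimensional ℝ E] (e : Module.Basis ι ℝ (LieAlg E G)) (a : ι) (g : G) :
    Cotan E g :=
  (LinearMap.toContinuousLinearMap (e.coord a)).comp (thetaR g)

/-- `η = (1/12) f_{abc} θ^R_a ∧ θ^R_b ∧ θ^R_c`. -/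
def etaForm [FiniteDimensional ℝ E] [Fintype ι] (B : LinearMap.BilinForm ℝ (LieAlg E G))
    (e : Module.Basis ι ℝ (LieAlg E G)) (g : G) : Tan E g [⋀^Fin 3]→ₗ[ℝ] ℝ :=
  (1 / 12 : ℝ) • ∑ a, ∑ b, ∑ c, structureConst B e a b c •
    wedgeCovectors ![thetaRComp e a g, thetaRComp e b g, thetaRComp e c g]

end LieGroups

section Spaces

variable {E : Type*} [NormedAddCommGroup E] [NormedSpace ℝ E] [FiniteDimensional ℝ E]
  {G : Type*} [TopologicalSpace G] [ChartedSpace E G] [Group G]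
  {F : Type*} [NormedAddCommGroup F] [NormedSpace ℝ F] [FiniteDimensional ℝ F]
  {M : Type*} [TopologicalSpace M] [ChartedSpace F M] [MulAction G M]
  {ι : Type*} [Fintype ι]

/-- The generating vector field `ξ_M(m) = d/dt|_{t=0} exp(-tξ)·m`, that is, the image of `-ξ`
under the tangent map at `1` of `g ↦ g·m`. It is linear in `ξ`. -/
def gen (ξ : LieAlg E G) (m : M) : Tan F m :=
  tmap E F (fun g : G => g • m) 1 (-ξ)

/-- The trivector field `φ_M`, for the Cartan 3-tensor `φ = (1/12) f_{abc} e_a ∧ e_b ∧ e_c`. -/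
def cartanTrivector (B : LinearMap.BilinForm ℝ (LieAlg E G))
    (e : Module.Basis ι ℝ (LieAlg E G)) (m : M) : Cotan F m [⋀^Fin 3]→ₗ[ℝ] ℝ :=
  (1 / 12 : ℝ) • ∑ a, ∑ b, ∑ c, structureConst B e a b c •
    wedgeVectors ![gen (F := F) (e a) m, gen (F := F) (e b) m, gen (F := F) (e c) m]

/-- `Φ : M → G` is smooth and `Ad`-equivariant. -/
structure IsEquivariantMap (E F : Type*) [NormedAddCommGroup E] [NormedSpace ℝ E]
    [NormedAddCommGroup F] [NormedSpace ℝ F]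
    {G : Type*} [TopologicalSpace G] [ChartedSpace E G] [Group G]
    {M : Type*} [TopologicalSpace M] [ChartedSpace F M] [MulAction G M] (Φ : M → G) : Prop where
  smooth : ContMDiff 𝓘(ℝ, F) 𝓘(ℝ, E) ∞ Φ
  equivariant : ∀ (g : G) (m : M), Φ (g • m) = g * Φ m * g⁻¹

/-- `(M, P)` is a quasi-Poisson `G`-manifold. -/
structure IsQuasiPoisson (B : LinearMap.BilinForm ℝ (LieAlg E G))
    (e : Module.Basis ι ℝ (LieAlg E G)) (P : MultivectorField F M 2) : Prop where
  smooth : SmoothMultivector P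
  invariant : ∀ (g : G) (m : M), pushMultivector (fun x : M => g • x) P m = P (g • m)
  schouten_eq : ∀ (m : M) (α : Fin 3 → Cotan F m),
    schouten P P m α = cartanTrivector B e m α

/-- `Φ` is a moment map for `P`:
`P♯(d(Φ^* f)) = (1/2) Φ^*((e_a^L + e_a^R) f) (e_a)_M` for all smooth functions `f` on `G`. -/
def MomentCondition (e : Module.Basis ι ℝ (LieAlg E G)) (P : MultivectorField F M 2)
    (Φ : M → G) : Prop :=
  ∀ f : G → ℝ, ContMDiff 𝓘(ℝ, E) 𝓘(ℝ, ℝ) ∞ f → ∀ m : M,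
    sharp (P m) (diff (fun x => f (Φ x)) m) =
      ∑ a, (1 / 2 * diff f (Φ m) (leftField (e a) (Φ m) + rightField (e a) (Φ m))) •
        gen (F := F) (e a) m

/-- `(M, P, Φ)` is a Hamiltonian quasi-Poisson `G`-manifold. -/
structure IsHamiltonianQuasiPoisson (B : LinearMap.BilinForm ℝ (LieAlg E G))
    (e : Module.Basis ι ℝ (LieAlg E G)) (P : MultivectorField F M 2) (Φ : M → G) : Prop where
  quasiPoisson : IsQuasiPoisson B e P
  equivariantMap : IsEquivariantMap E F Φ
  moment : MomentCondition e P Φ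

/-- Non-degeneracy: `im(P♯_m) + T_m(G·m) = T_m M` at every point. -/
def IsNondegenerate (E G : Type*) [NormedAddCommGroup E] [NormedSpace ℝ E]
    [TopologicalSpace G] [ChartedSpace E G] [Group G] [MulAction G M]
    (P : MultivectorField F M 2) : Prop :=
  ∀ (m : M) (v : Tan F m), ∃ (a : Cotan F m) (ξ : LieAlg E G), v = sharp (P m) a + gen ξ m

/-- `(M, ω, Φ)` is a quasi-Hamiltonian `G`-space. -/
structure IsQuasiHamiltonian (B : LinearMap.BilinForm ℝ (LieAlg E G))
    (e : Module.Basis ι ℝ (LieAlg E G)) (om : FormField F M 2) (Φ : M → G) : Prop where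
  smooth : SmoothForm om
  invariant : ∀ (g : G) (m : M), pullForm (fun x : M => g • x) om m = om m
  equivariantMap : IsEquivariantMap E F Φ
  /-- `dω = Φ^* η` -/
  d_eq : ∀ (m : M) (v : Fin 3 → Tan F m),
    dForm om m v = etaForm B e (Φ m) (fun i => tmap F E Φ m (v i))
  /-- `ι((e_a)_M) ω = (1/2) Φ^*(θ^L_a + θ^R_a)` -/
  moment : ∀ (a : ι) (m : M),
    flat (om m) (gen (e a) m) =
      (1 / 2 : ℝ) • (thetaLComp e a (Φ m) + thetaRComp e a (Φ m)).comp (tmap F E Φ m)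
  /-- `ker ω_m = {ξ_M(m) | ξ + Ad_{Φ(m)} ξ = 0}` -/
  kernel : ∀ (m : M) (v : Tan F m),
    flat (om m) v = 0 ↔ ∃ ξ : LieAlg E G, ξ + Ad (Φ m) ξ = 0 ∧ gen ξ m = v

/-- `P♯ ∘ ω♭ = Id - (1/4) (e_a)_M ⊗ Φ^*(θ^L_a - θ^R_a)`. -/
def Compatible (e : Module.Basis ι ℝ (LieAlg E G)) (P : MultivectorField F M 2)
    (om : FormField F M 2) (Φ : M → G) : Prop :=
  ∀ (m : M) (v : Tan F m),
    sharp (P m) (flat (om m) v) =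
      v - (1 / 4 : ℝ) • ∑ a,
        (thetaLComp e a (Φ m) - thetaRComp e a (Φ m)) (tmap F E Φ m v) • gen (e a) m

end Spaces

end QuasiPoisson

end

open QuasiPoisson

open scoped Manifold ContDiff

noncomputable section

set_option linter.unusedSectionVars false

/-! Write `T = θ^L ∘ dΦ` and `R` for the adjoint of the infinitesimal action, so that `R α · ξ =
α(ξ_M)`. The argument splits into linear algebra at each point and one differential identity.

Pointwise, let `τ(ζ) = ζ · T`. The moment condition for `P` reads `P♯(τ ζ) = ½ (ζ + Ad_Φ ζ)_M`, the
one for `ω` reads `ω♭(ξ_M) = ½ τ(ξ + Ad_Φ⁻¹ ξ)`, and equivariance of `Φ` gives `T(ξ_M) = ξ - Ad_Φ⁻¹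
ξ`. `DualityData` records this situation; it is invariant under exchanging vectors with covectors,
the action with `τ`, and `Ad_Φ` with its inverse (`DualityData.swap`). If every vector is `P♯ a +
ξ_M`, then the transpose of (*) prescribes `ω♭` on `P♯ a` and the moment condition prescribes it on
`ξ_M`, so `ω` is unique; `DualityData.exists_dual` shows that the prescription is consistent and
skew. The kernel condition follows from (*) and the moment condition (`DualityData.ker_dual`).
Conversely, the kernel condition forces `ker ω ∩ ker dΦ = 0`, so every covector is `ω♭ v + τ ζ`, and
the swapped statement yields a unique `P`; the transpose of (*) then gives non-degeneracy.

Invariance is inherited by pointwise uniqueness, because translates satisfy the same conditions.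
Smoothness is inherited because the unknown tensor, composed with a smooth family of surjections,
becomes a known smooth family (`contDiffAt_of_comp_surjective`).

The integrability conditions are compared by `extDeriv_sharp`. Differentiating the transpose of (*),
and using the Maurer-Cartan equation for `T` and the derivative of `Ad_Φ`, one finds `dω(P♯α₀, P♯α₁,
P♯α₂) = ½ [P,P](α₀,α₁,α₂) - ¼ Rα₀·[Rα₁, Rα₂] + ½ TP♯α₀·[TP♯α₁, TP♯α₂]`. The middle term is `-½ φ_M`
and the last is `Φ^*η`. Hence `dω = Φ^*η` gives `[P,P] = φ_M` at once. In the other direction `[P,P]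
= φ_M` gives `dω = Φ^*η` only on the image of `P♯`; on orbit directions it follows from Cartan's
formula for the invariant form `ω` (`extDeriv_symmetry`), and the two kinds of vectors span.

All derivatives are computed in charts of `M`, while `G` enters only through its chart at the
identity, by way of left logarithmic derivatives. -/

namespace QuasiPoisson

open Filter Topology

/-! ### Linear algebra of the duality between bivectors and 2-forms at a point. -/

section Duality

variable {V W g : Type*} [AddCommGroup V] [Module ℝ V] [AddCommGroup W] [Module ℝ W]
  [AddCommGroup g] [Module ℝ g]

/-- The linear algebra underlying the correspondence between quasi-Poisson bivectors and
quasi-Hamiltonian 2-forms. It is symmetric under the exchange of `V` and `W`. -/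
structure DualityData (B : LinearMap.BilinForm ℝ g) (p : W →ₗ[ℝ] V →ₗ[ℝ] ℝ)
    (ρ : g →ₗ[ℝ] V) (τ : g →ₗ[ℝ] W) (ρs : W →ₗ[ℝ] g) (τs : V →ₗ[ℝ] g) (A A' : g →ₗ[ℝ] g) :
    Prop where
  sepL : ∀ w, (∀ v, p w v = 0) → w = 0
  sepR : ∀ v, (∀ w, p w v = 0) → v = 0
  symm : ∀ ξ ζ, B ξ ζ = B ζ ξ
  nondeg : ∀ ξ, (∀ ζ, B ξ ζ = 0) → ξ = 0
  adj_rho : ∀ w ξ, B (ρs w) ξ = p w (ρ ξ)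
  adj_tau : ∀ v ζ, B (τs v) ζ = p (τ ζ) v
  isom : ∀ ξ ζ, B (A ξ) (A ζ) = B ξ ζ
  left_inv : ∀ ξ, A' (A ξ) = ξ
  right_inv : ∀ ξ, A (A' ξ) = ξ
  tau_rho : ∀ ξ, τs (ρ ξ) = ξ - A' ξ

variable {B : LinearMap.BilinForm ℝ g} {p : W →ₗ[ℝ] V →ₗ[ℝ] ℝ}
  {ρ : g →ₗ[ℝ] V} {τ : g →ₗ[ℝ] W} {ρs : W →ₗ[ℝ] g} {τs : V →ₗ[ℝ] g} {A A' : g →ₗ[ℝ] g}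

namespace DualityData

theorem isom' (h : DualityData B p ρ τ ρs τs A A') (ξ ζ : g) : B (A' ξ) (A' ζ) = B ξ ζ := by
  rw [← h.isom, h.right_inv, h.right_inv]

theorem adj (h : DualityData B p ρ τ ρs τs A A') (ξ ζ : g) : B ξ (A ζ) = B (A' ξ) ζ := by
  rw [← h.isom' ξ, h.left_inv]

/-- Only the last axiom is not symmetric on its face: transposing `τs ∘ ρ = 1 - A'` with respect to
`B` gives `ρs ∘ τ = 1 - A`, since `A` is an isometry with inverse `A'`. This lets each lemma below
serve both for passing from `P` to `ω` and for passing from `ω` to `P`. -/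
theorem swap (h : DualityData B p ρ τ ρs τs A A') :
    DualityData B p.flip τ ρ τs ρs A' A where
  sepL := h.sepR
  sepR := h.sepL
  symm := h.symm
  nondeg := h.nondeg
  adj_rho := h.adj_tau
  adj_tau := h.adj_rho
  isom := h.isom'
  left_inv := h.right_inv
  right_inv := h.left_inv
  tau_rho ξ := by
    rw [← sub_eq_zero]
    refine h.nondeg _ fun ζ => ?_
    have h1 := h.adj_rho (τ ξ) ζ
    rw [← h.adj_tau, h.tau_rho] at h1
    have h2 := h.adj ζ ξ
    simp only [map_sub, LinearMap.sub_apply, h1, h.symm (A ξ) ζ, h2, h.symm ζ ξ]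
    ring

variable {P : W →ₗ[ℝ] V}

/-- Transpose of the moment condition `hPτ`; the sign comes from the skewness of `P`. -/
theorem tau_sharp (h : DualityData B p ρ τ ρs τs A A')
    (hP : ∀ a b, p b (P a) = -p a (P b)) (hPτ : ∀ ζ, P (τ ζ) = (1 / 2 : ℝ) • ρ (ζ + A ζ)) (a : W) :
    τs (P a) = -((1 / 2 : ℝ) • (ρs a + A' (ρs a))) := by
  rw [← sub_eq_zero]
  refine h.nondeg _ fun ζ => ?_
  have h1 := h.adj_tau (P a) ζ
  have h2 := h.adj_rho a ζ
  have h3 := h.adj_rho a (A ζ)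
  have h4 := h.adj (ρs a) ζ
  rw [hP, hPτ] at h1
  simp only [map_sub, map_neg, map_smul, map_add, LinearMap.sub_apply, LinearMap.add_apply,
    LinearMap.neg_apply, LinearMap.smul_apply, smul_eq_mul] at *
  linarith

/-- `Ω` is prescribed on `P w` by the transpose of (*) and on `ρ ξ` by the moment condition. Since
these vectors span, the content is that the prescription respects the relations between them and is
skew. -/
theorem exists_dual (h : DualityData B p ρ τ ρs τs A A')
    (hP : ∀ a b, p b (P a) = -p a (P b)) (hPτ : ∀ ζ, P (τ ζ) = (1 / 2 : ℝ) • ρ (ζ + A ζ))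
    (hsurj : ∀ v, ∃ w ξ, v = P w + ρ ξ) :
    ∃ Ω : V →ₗ[ℝ] W, (∀ v v', p (Ω v) v' = -p (Ω v') v) ∧
      (∀ v, P (Ω v) = v - (1 / 4 : ℝ) • ρ (τs v - A (τs v))) ∧
      ∀ ξ, Ω (ρ ξ) = (1 / 2 : ℝ) • τ (ξ + A' ξ) := by
  have hTP := h.tau_sharp hP hPτ
  let S : W × g →ₗ[ℝ] V := P.coprod ρ
  -- The required value is `Ω (P w + ρ ξ) = w + τ (u (w, ξ))`: the `-1/4` part is the correction
  -- term in the transpose of (*), the `1/2` part is the moment condition.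
  let u : W × g →ₗ[ℝ] g := LinearMap.coprod
    (-((1 / 4 : ℝ) • (ρs - A' ∘ₗ ρs))) ((1 / 2 : ℝ) • (LinearMap.id + A'))
  let L : W × g →ₗ[ℝ] W := LinearMap.fst ℝ W g + τ ∘ₗ u
  have hu : ∀ w ξ, u (w, ξ) = -((1 / 4 : ℝ) • (ρs w - A' (ρs w))) + (1 / 2 : ℝ) • (ξ + A' ξ) :=
    fun w ξ => by simp [u]
  have hL : ∀ w ξ, L (w, ξ) = w + τ (u (w, ξ)) := fun w ξ => by simp [L]
  have hS : ∀ w ξ, S (w, ξ) = P w + ρ ξ := fun w ξ => by simp [S]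
  have hSs : Function.Surjective S := fun v => by
    obtain ⟨w, ξ, hv⟩ := hsurj v
    exact ⟨(w, ξ), by rw [hS, hv]⟩
  -- Well-definedness. The value `L x` is shown to vanish by pairing it with an arbitrary vector,
  -- again written as `P b + ρ ζ`.
  have key : ∀ x, S x = 0 → L x = 0 := by
    rintro ⟨a, ξ⟩ hx
    rw [hS] at hx
    have hr : τs (P a + ρ ξ) = 0 := by rw [hx, map_zero]
    rw [map_add, hTP, h.tau_rho] at hr
    refine h.sepL _ fun v => ?_
    obtain ⟨b, ζ, rfl⟩ := hsurj v
    have e1 := h.adj_rho a ζ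
    have e2 := h.adj_tau (P b) (u (a, ξ))
    have e3 := h.adj_tau (ρ ζ) (u (a, ξ))
    have e4 := h.adj_rho b ξ
    have e5 : p a (P b) = p b (ρ ξ) := by
      rw [hP, eq_neg_of_add_eq_zero_left hx, map_neg, neg_neg]
    rw [hTP] at e2
    rw [h.tau_rho] at e3
    rw [hu] at e2 e3
    -- Applying `τs` to `P a + ρ ξ = 0` gives one relation in `g`. The pairing of `L x` with `P b +
    -- ρ ζ` reduces to a combination of its inner products with the four elements tested here.
    have r1 : ∀ x, B x (-((1 / 2 : ℝ) • (ρs a + A' (ρs a))) + (ξ - A' ξ)) = 0 := fun x => by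
      rw [hr, map_zero]
    have r2 := r1 ζ
    have r3 := r1 (A' ζ)
    have r4 := r1 (ρs b)
    have r5 := r1 (A' (ρs b))
    rw [hL, hu]
    simp only [map_sub, map_neg, map_smul, map_add, LinearMap.sub_apply, LinearMap.add_apply,
      LinearMap.neg_apply, LinearMap.smul_apply, smul_eq_mul, h.isom'] at *
    have := h.symm (ρs a) ζ
    linarith
  obtain ⟨R, hR⟩ := S.exists_rightInverse_of_surjective (LinearMap.range_eq_top.2 hSs)
  have hΩ : ∀ w ξ, L (R (P w + ρ ξ)) = L (w, ξ) := fun w ξ => by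
    have : S (R (P w + ρ ξ) - (w, ξ)) = 0 := by
      rw [map_sub, ← hS]
      have := LinearMap.congr_fun hR (S (w, ξ))
      simp only [LinearMap.comp_apply, LinearMap.id_apply] at this
      rw [this, sub_self]
    have := key _ this
    rwa [map_sub, sub_eq_zero] at this
  have hval : ∀ w ξ, (L ∘ₗ R) (P w + ρ ξ) = w + τ (u (w, ξ)) := fun w ξ => by
    rw [LinearMap.comp_apply, hΩ, hL]
  -- Skewness is checked on the diagonal, where a single decomposition of `v` suffices, and
  -- polarized afterwards.
  have halt : ∀ v, p ((L ∘ₗ R) v) v = 0 := fun v => by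
    obtain ⟨a, ξ, rfl⟩ := hsurj v
    have e1 := h.adj_rho a ξ
    have e2 := h.adj_tau (P a) (u (a, ξ))
    have e3 := h.adj_tau (ρ ξ) (u (a, ξ))
    have e4 := hP a a
    rw [hTP] at e2
    rw [h.tau_rho] at e3
    rw [hval]
    rw [hu] at e2 e3 ⊢
    have s1 := h.symm (A' ξ) (A' (ρs a))
    have s2 := h.symm (A' ξ) (ρs a)
    have s3 := h.symm (ξ) (A' (ρs a))
    have s4 := h.symm (ξ) (ρs a)
    have s5 := h.symm (A' (ρs a)) (ρs a)
    have s6 := h.symm (A' ξ) (ξ)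
    simp only [map_sub, map_neg, map_smul, map_add, LinearMap.sub_apply, LinearMap.add_apply,
      LinearMap.neg_apply, LinearMap.smul_apply, smul_eq_mul, h.isom'] at *
    linarith
  refine ⟨L ∘ₗ R, fun v v' => ?_, fun v => ?_, fun ξ => ?_⟩
  · have h1 := halt (v + v')
    have h2 := halt v
    have h3 := halt v'
    simp only [map_add, LinearMap.add_apply] at *
    linarith
  · obtain ⟨a, ξ, rfl⟩ := hsurj v
    rw [hval, hu]
    simp only [map_sub, map_neg, map_smul, map_add, hPτ, hTP, h.tau_rho, smul_add, smul_neg,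
      smul_sub, smul_smul, h.right_inv]
    module
  · have := hval 0 ξ
    rw [map_zero, zero_add, zero_add, hu] at this
    rw [this, map_zero]
    simp

/-- Transpose of (*): the signs from the skewness of `P` and of `Ω` cancel, and `ρ (1 - A) τs`
transposes to `τ (1 - A') ρs`. -/
theorem sharp_flat_transpose {Ω : V →ₗ[ℝ] W} (h : DualityData B p ρ τ ρs τs A A')
    (hP : ∀ a b, p b (P a) = -p a (P b)) (hΩ : ∀ v v', p (Ω v) v' = -p (Ω v') v)
    (hC : ∀ v, P (Ω v) = v - (1 / 4 : ℝ) • ρ (τs v - A (τs v))) (a : W) :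
    Ω (P a) = a - (1 / 4 : ℝ) • τ (ρs a - A' (ρs a)) := by
  rw [← sub_eq_zero]
  refine h.sepL _ fun v => ?_
  have h1 := hΩ (P a) v
  rw [hP, hC, neg_neg] at h1
  have h2 := h.adj_rho a (τs v)
  have h3 := h.adj_rho a (A (τs v))
  have h4 := h.adj_tau v (ρs a)
  have h5 := h.adj_tau v (A' (ρs a))
  have h6 := h.adj (ρs a) (τs v)
  have h7 := h.symm (ρs a) (τs v)
  have h8 := h.symm (A' (ρs a)) (τs v)
  simp only [map_sub, map_smul, LinearMap.sub_apply, LinearMap.smul_apply, smul_eq_mul] at *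
  linarith

/-- The kernel of `Ω`. -/
theorem ker_dual {Ω : V →ₗ[ℝ] W} (h : DualityData B p ρ τ ρs τs A A')
    (hΩ : ∀ v v', p (Ω v) v' = -p (Ω v') v)
    (hC : ∀ v, P (Ω v) = v - (1 / 4 : ℝ) • ρ (τs v - A (τs v)))
    (hΩρ : ∀ ξ, Ω (ρ ξ) = (1 / 2 : ℝ) • τ (ξ + A' ξ)) (v : V) :
    Ω v = 0 ↔ ∃ ξ, ξ + A ξ = 0 ∧ ρ ξ = v := by
  constructor
  · intro hv
    -- By skewness `Ω v = 0` also kills the pairing of `Ω (ρ ζ)` with `v`, which the moment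
    -- condition turns into an inner product with `ζ`.
    have h1 : τs v + A (τs v) = 0 := by
      refine h.nondeg _ fun ζ => ?_
      have e1 := hΩ v (ρ ζ)
      have e2 := h.adj_tau v ζ
      have e3 := h.adj_tau v (A' ζ)
      have e4 := h.adj ζ (τs v)
      have e5 := h.symm ζ (A (τs v))
      have e6 := h.symm (A' ζ) (τs v)
      rw [hv, hΩρ] at e1
      simp only [map_zero, map_smul, map_add, LinearMap.zero_apply, LinearMap.add_apply,
        LinearMap.smul_apply, smul_eq_mul] at *
      linarith
    -- The witness is read off from (*) at a vector with `Ω v = 0`; that it is negated by `A`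
    -- follows from `A (τs v) = -τs v`.
    refine ⟨(1 / 4 : ℝ) • (τs v - A (τs v)), ?_, ?_⟩
    · have h2 := congrArg A h1
      rw [map_add, map_zero] at h2
      have : (1 / 4 : ℝ) • (τs v - A (τs v)) + A ((1 / 4 : ℝ) • (τs v - A (τs v))) =
          (1 / 4 : ℝ) • ((τs v + A (τs v)) - (A (τs v) + A (A (τs v)))) := by
        rw [map_smul, map_sub]; module
      rw [this, h1, h2, sub_zero, smul_zero]
    · have h2 := hC v
      rw [hv, map_zero] at h2
      rw [map_smul]
      exact (sub_eq_zero.1 h2.symm).symm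
  · rintro ⟨ξ, hξ, rfl⟩
    have : ξ + A' ξ = 0 := by
      have := congrArg A' hξ
      rwa [map_add, h.left_inv, map_zero, add_comm] at this
    rw [hΩρ, this, map_zero, smul_zero]

end DualityData

end Duality

/-! ### Smooth families of linear maps and mixed partial derivatives. -/

section Calculus

variable {E F H K : Type*} [NormedAddCommGroup E] [NormedSpace ℝ E]
  [NormedAddCommGroup F] [NormedSpace ℝ F]
  [NormedAddCommGroup H] [NormedSpace ℝ H] [NormedAddCommGroup K] [NormedSpace ℝ K]

/-- A family of linear maps is smooth if its composite with a smooth family of surjections is. -/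
theorem contDiffAt_of_comp_surjective [FiniteDimensional ℝ H] [FiniteDimensional ℝ K]
    {S : E → H →L[ℝ] K} {L : E → H →L[ℝ] F} {Ω : E → K →L[ℝ] F} {x : E} {n : ℕ∞ω}
    (hS : ContDiffAt ℝ n S x) (hL : ContDiffAt ℝ n L x)
    (hsurj : Function.Surjective (S x)) (h : ∀ᶠ y in 𝓝 x, (Ω y).comp (S y) = L y) :
    ContDiffAt ℝ n Ω x := by
  -- With a fixed right inverse `R` of `S x`, the endomorphism `S y ∘ R` is the identity at `x`,
  -- hence invertible nearby, and `Ω y = L y ∘ R ∘ (S y ∘ R)⁻¹` there.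
  obtain ⟨R₀, hR₀⟩ := (S x).toLinearMap.exists_rightInverse_of_surjective
    (LinearMap.range_eq_top.2 hsurj)
  let R : K →L[ℝ] H := LinearMap.toContinuousLinearMap R₀
  have hR : (S x).comp R = ContinuousLinearMap.id ℝ K := by
    ext k; exact LinearMap.congr_fun hR₀ k
  have : CompleteSpace K := FiniteDimensional.complete ℝ K
  have hT : ContDiffAt ℝ n (fun y => (S y).comp R) x := hS.clm_comp contDiffAt_const
  have hu : (S x).comp R = ((1 : (K →L[ℝ] K)ˣ) : K →L[ℝ] K) := by rw [hR]; rfl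
  have hinv : ContDiffAt ℝ n (fun y => Ring.inverse ((S y).comp R)) x := by
    have := contDiffAt_ringInverse ℝ (n := n) (1 : (K →L[ℝ] K)ˣ)
    rw [← hu] at this
    exact this.comp x hT
  have hunit : ∀ᶠ y in 𝓝 x, IsUnit ((S y).comp R) := by
    have := hT.continuousAt.eventually (Units.isOpen.mem_nhds (x := (S x).comp R) (by
      rw [hu]; exact Units.isUnit _))
    exact this
  refine ((hL.clm_comp (contDiffAt_const (c := R))).clm_comp hinv).congr_of_eventuallyEq ?_
  filter_upwards [h, hunit] with y hy hyu
  have h1 : ((S y).comp R).comp (Ring.inverse ((S y).comp R)) = ContinuousLinearMap.id ℝ K :=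
    Ring.mul_inverse_cancel _ hyu
  rw [← hy, ContinuousLinearMap.comp_assoc (Ω y), ContinuousLinearMap.comp_assoc (Ω y), h1,
    ContinuousLinearMap.comp_id]

theorem fderiv_prod_left {a : E × F → K} {x : E} {y : F} (h : DifferentiableAt ℝ a (x, y)) (u : E) :
    fderiv ℝ (fun x' => a (x', y)) x u = fderiv ℝ a (x, y) (u, 0) := by
  have h1 : HasFDerivAt (fun x' : E => (x', y)) (ContinuousLinearMap.inl ℝ E F) x :=
    hasFDerivAt_prodMk_left x y
  have h2 := HasFDerivAt.comp (x := x) (f := fun x' : E => (x', y)) h.hasFDerivAt h1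
  have h3 := h2.fderiv
  rw [show (fun x' => a (x', y)) = a ∘ fun x' : E => (x', y) from rfl, h3]
  rfl

theorem fderiv_prod_right {a : E × F → K} {x : E} {y : F} (h : DifferentiableAt ℝ a (x, y))
    (v : F) : fderiv ℝ (fun y' => a (x, y')) y v = fderiv ℝ a (x, y) (0, v) := by
  have h1 : HasFDerivAt (fun y' : F => (x, y')) (ContinuousLinearMap.inr ℝ E F) y :=
    hasFDerivAt_prodMk_right x y
  have h2 := HasFDerivAt.comp (x := y) (f := fun y' : F => (x, y')) h.hasFDerivAt h1
  have h3 := h2.fderiv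
  rw [show (fun y' => a (x, y')) = a ∘ fun y' : F => (x, y') from rfl, h3]
  rfl

/-- Symmetry of mixed partial derivatives. -/
theorem fderiv_mixed {a : E × F → K} {x : E} {y : F} (h : ContDiffAt ℝ ∞ a (x, y)) (u : E) (v : F) :
    fderiv ℝ (fun x' => fderiv ℝ (fun y' => a (x', y')) y v) x u =
      fderiv ℝ (fun y' => fderiv ℝ (fun x' => a (x', y')) x u) y v := by
  have hd : ∀ᶠ q in 𝓝 (x, y), DifferentiableAt ℝ a q := by
    have h1 : ContDiffAt ℝ 1 a (x, y) := h.of_le (by exact_mod_cast le_top)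
    filter_upwards [h1.eventually (by simp)] with q hq
    exact hq.differentiableAt (by simp)
  have hd2 : DifferentiableAt ℝ (fderiv ℝ a) (x, y) :=
    (h.fderiv_right (m := 1) (by norm_cast)).differentiableAt (by simp)
  have e1 : (fun x' => fderiv ℝ (fun y' => a (x', y')) y v) =ᶠ[𝓝 x]
      fun x' => fderiv ℝ a (x', y) (0, v) := by
    have : ContinuousAt (fun x' : E => (x', y)) x := by fun_prop
    filter_upwards [this.eventually hd] with x' hx'
    exact fderiv_prod_right hx' v
  have e2 : (fun y' => fderiv ℝ (fun x' => a (x', y')) x u) =ᶠ[𝓝 y]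
      fun y' => fderiv ℝ a (x, y') (u, 0) := by
    have : ContinuousAt (fun y' : F => (x, y')) y := by fun_prop
    filter_upwards [this.eventually hd] with y' hy'
    exact fderiv_prod_left hy' u
  rw [e1.fderiv_eq, e2.fderiv_eq,
    fderiv_prod_left (a := fun q => fderiv ℝ a q (0, v)) (hd2.clm_apply (by fun_prop)),
    fderiv_prod_right (a := fun q => fderiv ℝ a q (u, 0)) (hd2.clm_apply (by fun_prop)),
    fderiv_clm_apply hd2 (by fun_prop), fderiv_clm_apply hd2 (by fun_prop)]
  have hs : IsSymmSndFDerivAt ℝ a (x, y) := h.isSymmSndFDerivAt (by simpa using ENat.LEInfty.out)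
  simp only [fderiv_fun_const, Pi.zero_apply, ContinuousLinearMap.comp_zero, zero_add,
    ContinuousLinearMap.flip_apply]
  exact hs _ _

end Calculus

/-! ### The differentiated compatibility relation. -/

section Identities

variable {E F : Type*} [NormedAddCommGroup E] [NormedSpace ℝ E]
  [NormedAddCommGroup F] [NormedSpace ℝ F]
  {B : E →L[ℝ] E →L[ℝ] ℝ} {br : E → E → E}
  {W : F → F →L[ℝ] F →L[ℝ] ℝ} {T : F → F →L[ℝ] E} {A : F → E →L[ℝ] E} {y₀ : F}

/-- In the application `W = ω♭`, `T` is the logarithmic derivative of the moment map, `A = Ad_Φ`, `X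
i = P♯ (α i)` and `Y i` is the adjoint of the action applied to `α i`. Hypothesis `h1` is the
transpose of (*), and `h2` comes from the transposed moment condition. Differentiating both
expresses the cyclic sum for `dω` through the derivatives of `X`, which make up the Schouten
bracket, and Lie brackets; the derivatives of `Y` cancel, and those of `T` enter only
antisymmetrized. -/
theorem cyclic_aux
    (hB : ∀ ξ ζ, B ξ ζ = B ζ ξ)
    (hW : DifferentiableAt ℝ W y₀) (hT : DifferentiableAt ℝ T y₀) (hA : DifferentiableAt ℝ A y₀)
    (hskew : ∀ u v, W y₀ u v = -W y₀ v u)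
    (hMC : ∀ u v, fderiv ℝ T y₀ u v - fderiv ℝ T y₀ v u = -br (T y₀ u) (T y₀ v))
    (hdA : ∀ u ζ, fderiv ℝ A y₀ u ζ = A y₀ (br (T y₀ u) ζ))
    {X : Fin 3 → F → F} {Y : Fin 3 → F → E} {α : Fin 3 → F →L[ℝ] ℝ}
    (hX : ∀ i, DifferentiableAt ℝ (X i) y₀) (hY : ∀ i, DifferentiableAt ℝ (Y i) y₀)
    (h1 : ∀ i v, ∀ᶠ y in 𝓝 y₀,
      W y (X i y) v = α i v - 1 / 4 * B (Y i y) (T y v - A y (T y v)))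
    (h2 : ∀ i, ∀ᶠ y in 𝓝 y₀, ∀ ζ, B ζ (T y (X i y) - A y (T y (X i y))) =
      1 / 2 * (B ζ (A y (Y i y)) - B (A y ζ) (Y i y))) :
    fderiv ℝ W y₀ (X 0 y₀) (X 1 y₀) (X 2 y₀) + fderiv ℝ W y₀ (X 1 y₀) (X 2 y₀) (X 0 y₀) +
        fderiv ℝ W y₀ (X 2 y₀) (X 0 y₀) (X 1 y₀) =
      α 2 (fderiv ℝ (X 1) y₀ (X 0 y₀)) + α 0 (fderiv ℝ (X 2) y₀ (X 1 y₀)) +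
        α 1 (fderiv ℝ (X 0) y₀ (X 2 y₀)) -
      (1 / 8 * (B (Y 2 y₀) (A y₀ (br (T y₀ (X 0 y₀)) (Y 1 y₀))) -
          B (A y₀ (br (T y₀ (X 0 y₀)) (Y 2 y₀))) (Y 1 y₀)) +
        1 / 8 * (B (Y 0 y₀) (A y₀ (br (T y₀ (X 1 y₀)) (Y 2 y₀))) -
          B (A y₀ (br (T y₀ (X 1 y₀)) (Y 0 y₀))) (Y 2 y₀)) +
        1 / 8 * (B (Y 1 y₀) (A y₀ (br (T y₀ (X 2 y₀)) (Y 0 y₀))) -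
          B (A y₀ (br (T y₀ (X 2 y₀)) (Y 1 y₀))) (Y 0 y₀))) +
      1 / 4 * (B (Y 2 y₀) (- br (T y₀ (X 0 y₀)) (T y₀ (X 1 y₀)) -
            A y₀ (br (T y₀ (X 0 y₀)) (T y₀ (X 1 y₀))) + A y₀ (br (T y₀ (X 1 y₀)) (T y₀ (X 0 y₀)))
              + A y₀ (br (T y₀ (X 0 y₀)) (T y₀ (X 1 y₀)))) +
        B (Y 0 y₀) (- br (T y₀ (X 1 y₀)) (T y₀ (X 2 y₀)) -
            A y₀ (br (T y₀ (X 1 y₀)) (T y₀ (X 2 y₀))) + A y₀ (br (T y₀ (X 2 y₀)) (T y₀ (X 1 y₀)))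
              + A y₀ (br (T y₀ (X 1 y₀)) (T y₀ (X 2 y₀)))) +
        B (Y 1 y₀) (- br (T y₀ (X 2 y₀)) (T y₀ (X 0 y₀)) -
            A y₀ (br (T y₀ (X 2 y₀)) (T y₀ (X 0 y₀))) + A y₀ (br (T y₀ (X 0 y₀)) (T y₀ (X 2 y₀)))
              + A y₀ (br (T y₀ (X 2 y₀)) (T y₀ (X 0 y₀))))) := by
  have d1 : ∀ i u v, fderiv ℝ W y₀ u (X i y₀) v + W y₀ (fderiv ℝ (X i) y₀ u) v =
      -(1 / 4 * (B (fderiv ℝ (Y i) y₀ u) (T y₀ v - A y₀ (T y₀ v)) +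
        B (Y i y₀) (fderiv ℝ T y₀ u v - fderiv ℝ A y₀ u (T y₀ v)
          - A y₀ (fderiv ℝ T y₀ u v)))) := by
    intro i u v
    have e' : (fun y => W y (X i y) v) =ᶠ[𝓝 y₀]
      fun y => α i v - 1 / 4 * B (Y i y) (T y v - A y (T y v)) := h1 i v
    have l := ((hW.hasFDerivAt.clm_apply (hX i).hasFDerivAt).clm_apply
      (hasFDerivAt_const v y₀)).fderiv
    have tv := hT.hasFDerivAt.clm_apply (hasFDerivAt_const v y₀)
    have r := (((((hasFDerivAt_const (𝕜 := ℝ) B y₀).clm_apply (hY i).hasFDerivAt).clm_apply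
      (tv.fun_sub (hA.hasFDerivAt.clm_apply tv))).const_mul (1 / 4)).const_sub (α i v)).fderiv
    have k := congrArg (fun f => f u) (l.symm.trans (e'.fderiv_eq.trans r))
    simp only [add_apply, ContinuousLinearMap.comp_apply,
      ContinuousLinearMap.flip_apply, neg_apply,
      smul_apply, sub_apply, smul_eq_mul,
      zero_apply, map_zero, zero_add, add_zero] at k
    simp only [map_sub, map_add] at k ⊢
    linarith
  -- Differentiating `h2` paired with `Y i` makes it possible to eliminate `T` applied to a
  -- derivative of `X`, which `h1` alone leaves behind.
  have d2 : ∀ i j u, B (fderiv ℝ (Y i) y₀ u) (T y₀ (X j y₀) - A y₀ (T y₀ (X j y₀))) +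
      B (Y i y₀) (fderiv ℝ T y₀ u (X j y₀) + T y₀ (fderiv ℝ (X j) y₀ u)
        - fderiv ℝ A y₀ u (T y₀ (X j y₀))
        - A y₀ (fderiv ℝ T y₀ u (X j y₀) + T y₀ (fderiv ℝ (X j) y₀ u))) =
      1 / 2 * (B (fderiv ℝ (Y i) y₀ u) (A y₀ (Y j y₀)) +
        B (Y i y₀) (fderiv ℝ A y₀ u (Y j y₀) + A y₀ (fderiv ℝ (Y j) y₀ u))
        - B (fderiv ℝ A y₀ u (Y i y₀) + A y₀ (fderiv ℝ (Y i) y₀ u)) (Y j y₀)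
        - B (A y₀ (Y i y₀)) (fderiv ℝ (Y j) y₀ u)) := by
    intro i j u
    have e' : (fun y => B (Y i y) (T y (X j y) - A y (T y (X j y)))) =ᶠ[𝓝 y₀]
      fun y => 1 / 2 * (B (Y i y) (A y (Y j y)) - B (A y (Y i y)) (Y j y)) := by
      filter_upwards [h2 j] with y hy using hy _
    have hc := hasFDerivAt_const (𝕜 := ℝ) B y₀
    have tv := hT.hasFDerivAt.clm_apply (hX j).hasFDerivAt
    have l := ((hc.clm_apply (hY i).hasFDerivAt).clm_apply
      (tv.fun_sub (hA.hasFDerivAt.clm_apply tv))).fderiv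
    have r := ((((hc.clm_apply (hY i).hasFDerivAt).clm_apply
      (hA.hasFDerivAt.clm_apply (hY j).hasFDerivAt)).sub
      ((hc.clm_apply (hA.hasFDerivAt.clm_apply (hY i).hasFDerivAt)).clm_apply
        (hY j).hasFDerivAt)).const_mul (1 / 2)).fderiv
    have k := congrArg (fun f => f u) (l.symm.trans (e'.fderiv_eq.trans r))
    simp only [add_apply, ContinuousLinearMap.comp_apply,
      ContinuousLinearMap.flip_apply,
      smul_apply, sub_apply, smul_eq_mul,
      zero_apply, add_zero] at k
    simp only [map_sub, map_add, add_apply] at k ⊢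
    linarith
  have c1 : ∀ i v, W y₀ (X i y₀) v = α i v - 1 / 4 * B (Y i y₀) (T y₀ v - A y₀ (T y₀ v)) :=
    fun i v => (h1 i v).self_of_nhds
  have c2 : ∀ i ζ, B ζ (T y₀ (X i y₀) - A y₀ (T y₀ (X i y₀))) =
      1 / 2 * (B ζ (A y₀ (Y i y₀)) - B (A y₀ ζ) (Y i y₀)) := fun i => (h2 i).self_of_nhds
  -- one cyclic summand, in which only first derivatives of `T` and `Y` survive
  have s : ∀ i j k, fderiv ℝ W y₀ (X i y₀) (X j y₀) (X k y₀) =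
      α k (fderiv ℝ (X j) y₀ (X i y₀))
      - 1 / 8 * (B (Y k y₀) (fderiv ℝ A y₀ (X i y₀) (Y j y₀)) +
        B (Y k y₀) (A y₀ (fderiv ℝ (Y j) y₀ (X i y₀)))
        - B (fderiv ℝ A y₀ (X i y₀) (Y k y₀)) (Y j y₀)
        - B (A y₀ (Y k y₀)) (fderiv ℝ (Y j) y₀ (X i y₀)))
      + 1 / 4 * B (Y k y₀) (fderiv ℝ T y₀ (X i y₀) (X j y₀)
          - fderiv ℝ A y₀ (X i y₀) (T y₀ (X j y₀)) - A y₀ (fderiv ℝ T y₀ (X i y₀) (X j y₀)))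
      - 1 / 4 * B (Y j y₀) (fderiv ℝ T y₀ (X i y₀) (X k y₀)
          - fderiv ℝ A y₀ (X i y₀) (T y₀ (X k y₀)) - A y₀ (fderiv ℝ T y₀ (X i y₀) (X k y₀)))
      - 1 / 8 * (B (fderiv ℝ (Y j) y₀ (X i y₀)) (A y₀ (Y k y₀)) -
          B (A y₀ (fderiv ℝ (Y j) y₀ (X i y₀))) (Y k y₀)) := by
    intro i j k
    have a1 := d1 j (X i y₀) (X k y₀)
    have a2 := d2 k j (X i y₀)
    have a3 := c1 k (fderiv ℝ (X j) y₀ (X i y₀))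
    have a4 := hskew (X k y₀) (fderiv ℝ (X j) y₀ (X i y₀))
    have a5 := c2 k (fderiv ℝ (Y j) y₀ (X i y₀))
    have a6 := c2 j (fderiv ℝ (Y k) y₀ (X i y₀))
    simp only [map_sub, map_add, add_apply] at a1 a2 a3 a5 a6 ⊢
    linarith
  rw [s 0 1 2, s 1 2 0, s 2 0 1]
  -- Against each `Y k` the cyclic sum contains the derivative of `T` in both orders with opposite
  -- signs, so the Maurer-Cartan equation removes it.
  have m1 : ∀ i j, fderiv ℝ T y₀ (X i y₀) (X j y₀) = fderiv ℝ T y₀ (X j y₀) (X i y₀)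
      - br (T y₀ (X i y₀)) (T y₀ (X j y₀)) := fun i j => by
    rw [sub_eq_add_neg, ← hMC]; abel
  rw [m1 0 1, m1 1 2, m1 2 0]
  simp only [hdA]
  -- After these symmetries of `B`, the four terms containing a derivative of `Y` in each summand
  -- cancel.
  have sy : ∀ i j k, B (A y₀ (fderiv ℝ (Y i) y₀ (X j y₀))) (Y k y₀) =
    B (Y k y₀) (A y₀ (fderiv ℝ (Y i) y₀ (X j y₀))) := fun i j k => hB _ _
  have sy' : ∀ i j k, B (A y₀ (Y i y₀)) (fderiv ℝ (Y j) y₀ (X k y₀)) =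
    B (fderiv ℝ (Y j) y₀ (X k y₀)) (A y₀ (Y i y₀)) := fun i j k => hB _ _
  simp only [map_sub, map_add, map_neg, sy, sy']
  ring

end Identities

/-! ### Two-forms and bivectors as linear maps, and coordinate formulas for `d` and the Schouten
bracket. -/

section Alternating

section Pointwise

variable {V : Type*} [AddCommGroup V] [Module ℝ V] [TopologicalSpace V]

theorem alt_two_swap (om : V [⋀^Fin 2]→L[ℝ] ℝ) (u v : V) : om ![u, v] = -om ![v, u] := by
  have h := om.toAlternatingMap.map_swap ![v, u] (i := 0) (j := 1) (by simp)
  have e : ![v, u] ∘ Equiv.swap (0 : Fin 2) 1 = ![u, v] := by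
    ext i; fin_cases i <;> simp
  rw [e] at h
  exact h

theorem alt_two_ext {om om' : V [⋀^Fin 2]→L[ℝ] ℝ} (h : ∀ u v, om ![u, v] = om' ![u, v]) :
    om = om' := by
  ext m
  have : m = ![m 0, m 1] := by ext i; fin_cases i <;> rfl
  rw [this]
  exact h _ _

variable [IsTopologicalAddGroup V] [ContinuousSMul ℝ V] [T2Space V] [FiniteDimensional ℝ V]

/-- The alternating 2-form of a skew bilinear form. -/
theorem exists_alt_two (b : V →ₗ[ℝ] V →ₗ[ℝ] ℝ) (hb : ∀ u v, b u v = -b v u) :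
    ∃ om : V [⋀^Fin 2]→L[ℝ] ℝ, ∀ u v, om ![u, v] = b u v := by
  have hc : Continuous fun m : Fin 2 → V => b (m 0) (m 1) := by
    let e := Module.finBasis ℝ V
    have : ∀ m : Fin 2 → V, b (m 0) (m 1) =
        ∑ i, ∑ j, e.coord i (m 0) * (e.coord j (m 1) * b (e i) (e j)) := fun m => by
      conv_lhs => rw [← e.sum_repr (m 0), ← e.sum_repr (m 1)]
      simp only [map_sum, LinearMap.sum_apply, map_smul, LinearMap.smul_apply, smul_eq_mul,
        Finset.mul_sum, Module.Basis.coord_apply]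
      rw [Finset.sum_comm]
      exact Finset.sum_congr rfl fun i _ => Finset.sum_congr rfl fun j _ => by ring
    simp only [this]
    refine continuous_finsetSum _ fun i _ => continuous_finsetSum _ fun j _ => ?_
    exact ((e.coord i).continuous_of_finiteDimensional.comp (continuous_apply 0)).mul
      (((e.coord j).continuous_of_finiteDimensional.comp (continuous_apply 1)).mul
        continuous_const)
  refine ⟨{ toFun := fun m => b (m 0) (m 1), map_update_add' := ?_, map_update_smul' := ?_,
            map_eq_zero_of_eq' := ?_, cont := hc }, fun u v => rfl⟩
  · intro _ m i x y
    fin_cases i <;> simp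
  · intro _ m i c x
    fin_cases i <;> simp
  · intro v i j hij hne
    have h0 : ∀ u, b u u = 0 := fun u => by linarith [hb u u]
    fin_cases i <;> fin_cases j
    · exact absurd rfl hne
    · change b (v 0) (v 1) = 0
      rw [show v 0 = v 1 from hij, h0]
    · change b (v 0) (v 1) = 0
      rw [show v 0 = v 1 from hij.symm, h0]
    · exact absurd rfl hne

end Pointwise

variable {D F : Type*} [NormedAddCommGroup D] [NormedSpace ℝ D]
  [NormedAddCommGroup F] [NormedSpace ℝ F] [FiniteDimensional ℝ F]

/-- `ω♭` as a continuous linear map. -/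
def flatCLM (om : F [⋀^Fin 2]→L[ℝ] ℝ) : F →L[ℝ] F →L[ℝ] ℝ :=
  LinearMap.toContinuousLinearMap (flat om)

/-- `P♯` as a continuous linear map. -/
def sharpCLM (P : (F →L[ℝ] ℝ) [⋀^Fin 2]→L[ℝ] ℝ) : (F →L[ℝ] ℝ) →L[ℝ] F :=
  LinearMap.toContinuousLinearMap (sharp P)

theorem flatCLM_apply (om : F [⋀^Fin 2]→L[ℝ] ℝ) (u v : F) : flatCLM om u v = om ![u, v] := rfl

theorem sharpCLM_apply (P : (F →L[ℝ] ℝ) [⋀^Fin 2]→L[ℝ] ℝ) (a : F →L[ℝ] ℝ) :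
    sharpCLM P a = sharp P a := rfl

theorem contDiffAt_clm_of_apply {H K : Type*} [NormedAddCommGroup H] [NormedSpace ℝ H]
    [NormedAddCommGroup K] [NormedSpace ℝ K] [FiniteDimensional ℝ H] {n : ℕ∞ω} {f : D → H →L[ℝ] K}
    {x : D} (h : ∀ v, ContDiffAt ℝ n (fun y => f y v) x) : ContDiffAt ℝ n f x := by
  let e := Module.finBasis ℝ H
  have : f = fun y => ∑ i, (LinearMap.toContinuousLinearMap (e.coord i)).smulRight (f y (e i)) := by
    ext y v
    conv_lhs => rw [← e.sum_repr v]
    simp [-Module.Basis.sum_repr]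
  rw [this]
  refine ContDiffAt.sum fun i _ => ?_
  exact (ContinuousLinearMap.smulRightL ℝ H K
    (LinearMap.toContinuousLinearMap (e.coord i))).contDiff.contDiffAt.comp x (h (e i))

theorem contDiffAt_alt_apply {F : Type*} [NormedAddCommGroup F] [NormedSpace ℝ F]
    {k : ℕ} {n : ℕ∞ω} {om : D → F [⋀^Fin k]→L[ℝ] ℝ} {x : D}
    (h : ContDiffAt ℝ n om x) (v : Fin k → F) : ContDiffAt ℝ n (fun y => om y v) x :=
  (ContinuousAlternatingMap.apply ℝ F ℝ v).contDiff.contDiffAt.comp x h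

theorem contDiffAt_flatCLM {n : ℕ∞ω} {om : D → F [⋀^Fin 2]→L[ℝ] ℝ} {x : D}
    (h : ContDiffAt ℝ n om x) : ContDiffAt ℝ n (fun y => flatCLM (om y)) x :=
  contDiffAt_clm_of_apply fun _ => contDiffAt_clm_of_apply fun _ => contDiffAt_alt_apply h _

/-- Covectors as alternating 1-forms. -/
def covectorToForm (F : Type*) [NormedAddCommGroup F] [NormedSpace ℝ F] :
    (F →L[ℝ] ℝ) →L[ℝ] F [⋀^Fin 1]→L[ℝ] ℝ :=
  (ContinuousAlternatingMap.ofSubsingletonLIE (𝕜 := ℝ) (E := F) (F := ℝ)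
    (0 : Fin 1)).toLinearIsometry.toContinuousLinearMap

theorem covectorToForm_apply {F : Type*} [NormedAddCommGroup F] [NormedSpace ℝ F]
    (a : F →L[ℝ] ℝ) (v : Fin 1 → F) : covectorToForm F a v = a (v 0) := rfl

/-- A skew bilinear form is counted twice by alternatization, hence the factor `1/2`. Its use is to
recover `ω` from `ω♭` by a continuous linear map, so that smoothness of the latter implies
smoothness of the former. -/
theorem eq_alternatize_flatCLM (om : F [⋀^Fin 2]→L[ℝ] ℝ) :
    om = (1 / 2 : ℝ) • ContinuousAlternatingMap.alternatizeUncurryFinCLM ℝ F ℝ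
      ((covectorToForm F).comp (flatCLM om)) := by
  refine alt_two_ext fun u v => ?_
  rw [ContinuousAlternatingMap.smul_apply, ContinuousAlternatingMap.alternatizeUncurryFinCLM_apply,
    ContinuousAlternatingMap.alternatizeUncurryFin_apply, Fin.sum_univ_two]
  have h := alt_two_swap om u v
  have h1 := flatCLM_apply om u v
  have h2 := flatCLM_apply om v u
  simp [covectorToForm_apply, Fin.removeNth] at *
  linarith

theorem contDiffAt_of_flatCLM {n : ℕ∞ω} {om : D → F [⋀^Fin 2]→L[ℝ] ℝ} {x : D}
    (h : ContDiffAt ℝ n (fun y => flatCLM (om y)) x) : ContDiffAt ℝ n om x := by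
  have h1 := (ContinuousAlternatingMap.alternatizeUncurryFinCLM ℝ F ℝ).contDiff.contDiffAt.comp x
    ((contDiffAt_const (c := (covectorToForm F))).clm_comp h)
  refine (h1.const_smul (1 / 2 : ℝ)).congr_of_eventuallyEq (Eventually.of_forall fun y => ?_)
  exact eq_alternatize_flatCLM (om y)

/-- The canonical isomorphism `V** ≃ V`. -/
def bidualEval (F : Type*) [NormedAddCommGroup F] [NormedSpace ℝ F] [FiniteDimensional ℝ F] :
    ((F →L[ℝ] ℝ) →L[ℝ] ℝ) →L[ℝ] F :=
  LinearMap.toContinuousLinearMap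
    { toFun := fun f : (F →L[ℝ] ℝ) →L[ℝ] ℝ => (Module.evalEquiv ℝ F).symm
        (f.toLinearMap ∘ₗ (LinearMap.toContinuousLinearMap (𝕜 := ℝ) (E := F) (F' := ℝ)).toLinearMap)
      map_add' := fun f g => by rw [← map_add]; rfl
      map_smul' := fun c f => by rw [RingHom.id_apply, ← map_smul]; rfl }

theorem contDiffAt_sharpCLM {n : ℕ∞ω} {P : D → (F →L[ℝ] ℝ) [⋀^Fin 2]→L[ℝ] ℝ} {x : D}
    (h : ContDiffAt ℝ n P x) : ContDiffAt ℝ n (fun y => sharpCLM (P y)) x := by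
  have : (fun y => sharpCLM (P y)) = fun y => (bidualEval F).comp (flatCLM (P y)) := rfl
  rw [this]
  exact contDiffAt_const.clm_comp (contDiffAt_flatCLM h)

theorem contDiffAt_of_sharpCLM {n : ℕ∞ω} {P : D → (F →L[ℝ] ℝ) [⋀^Fin 2]→L[ℝ] ℝ} {x : D}
    (h : ContDiffAt ℝ n (fun y => sharpCLM (P y)) x) : ContDiffAt ℝ n P x := by
  refine contDiffAt_of_flatCLM
    (contDiffAt_clm_of_apply fun a => contDiffAt_clm_of_apply fun b => ?_)
  have : (fun y => flatCLM (P y) a b) = fun y => b (sharpCLM (P y) a) := by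
    funext y; rw [flatCLM_apply, sharpCLM_apply, apply_sharp]
  rw [this]
  exact b.contDiff.contDiffAt.comp x (h.clm_apply contDiffAt_const)

theorem extDeriv_two_apply {om : F → F [⋀^Fin 2]→L[ℝ] ℝ} {x : F} (h : ContDiffAt ℝ ∞ om x)
    (v : Fin 3 → F) :
    extDeriv om x v = fderiv ℝ (fun y => flatCLM (om y)) x (v 0) (v 1) (v 2) +
      fderiv ℝ (fun y => flatCLM (om y)) x (v 1) (v 2) (v 0) +
      fderiv ℝ (fun y => flatCLM (om y)) x (v 2) (v 0) (v 1) := by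
  have hd : DifferentiableAt ℝ om x := h.differentiableAt (by simp)
  have hf : DifferentiableAt ℝ (fun y => flatCLM (om y)) x :=
    (contDiffAt_flatCLM h).differentiableAt (by simp)
  have key : ∀ u a b, fderiv ℝ (fun y => om y ![a, b]) x u =
      fderiv ℝ (fun y => flatCLM (om y)) x u a b := fun u a b => by
    have h1 := ((hf.hasFDerivAt.clm_apply (hasFDerivAt_const a x)).clm_apply
      (hasFDerivAt_const b x)).fderiv
    have h2 := congrArg (fun f => f u) h1
    simpa [flatCLM_apply] using h2
  have e : ∀ i : Fin 3, i.removeNth v = ![i.removeNth v 0, i.removeNth v 1] := fun i => by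
    ext j; fin_cases j <;> rfl
  rw [extDeriv_apply hd, Fin.sum_univ_three]
  have e0 : (0 : Fin 3).removeNth v = ![v 1, v 2] := by ext j; fin_cases j <;> rfl
  have e1 : (1 : Fin 3).removeNth v = ![v 0, v 2] := by ext j; fin_cases j <;> rfl
  have e2 : (2 : Fin 3).removeNth v = ![v 0, v 1] := by ext j; fin_cases j <;> rfl
  have sw : fderiv ℝ (fun y => om y ![v 0, v 2]) x (v 1) =
      -fderiv ℝ (fun y => om y ![v 2, v 0]) x (v 1) := by
    have : (fun y => om y ![v 0, v 2]) = fun y => -om y ![v 2, v 0] := by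
      funext y; exact alt_two_swap _ _ _
    rw [this, fderiv_fun_neg]; rfl
  rw [e0, e1, e2, sw, key, key, key]
  simp

/-- The two summands of the model bracket coincide when both arguments are `P`, and the derivative
of `P(a, b)` is `b` applied to the derivative of `P♯ a`. This matches the terms produced by
`cyclic_aux`. -/
theorem schoutenModel_self {P : F → (F →L[ℝ] ℝ) [⋀^Fin 2]→L[ℝ] ℝ} {x : F}
    (h : ContDiffAt ℝ ∞ P x) (α : Fin 3 → F →L[ℝ] ℝ) :
    schoutenModel P P x α =
      2 * (α 2 (fderiv ℝ (fun y => sharp (P y) (α 1)) x (sharp (P x) (α 0))) +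
        α 0 (fderiv ℝ (fun y => sharp (P y) (α 2)) x (sharp (P x) (α 1))) +
        α 1 (fderiv ℝ (fun y => sharp (P y) (α 0)) x (sharp (P x) (α 2)))) := by
  have hd : ∀ a, DifferentiableAt ℝ (fun y => sharp (P y) a) x := fun a =>
    ((contDiffAt_sharpCLM h).clm_apply (contDiffAt_const (c := a))).differentiableAt (by simp)
  have key : ∀ a b u, fderiv ℝ (fun y => P y ![a, b]) x u =
      b (fderiv ℝ (fun y => sharp (P y) a) x u) := fun a b u => by
    have : (fun y => P y ![a, b]) = fun y => b (sharp (P y) a) := by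
      funext y; rw [apply_sharp]
    rw [this]
    have h2 := (b.hasFDerivAt.comp x (hd a).hasFDerivAt).fderiv
    exact congrArg (fun f => f u) h2
  simp only [schoutenModel, Fin.sum_univ_three, key]
  have e1 : (1 : Fin 3) + 1 = 2 := rfl
  have e2 : (1 : Fin 3) + 2 = 0 := rfl
  have e3 : (2 : Fin 3) + 1 = 0 := rfl
  have e4 : (2 : Fin 3) + 2 = 1 := rfl
  simp only [zero_add, e1, e2, e3, e4]
  ring

end Alternating

/-! ### Exterior derivative on the image of `P♯` and along symmetries. -/

section Identities

variable {E F : Type*} [NormedAddCommGroup E] [NormedSpace ℝ E]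
  [NormedAddCommGroup F] [NormedSpace ℝ F]
  {B : E →L[ℝ] E →L[ℝ] ℝ} {br : E →ₗ[ℝ] E →ₗ[ℝ] E}

/-- Invariance makes `B(x, [y, z])` totally antisymmetric. After substituting `x i`, every term is a
value of this form on one member of each pair `c false i`, `c true i`; the rewrites `o1` to `o5`
bring all of them to the order `0, 1, 2`, and `hc` identifies the two unmixed values. -/
theorem cyclic_bracket_sum (hsymm : ∀ ξ ζ, B ξ ζ = B ζ ξ) (hanti : ∀ x y, br x y = -br y x)
    (hinv : ∀ x y z, B (br x y) z = -B y (br x z)) (c : Bool → Fin 3 → E)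
    (hc : B (c true 0) (br (c true 1) (c true 2)) = B (c false 0) (br (c false 1) (c false 2)))
    (x : Fin 3 → E) (hx : ∀ i, x i = -((1 / 2 : ℝ) • (c false i + c true i))) :
    -(1 / 8 * (B (c false 2) (br (x 0) (c true 1)) - B (c false 1) (br (x 0) (c true 2))) +
        1 / 8 * (B (c false 0) (br (x 1) (c true 2)) - B (c false 2) (br (x 1) (c true 0))) +
        1 / 8 * (B (c false 1) (br (x 2) (c true 0)) - B (c false 0) (br (x 2) (c true 1)))) +
      1 / 4 * (-B (c true 2) (br (x 0) (x 1)) - B (c false 2) (br (x 0) (x 1))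
        - B (c true 0) (br (x 1) (x 2)) - B (c false 0) (br (x 1) (x 2))
        - B (c true 1) (br (x 2) (x 0)) - B (c false 1) (br (x 2) (x 0))) =
    -(1 / 4 * B (c false 0) (br (c false 1) (c false 2))) +
      1 / 2 * B (x 0) (br (x 1) (x 2)) := by
  have cyc : ∀ u v w, B u (br v w) = B v (br w u) := fun u v w => by
    rw [hsymm u, hanti v w, map_neg, neg_apply, hinv, neg_neg]
  have anti : ∀ u v w, B u (br v w) = -B u (br w v) := fun u v w => by
    rw [hanti v w, map_neg]
  have o1 : ∀ p q r, B (c p 2) (br (c q 0) (c r 1)) = B (c q 0) (br (c r 1) (c p 2)) :=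
    fun p q r => cyc _ _ _
  have o2 : ∀ p q r, B (c p 1) (br (c q 2) (c r 0)) = B (c r 0) (br (c p 1) (c q 2)) :=
    fun p q r => by rw [cyc, cyc]
  have o3 : ∀ p q r, B (c p 0) (br (c q 2) (c r 1)) = -B (c p 0) (br (c r 1) (c q 2)) :=
    fun p q r => anti _ _ _
  have o4 : ∀ p q r, B (c p 1) (br (c q 0) (c r 2)) = -B (c q 0) (br (c p 1) (c r 2)) :=
    fun p q r => by rw [cyc, anti]
  have o5 : ∀ p q r, B (c p 2) (br (c q 1) (c r 0)) = -B (c r 0) (br (c q 1) (c p 2)) :=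
    fun p q r => by rw [anti, cyc]
  simp only [hx, map_neg, map_smul, map_add, LinearMap.neg_apply, LinearMap.smul_apply,
    LinearMap.add_apply, neg_apply, smul_apply, add_apply, smul_eq_mul, o1, o2, o3, o4, o5, hc]
  ring

variable [FiniteDimensional ℝ F]
  {om : F → F [⋀^Fin 2]→L[ℝ] ℝ} {P : F → (F →L[ℝ] ℝ) [⋀^Fin 2]→L[ℝ] ℝ}
  {T : F → F →L[ℝ] E} {A : F → E →L[ℝ] E} {R : F → (F →L[ℝ] ℝ) →L[ℝ] E} {y₀ : F}

/-- The relation between the exterior derivative of `ω` and the Schouten bracket of `P`. -/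
theorem extDeriv_sharp (hsymm : ∀ ξ ζ, B ξ ζ = B ζ ξ) (hanti : ∀ x y, br x y = -br y x)
    (hinv : ∀ x y z, B (br x y) z = -B y (br x z))
    (hom : ContDiffAt ℝ ∞ om y₀) (hP : ContDiffAt ℝ ∞ P y₀)
    (hT : DifferentiableAt ℝ T y₀) (hA : DifferentiableAt ℝ A y₀) (hR : DifferentiableAt ℝ R y₀)
    (hMC : ∀ u v, fderiv ℝ T y₀ u v - fderiv ℝ T y₀ v u = -br (T y₀ u) (T y₀ v))
    (hdA : ∀ u ζ, fderiv ℝ A y₀ u ζ = A y₀ (br (T y₀ u) ζ))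
    (hAbr : ∀ x y, A y₀ (br x y) = br (A y₀ x) (A y₀ y))
    (hAB : ∀ y ξ ζ, B (A y ξ) (A y ζ) = B ξ ζ)
    (hC : ∀ᶠ y in 𝓝 y₀, ∀ a v,
      om y ![sharp (P y) a, v] = a v - 1 / 4 * B (R y a) (T y v - A y (T y v)))
    (hTP : ∀ᶠ y in 𝓝 y₀, ∀ a,
      A y (T y (sharp (P y) a)) = -((1 / 2 : ℝ) • (R y a + A y (R y a))))
    (α : Fin 3 → F →L[ℝ] ℝ) :
    extDeriv om y₀ (fun i => sharp (P y₀) (α i)) =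
      1 / 2 * schoutenModel P P y₀ α -
        1 / 4 * B (R y₀ (α 0)) (br (R y₀ (α 1)) (R y₀ (α 2))) +
        1 / 2 * B (T y₀ (sharp (P y₀) (α 0)))
          (br (T y₀ (sharp (P y₀) (α 1))) (T y₀ (sharp (P y₀) (α 2)))) := by
  have hX : ∀ i, DifferentiableAt ℝ (fun y => sharp (P y) (α i)) y₀ := fun i =>
    ((contDiffAt_sharpCLM hP).clm_apply (contDiffAt_const (c := α i))).differentiableAt (by simp)
  have hY : ∀ i, DifferentiableAt ℝ (fun y => R y (α i)) y₀ := fun i =>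
    hR.clm_apply (differentiableAt_const _)
  have main := cyclic_aux (B := B) (br := fun x y => br x y) (W := fun y => flatCLM (om y))
    (T := T) (A := A)
    (X := fun i y => sharp (P y) (α i)) (Y := fun i y => R y (α i)) (α := α) hsymm
    ((contDiffAt_flatCLM hom).differentiableAt (by simp)) hT hA
    (fun u v => alt_two_swap (om y₀) u v) hMC hdA hX hY
    (fun i v => by
      filter_upwards [hC] with y hy
      exact hy (α i) v)
    -- With `hTP` and the isometry property, `T X - A T X` becomes `1/2 (A Y - A⁻¹ Y)`, stated here
    -- without the inverse.
    (fun i => by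
      filter_upwards [hTP] with y hy ζ
      have h1 := hAB y ζ (T y (sharp (P y) (α i)))
      have h2 := hAB y ζ (R y (α i))
      rw [hy] at h1
      rw [map_sub, hy, ← h1]
      simp only [map_neg, map_smul, map_add, smul_eq_mul, h2]
      ring)
  rw [extDeriv_two_apply hom, main, schoutenModel_self hP]
  -- The family `c` consists of `R α` for `false` and `A R α` for `true`; `x` is `A T P♯ α`. The
  -- final `A`'s drop out because `A` preserves both bracket and inner product.
  have alg := cyclic_bracket_sum (B := B) (br := br) hsymm hanti hinv
    (fun p i => if p then A y₀ (R y₀ (α i)) else R y₀ (α i))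
    (by simp only [if_true, Bool.false_eq_true, if_false]; rw [← hAbr, hAB])
    (fun i => A y₀ (T y₀ (sharp (P y₀) (α i))))
    (fun i => by simp only [if_true, Bool.false_eq_true, if_false]; exact hTP.self_of_nhds (α i))
  simp only [if_true, Bool.false_eq_true, if_false] at alg
  simp only [← hAbr, hAB] at alg
  have sw : ∀ x y z, B (A y₀ (br x y)) z = B z (A y₀ (br x y)) := fun x y z => hsymm _ _
  have an : ∀ i j, br (T y₀ (sharp (P y₀) (α i))) (T y₀ (sharp (P y₀) (α j))) =
      -br (T y₀ (sharp (P y₀) (α j))) (T y₀ (sharp (P y₀) (α i))) := fun i j => hanti _ _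
  rw [an 1 0, an 2 1, an 0 2]
  simp only [map_sub, map_add, map_neg, sw] at alg ⊢
  linarith

/-- Contraction of `dω` with an infinitesimal symmetry of `ω`. -/
theorem extDeriv_symmetry {ρ : F → F} {ξ : E} (hanti : ∀ x y, br x y = -br y x)
    (hom : ContDiffAt ℝ ∞ om y₀)
    (hT : DifferentiableAt ℝ T y₀) (hA : DifferentiableAt ℝ A y₀) (hρ : DifferentiableAt ℝ ρ y₀)
    (hMC : ∀ u v, fderiv ℝ T y₀ u v - fderiv ℝ T y₀ v u = -br (T y₀ u) (T y₀ v))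
    (hdA : ∀ u ζ, fderiv ℝ A y₀ u ζ = A y₀ (br (T y₀ u) ζ))
    (hM : ∀ᶠ y in 𝓝 y₀, ∀ v, om y ![ρ y, v] = 1 / 2 * B ξ (T y v + A y (T y v)))
    (hLie : ∀ u v, fderiv ℝ (fun y => flatCLM (om y)) y₀ (ρ y₀) u v +
      om y₀ ![fderiv ℝ ρ y₀ u, v] + om y₀ ![u, fderiv ℝ ρ y₀ v] = 0) (u v : F) :
    extDeriv om y₀ ![ρ y₀, u, v] =
      1 / 2 * B ξ (br (T y₀ u) (T y₀ v) - A y₀ (br (T y₀ u) (T y₀ v))) := by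
  have hW : DifferentiableAt ℝ (fun y => flatCLM (om y)) y₀ :=
    (contDiffAt_flatCLM hom).differentiableAt (by simp)
  -- Derivative of the moment condition. Antisymmetrized in `u` and `v`, it computes the
  -- differential of the 1-form `ι(ρ) ω`.
  have d1 : ∀ u v, fderiv ℝ (fun y => flatCLM (om y)) y₀ u (ρ y₀) v +
      om y₀ ![fderiv ℝ ρ y₀ u, v] = 1 / 2 * B ξ (fderiv ℝ T y₀ u v + fderiv ℝ A y₀ u (T y₀ v) +
        A y₀ (fderiv ℝ T y₀ u v)) := by
    intro u v
    have e' : (fun y => flatCLM (om y) (ρ y) v) =ᶠ[𝓝 y₀]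
        fun y => 1 / 2 * B ξ (T y v + A y (T y v)) := by
      filter_upwards [hM] with y hy using hy v
    have l := ((hW.hasFDerivAt.clm_apply hρ.hasFDerivAt).clm_apply
      (hasFDerivAt_const v y₀)).fderiv
    have tv := hT.hasFDerivAt.clm_apply (hasFDerivAt_const v y₀)
    have r := (((B ξ).hasFDerivAt.comp y₀
      (tv.fun_add (hA.hasFDerivAt.clm_apply tv))).const_mul (1 / 2)).fderiv
    have k := congrArg (fun f => f u) (l.symm.trans (e'.fderiv_eq.trans r))
    simp only [add_apply, ContinuousLinearMap.comp_apply, ContinuousLinearMap.flip_apply,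
      smul_apply, smul_eq_mul, zero_apply, map_zero, zero_add, flatCLM_apply] at k
    simp only [map_add] at k ⊢
    linarith
  have sk : ∀ u a b, fderiv ℝ (fun y => flatCLM (om y)) y₀ u a b =
      -fderiv ℝ (fun y => flatCLM (om y)) y₀ u b a := fun u a b => by
    have key : ∀ a b, fderiv ℝ (fun y => om y ![a, b]) y₀ u =
        fderiv ℝ (fun y => flatCLM (om y)) y₀ u a b := fun a b => by
      have h1 := ((hW.hasFDerivAt.clm_apply (hasFDerivAt_const a y₀)).clm_apply
        (hasFDerivAt_const b y₀)).fderiv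
      have h2 := congrArg (fun f => f u) h1
      simpa [flatCLM_apply] using h2
    rw [← key, ← key]
    have : (fun y => om y ![a, b]) = fun y => -om y ![b, a] := by
      funext y; exact alt_two_swap _ _ _
    rw [this, fderiv_fun_neg]; rfl
  rw [extDeriv_two_apply hom]
  simp only [Matrix.cons_val_zero, Matrix.cons_val_one, Matrix.cons_val]
  -- Cartan's formula in coordinates: with vanishing Lie derivative, `ι(ρ) dω = -d ι(ρ) ω`.
  have a1 := hLie u v
  have a2 := d1 u v
  have a3 := d1 v u
  have a4 := sk u v (ρ y₀)
  have a5 := alt_two_swap (om y₀) u (fderiv ℝ ρ y₀ v)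
  have m1 : fderiv ℝ T y₀ u v = fderiv ℝ T y₀ v u - br (T y₀ u) (T y₀ v) := by
    rw [sub_eq_add_neg, ← hMC]; abel
  rw [hdA, m1] at a2
  rw [hdA, hanti] at a3
  simp only [map_sub, map_add, map_neg] at a2 a3 ⊢
  linarith

end Identities

/-! ### Tangent maps as derivatives in charts. -/

section Charts

variable {F : Type*} [NormedAddCommGroup F] [NormedSpace ℝ F]
  {M : Type*} [TopologicalSpace M] [ChartedSpace F M]
  {F' : Type*} [NormedAddCommGroup F'] [NormedSpace ℝ F']
  {N : Type*} [TopologicalSpace N] [ChartedSpace F' N]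
  {Z : Type*} [NormedAddCommGroup Z] [NormedSpace ℝ Z]

theorem contDiffAt_chart_comp [IsManifold 𝓘(ℝ, F) ∞ M] {f : Z → M} {z : Z} {m₀ : M}
    (hf : ContMDiffAt 𝓘(ℝ, Z) 𝓘(ℝ, F) ∞ f z) (h : f z ∈ (extChartAt 𝓘(ℝ, F) m₀).source) :
    ContDiffAt ℝ ∞ (fun x => extChartAt 𝓘(ℝ, F) m₀ (f x)) z := by
  rw [extChartAt_source] at h
  exact ((contMDiffAt_extChartAt' h).comp z hf).contDiffAt

theorem contMDiffAt_chart_symm [IsManifold 𝓘(ℝ, F) ∞ M] {m₀ : M} {y : F}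
    (hy : y ∈ (extChartAt 𝓘(ℝ, F) m₀).target) :
    ContMDiffAt 𝓘(ℝ, F) 𝓘(ℝ, F) ∞ (extChartAt 𝓘(ℝ, F) m₀).symm y :=
  (contMDiffOn_extChartAt_symm m₀).contMDiffAt ((isOpen_extChartAt_target m₀).mem_nhds hy)

/-- The separate `y` lets the target chart be centred at a point only propositionally equal to `f
x`, in practice the identity of `G`. The equality is typed in the model spaces to avoid transport
between tangent spaces. -/
theorem mfderiv_eq_fderiv {f : M → N} {x : M} {y : N} (h : MDifferentiableAt 𝓘(ℝ, F) 𝓘(ℝ, F') f x)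
    (hy : f x = y) :
    @Eq (F →L[ℝ] F') (mfderiv 𝓘(ℝ, F) 𝓘(ℝ, F') f x)
      (fderiv ℝ (fun z => extChartAt 𝓘(ℝ, F') y (f ((extChartAt 𝓘(ℝ, F) x).symm z)))
        (extChartAt 𝓘(ℝ, F) x x)) := by
  subst hy
  have := h.mfderiv
  rw [modelWithCornersSelf_coe, Set.range_id, fderivWithin_univ] at this
  exact this

theorem mfderiv_eq_fderiv_source {f : F → N} {x : F} {y : N}
    (h : MDifferentiableAt 𝓘(ℝ, F) 𝓘(ℝ, F') f x) (hy : f x = y) :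
    @Eq (F →L[ℝ] F') (mfderiv 𝓘(ℝ, F) 𝓘(ℝ, F') f x)
      (fderiv ℝ (fun z => extChartAt 𝓘(ℝ, F') y (f z)) x) := by
  have := mfderiv_eq_fderiv h hy
  simpa only [extChartAt_model_space_eq_id, PartialEquiv.refl_coe, PartialEquiv.refl_symm, id]
    using this

theorem mfderiv_eq_fderiv_target {f : M → F'} {x : M}
    (h : MDifferentiableAt 𝓘(ℝ, F) 𝓘(ℝ, F') f x) :
    @Eq (F →L[ℝ] F') (mfderiv 𝓘(ℝ, F) 𝓘(ℝ, F') f x)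
      (fderiv ℝ (fun z => f ((extChartAt 𝓘(ℝ, F) x).symm z)) (extChartAt 𝓘(ℝ, F) x x)) := by
  have := mfderiv_eq_fderiv h rfl
  simpa only [extChartAt_model_space_eq_id, PartialEquiv.refl_coe, PartialEquiv.refl_symm, id]
    using this

end Charts

/-! ### A Lie group in its chart at the identity: adjoint action, logarithmic derivative and
bracket. -/

section LieGroup

variable {E : Type*} [NormedAddCommGroup E] [NormedSpace ℝ E]
  {G : Type*} [TopologicalSpace G] [ChartedSpace E G] [Group G] [LieGroup 𝓘(ℝ, E) ∞ G]
  {Z : Type*} [NormedAddCommGroup Z] [NormedSpace ℝ Z]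

/-- The chart at the identity. -/
abbrev chartOne (E : Type*) [NormedAddCommGroup E] [NormedSpace ℝ E]
    (G : Type*) [TopologicalSpace G] [ChartedSpace E G] [Group G] : PartialEquiv G E :=
  extChartAt 𝓘(ℝ, E) (1 : G)

variable (E G) in
/-- The coordinate of the identity. -/
abbrev origin : E := chartOne E G 1

theorem chartOne_symm_origin {E : Type*} [NormedAddCommGroup E] [NormedSpace ℝ E]
    {G : Type*} [TopologicalSpace G] [ChartedSpace E G] [Group G] :
    (chartOne E G).symm (origin E G) = 1 := extChartAt_to_inv 1

theorem contMDiffAt_chartOne_symm :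
    ContMDiffAt 𝓘(ℝ, E) 𝓘(ℝ, E) ∞ (chartOne E G).symm (origin E G) :=
  contMDiffAt_chart_symm (mem_extChartAt_target 1)

theorem contDiffAt_chartOne_comp {f : Z → G} {z : Z}
    (hf : ContMDiffAt 𝓘(ℝ, Z) 𝓘(ℝ, E) ∞ f z) (h : f z = 1) :
    ContDiffAt ℝ ∞ (fun x => chartOne E G (f x)) z :=
  contDiffAt_chart_comp hf (by rw [h]; exact mem_extChartAt_source 1)

theorem chartOne_left_inv_of_continuousAt {E : Type*} [NormedAddCommGroup E] [NormedSpace ℝ E]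
    {G : Type*} [TopologicalSpace G] [ChartedSpace E G] [Group G]
    {Z : Type*} [TopologicalSpace Z] {f : Z → G} {z : Z} (hf : ContinuousAt f z)
    (h : f z = 1) : ∀ᶠ x in 𝓝 z, (chartOne E G).symm (chartOne E G (f x)) = f x := by
  have : (chartOne E G).source ∈ 𝓝 (f z) := by rw [h]; exact extChartAt_source_mem_nhds 1
  filter_upwards [hf.preimage_mem_nhds this] with x hx
  exact (chartOne E G).left_inv hx

/-- The adjoint action, in the chart at the identity. -/
def adjointCoord (g : G) : E →L[ℝ] E :=
  fderiv ℝ (fun x => chartOne E G (g * (chartOne E G).symm x * g⁻¹)) (origin E G)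

/-- The left logarithmic derivative of a map into a Lie group, in the chart at the identity. -/
def logDeriv (Ψ : Z → G) (y : Z) : Z →L[ℝ] E :=
  fderiv ℝ (fun x => chartOne E G ((Ψ y)⁻¹ * Ψ x)) y

/-- The tangent maps at the identity of left translations, in the chart at the identity. -/
def leftCoord (a : E) : E →L[ℝ] E :=
  fderiv ℝ (fun b => chartOne E G ((chartOne E G).symm a * (chartOne E G).symm b)) (origin E G)

theorem Ad_eq_adjointCoord (g : G) : @Eq (E →L[ℝ] E) (Ad (E := E) g) (adjointCoord g) := by
  have h : MDifferentiableAt 𝓘(ℝ, E) 𝓘(ℝ, E) (fun x : G => g * x * g⁻¹) 1 :=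
    (contMDiffAt_const.mul (contMDiffAt_id (n := ∞)) |>.mul contMDiffAt_const).mdifferentiableAt
      (by simp)
  exact mfderiv_eq_fderiv h (by simp)

theorem contDiffAt_adjointCoord {Ψ : Z → G} {z : Z} (h : ContMDiffAt 𝓘(ℝ, Z) 𝓘(ℝ, E) ∞ Ψ z) :
    ContDiffAt ℝ ∞ (fun y => adjointCoord (E := E) (Ψ y)) z := by
  have h1 : ContMDiffAt 𝓘(ℝ, Z × E) 𝓘(ℝ, E) ∞ (fun p : Z × E => Ψ p.1) (z, origin E G) :=
    ContMDiffAt.comp (x := (z, origin E G)) (g := Ψ) h contDiffAt_fst.contMDiffAt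
  have h2 : ContMDiffAt 𝓘(ℝ, Z × E) 𝓘(ℝ, E) ∞ (fun p : Z × E => (chartOne E G).symm p.2)
      (z, origin E G) :=
    ContMDiffAt.comp (x := (z, origin E G)) (g := (chartOne E G).symm) contMDiffAt_chartOne_symm
      contDiffAt_snd.contMDiffAt
  have h3 := contDiffAt_chartOne_comp ((h1.mul h2).mul h1.inv)
    (by simp only [Pi.mul_apply, chartOne_symm_origin, mul_one]; exact mul_inv_cancel _)
  exact ContDiffAt.fderiv (f := fun y x => chartOne E G (Ψ y * (chartOne E G).symm x * (Ψ y)⁻¹))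
    (g := fun _ => origin E G) h3 contDiffAt_const (by simp)

theorem contDiffAt_logDeriv {Ψ : Z → G} {z : Z} (h : ContMDiffAt 𝓘(ℝ, Z) 𝓘(ℝ, E) ∞ Ψ z) :
    ContDiffAt ℝ ∞ (logDeriv (E := E) Ψ) z := by
  have h1 : ContMDiffAt 𝓘(ℝ, Z × Z) 𝓘(ℝ, E) ∞ (fun p : Z × Z => Ψ p.1) (z, z) :=
    ContMDiffAt.comp (x := (z, z)) (g := Ψ) h contDiffAt_fst.contMDiffAt
  have h2 : ContMDiffAt 𝓘(ℝ, Z × Z) 𝓘(ℝ, E) ∞ (fun p : Z × Z => Ψ p.2) (z, z) :=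
    ContMDiffAt.comp (x := (z, z)) (g := Ψ) h contDiffAt_snd.contMDiffAt
  have h3 := contDiffAt_chartOne_comp (h1.inv.mul h2) (by simp)
  exact ContDiffAt.fderiv (f := fun y x => chartOne E G ((Ψ y)⁻¹ * Ψ x))
    (g := fun y => y) h3 contDiffAt_id (by simp)

theorem contDiffAt_mulCoord : ContDiffAt ℝ ∞ (fun p : E × E =>
    chartOne E G ((chartOne E G).symm p.1 * (chartOne E G).symm p.2)) (origin E G, origin E G) := by
  have h1 : ContMDiffAt 𝓘(ℝ, E × E) 𝓘(ℝ, E) ∞ (fun p : E × E => (chartOne E G).symm p.1)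
      (origin E G, origin E G) :=
    ContMDiffAt.comp (x := (origin E G, origin E G)) (g := (chartOne E G).symm)
      contMDiffAt_chartOne_symm contDiffAt_fst.contMDiffAt
  have h2 : ContMDiffAt 𝓘(ℝ, E × E) 𝓘(ℝ, E) ∞ (fun p : E × E => (chartOne E G).symm p.2)
      (origin E G, origin E G) :=
    ContMDiffAt.comp (x := (origin E G, origin E G)) (g := (chartOne E G).symm)
      contMDiffAt_chartOne_symm contDiffAt_snd.contMDiffAt
  exact contDiffAt_chartOne_comp (h1.mul h2) (by
    simp only [chartOne_symm_origin, mul_one])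

theorem contDiffAt_leftCoord : ContDiffAt ℝ ∞ (leftCoord (E := E) (G := G)) (origin E G) :=
  ContDiffAt.fderiv (f := fun a b => chartOne E G ((chartOne E G).symm a * (chartOne E G).symm b))
    (g := fun _ => origin E G) contDiffAt_mulCoord contDiffAt_const (by simp)

/-- The chain rule through the chart at the identity, valid since `f z = 1`; it requires nothing of
`k` away from that chart. -/
theorem fderiv_chartOne_symm_comp {f : Z → G} {z : Z}
    (hf : ContMDiffAt 𝓘(ℝ, Z) 𝓘(ℝ, E) ∞ f z) (h : f z = 1) {Y : Type*} [NormedAddCommGroup Y]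
    [NormedSpace ℝ Y] {k : G → Y}
    (hk : DifferentiableAt ℝ (fun x => k ((chartOne E G).symm x)) (origin E G)) :
    fderiv ℝ (fun x => k (f x)) z =
      (fderiv ℝ (fun x => k ((chartOne E G).symm x)) (origin E G)).comp
        (fderiv ℝ (fun x => chartOne E G (f x)) z) := by
  have h1 := (contDiffAt_chartOne_comp hf h).differentiableAt (by simp)
  have e : (fun x => k (f x)) =ᶠ[𝓝 z]
      (fun x => k ((chartOne E G).symm x)) ∘ fun x => chartOne E G (f x) := by
    filter_upwards [chartOne_left_inv_of_continuousAt (E := E) hf.continuousAt h] with x hx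
    simp only [Function.comp_apply]
    rw [hx]
  have h0 : chartOne E G (f z) = origin E G := by rw [h]
  rw [e.fderiv_eq, fderiv_comp z (by rw [h0]; exact hk) h1, h0]

theorem differentiableAt_mulCoord_right : ∀ᶠ a in 𝓝 (origin E G), DifferentiableAt ℝ
    (fun b => chartOne E G ((chartOne E G).symm a * (chartOne E G).symm b)) (origin E G) := by
  have h1 : ContDiffAt ℝ 1 (fun p : E × E => chartOne E G ((chartOne E G).symm p.1 *
    (chartOne E G).symm p.2)) (origin E G, origin E G) := contDiffAt_mulCoord.of_le (by norm_cast)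
  have hc : ContinuousAt (fun a : E => (a, origin E G)) (origin E G) := by fun_prop
  filter_upwards [hc.eventually (h1.eventually (by simp))] with a ha
  exact (ha.differentiableAt (by simp)).comp (origin E G)
    (f := fun b : E => (a, b)) (by fun_prop)

theorem differentiableAt_mulCoord_left : ∀ᶠ a in 𝓝 (origin E G), DifferentiableAt ℝ
    (fun b => chartOne E G ((chartOne E G).symm b * (chartOne E G).symm a)) (origin E G) := by
  have h1 : ContDiffAt ℝ 1 (fun p : E × E => chartOne E G ((chartOne E G).symm p.1 *
    (chartOne E G).symm p.2)) (origin E G, origin E G) := contDiffAt_mulCoord.of_le (by norm_cast)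
  have hc : ContinuousAt (fun a : E => (origin E G, a)) (origin E G) := by fun_prop
  filter_upwards [hc.eventually (h1.eventually (by simp))] with a ha
  exact (ha.differentiableAt (by simp)).comp (origin E G)
    (f := fun b : E => (b, a)) (by fun_prop)

theorem fderiv_chartOne_self {E : Type*} [NormedAddCommGroup E] [NormedSpace ℝ E]
    {G : Type*} [TopologicalSpace G] [ChartedSpace E G] [Group G] :
    fderiv ℝ (fun x => chartOne E G ((chartOne E G).symm x))
    (origin E G) = ContinuousLinearMap.id ℝ E := by
  have e : (fun x => chartOne E G ((chartOne E G).symm x)) =ᶠ[𝓝 (origin E G)] id := by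
    filter_upwards [extChartAt_target_mem_nhds (I := 𝓘(ℝ, E)) (1 : G)] with x hx
    exact (chartOne E G).right_inv hx
  rw [e.fderiv_eq, fderiv_id]

theorem adjointCoord_one : adjointCoord (E := E) (1 : G) = ContinuousLinearMap.id ℝ E := by
  simp only [adjointCoord, one_mul, inv_one, mul_one]
  exact fderiv_chartOne_self

theorem leftCoord_origin : leftCoord (E := E) (G := G) (origin E G) =
    ContinuousLinearMap.id ℝ E := by
  simp only [leftCoord, chartOne_symm_origin, one_mul]
  exact fderiv_chartOne_self

/-- The bracket of the Lie algebra, on the model space. -/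
def lieCoord (G : Type*) [TopologicalSpace G] [ChartedSpace E G] [Group G] (ξ ζ : E) : E :=
  Bracket.bracket (L := LieAlg E G) (M := LieAlg E G) ξ ζ

theorem fderiv_apply_const {H K : Type*} [NormedAddCommGroup H] [NormedSpace ℝ H]
    [NormedAddCommGroup K] [NormedSpace ℝ K] {f : Z → H →L[ℝ] K} {z : Z}
    (h : DifferentiableAt ℝ f z) (u : Z) (v : H) :
    fderiv ℝ (fun y => f y v) z u = fderiv ℝ f z u v := by
  rw [(h.hasFDerivAt.clm_apply (hasFDerivAt_const v z)).fderiv]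
  simp

/-- The left-invariant vector fields, in the chart at the identity. -/
def leftFieldCoord (G : Type*) [TopologicalSpace G] [ChartedSpace E G] [Group G] (ξ : E) : E → E :=
  VectorField.mpullbackWithin 𝓘(ℝ, E) 𝓘(ℝ, E) (chartOne E G).symm
    (mulInvariantVectorField (I := 𝓘(ℝ, E)) (G := G) ξ) (Set.range 𝓘(ℝ, E))

/-- Connects the left-invariant fields that define the bracket of `GroupLieAlgebra` with the
explicit family `leftCoord`, so that the bracket can be computed by ordinary derivatives. -/
theorem leftFieldCoord_eventuallyEq (ξ : E) :
    leftFieldCoord G ξ =ᶠ[𝓝 (origin E G)] fun x => leftCoord (E := E) (G := G) x ξ := by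
  filter_upwards [extChartAt_target_mem_nhds (I := 𝓘(ℝ, E)) (1 : G)] with x hx
  have hinv := ContinuousLinearMap.inverse_eq
    (mfderivWithin_extChartAt_symm_comp_mfderiv_extChartAt (I := 𝓘(ℝ, E)) hx)
    (mfderiv_extChartAt_comp_mfderivWithin_extChartAt_symm (I := 𝓘(ℝ, E)) hx)
  rw [leftFieldCoord, VectorField.mpullbackWithin_apply, hinv]
  have hs : (chartOne E G).symm x ∈ (chartAt E (1 : G)).source := by
    have := (chartOne E G).map_target hx
    rwa [extChartAt_source] at this
  have h1 : MDifferentiableAt 𝓘(ℝ, E) 𝓘(ℝ, E) (chartOne E G) ((chartOne E G).symm x) :=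
    (contMDiffAt_extChartAt' (n := ∞) hs).mdifferentiableAt (by simp)
  have h2 : MDifferentiableAt 𝓘(ℝ, E) 𝓘(ℝ, E) (fun y : G => (chartOne E G).symm x * y) 1 :=
    (contMDiff_mul_left (n := ∞)).mdifferentiableAt (by simp)
  have h3 := mfderiv_comp_apply_of_eq (x := (1 : G)) h1 h2 (mul_one _) ξ
  have h4 := mfderiv_eq_fderiv_target (h1.comp_of_eq (x := (1 : G)) h2 (mul_one _))
  have h5 := congrArg (fun f : E →L[ℝ] E => f ξ) h4
  exact h3.symm.trans h5

/-- The bracket of the Lie algebra in the chart at the identity. -/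
theorem lieCoord_eq_leftCoord (ξ ζ : E) :
    lieCoord G ξ ζ = fderiv ℝ (leftCoord (E := E) (G := G)) (origin E G) ξ ζ -
      fderiv ℝ (leftCoord (E := E) (G := G)) (origin E G) ζ ξ := by
  have hL := (contDiffAt_leftCoord (E := E) (G := G)).differentiableAt (by simp)
  -- The chart centred at the identity has identity tangent map there, so the pullback in the
  -- definition of the manifold Lie bracket is trivial at this point.
  have hid : ∀ w : E,
      @Eq E ((mfderiv 𝓘(ℝ, E) 𝓘(ℝ, E) (extChartAt 𝓘(ℝ, E) (1 : G)) 1).inverse w) w := by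
    intro w
    have h1 : @Eq (E →L[ℝ] E) (mfderiv 𝓘(ℝ, E) 𝓘(ℝ, E) (extChartAt 𝓘(ℝ, E) (1 : G)) 1)
      (ContinuousLinearMap.id ℝ E) := mfderiv_extChartAt_self
    exact (congrArg (fun f : E →L[ℝ] E => f.inverse w) h1).trans (by simp)
  have h1 : lieCoord G ξ ζ = VectorField.lieBracketWithin ℝ (leftFieldCoord G ξ)
        (leftFieldCoord G ζ)
        ((chartOne E G).symm ⁻¹' Set.univ ∩ Set.range 𝓘(ℝ, E)) (origin E G) := hid _
  rw [show (chartOne E G).symm ⁻¹' Set.univ ∩ Set.range 𝓘(ℝ, E) = Set.univ by simp,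
    VectorField.lieBracketWithin_univ] at h1
  rw [h1, Filter.EventuallyEq.lieBracket_vectorField_eq (leftFieldCoord_eventuallyEq ξ)
    (leftFieldCoord_eventuallyEq ζ), VectorField.lieBracket, leftCoord_origin,
    fderiv_apply_const hL, fderiv_apply_const hL]
  simp

/-- The derivative of the adjoint action at the identity. -/
theorem fderiv_adjointCoord (ξ ζ : E) :
    fderiv ℝ (fun a => adjointCoord (E := E) ((chartOne E G).symm a)) (origin E G) ξ ζ =
      lieCoord G ξ ζ := by
  let R : E → E →L[ℝ] E := fun a =>
    fderiv ℝ (fun b => chartOne E G ((chartOne E G).symm b * (chartOne E G).symm a)) (origin E G)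
  have hR : ContDiffAt ℝ ∞ R (origin E G) := by
    refine ContDiffAt.fderiv
      (f := fun a b => chartOne E G ((chartOne E G).symm b * (chartOne E G).symm a))
      (g := fun _ => origin E G) (n := ∞) ?_ contDiffAt_const (by simp)
    exact ContDiffAt.comp (x := (origin E G, origin E G)) (f := fun p : E × E => (p.2, p.1))
      contDiffAt_mulCoord (by fun_prop)
  have hA := contDiffAt_adjointCoord (contMDiffAt_chartOne_symm (E := E) (G := G))
  -- Infinitesimal form of `a b = (a b a⁻¹) a`: left translation is the adjoint action followed by
  -- right translation `R a`.
  have hfac : leftCoord (E := E) (G := G) =ᶠ[𝓝 (origin E G)]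
      fun a => (R a).comp (adjointCoord (E := E) ((chartOne E G).symm a)) := by
    filter_upwards [differentiableAt_mulCoord_left (E := E) (G := G)] with a ha
    have hf : ContMDiffAt 𝓘(ℝ, E) 𝓘(ℝ, E) ∞ (fun b => (chartOne E G).symm a *
        (chartOne E G).symm b * ((chartOne E G).symm a)⁻¹) (origin E G) :=
      (contMDiffAt_const.mul contMDiffAt_chartOne_symm).mul contMDiffAt_const
    have := fderiv_chartOne_symm_comp hf (by simp only [chartOne_symm_origin]; group)
      (k := fun g => chartOne E G (g * (chartOne E G).symm a)) ha
    simp only [inv_mul_cancel_right] at this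
    exact this
  have hR0 : R (origin E G) = ContinuousLinearMap.id ℝ E := by
    simp only [R, chartOne_symm_origin, mul_one]
    exact fderiv_chartOne_self
  have hd := congrArg (fun f => f ξ ζ) (hfac.fderiv_eq.trans
    (fderiv_clm_comp (hR.differentiableAt (by simp)) (hA.differentiableAt (by simp))))
  simp only [add_apply, ContinuousLinearMap.comp_apply, ContinuousLinearMap.compL_apply,
    ContinuousLinearMap.flip_apply, hR0, ContinuousLinearMap.id_comp, chartOne_symm_origin,
    adjointCoord_one, ContinuousLinearMap.comp_id] at hd
  -- The derivatives of left and right translations are mixed second derivatives of the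
  -- multiplication, so that of `R` is that of `leftCoord` with its arguments exchanged. The
  -- difference is the bracket.
  have hmix := fderiv_mixed (contDiffAt_mulCoord (E := E) (G := G)) ζ ξ
  have e1 := fderiv_apply_const ((contDiffAt_leftCoord (E := E) (G := G)).differentiableAt
    (by simp)) ζ ξ
  have e2 := fderiv_apply_const (hR.differentiableAt (by simp)) ξ ζ
  have e3 := e1.symm.trans (hmix.trans e2)
  rw [lieCoord_eq_leftCoord, hd, e3]
  abel

theorem logDeriv_mul_left (g : G) (Ψ : Z → G) :
    logDeriv (E := E) (fun y => g * Ψ y) = logDeriv (E := E) Ψ := by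
  funext y
  simp only [logDeriv, mul_inv_rev, mul_assoc, inv_mul_cancel_left]

end LieGroup

/-! ### The Maurer-Cartan equation and invariance of the bracket. -/

section MaurerCartan

variable {E : Type*} [NormedAddCommGroup E] [NormedSpace ℝ E]
  {G : Type*} [TopologicalSpace G] [ChartedSpace E G] [Group G] [LieGroup 𝓘(ℝ, E) ∞ G]
  {Z : Type*} [NormedAddCommGroup Z] [NormedSpace ℝ Z]

theorem differentiableAt_logDeriv_aux {Ψ : Z → G} {z : Z}
    (h : ContMDiffAt 𝓘(ℝ, Z) 𝓘(ℝ, E) ∞ Ψ z) :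
    DifferentiableAt ℝ (fun x => chartOne E G ((Ψ z)⁻¹ * Ψ x)) z :=
  (contDiffAt_chartOne_comp (f := fun x => (Ψ z)⁻¹ * Ψ x) (contMDiffAt_const.mul h)
    (by simp)).differentiableAt (by simp)

theorem logDeriv_of_eq_one {Ψ : Z → G} {z : Z} (h : Ψ z = 1) :
    logDeriv (E := E) Ψ z = fderiv ℝ (fun x => chartOne E G (Ψ x)) z := by
  simp only [logDeriv, h, inv_one, one_mul]

/-- In coordinates, `θ^L` at a point is inverse to the tangent map of left translation to it.
Differentiating at the identity relates the derivative of `θ^L` to that of `leftCoord`, hence to the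
bracket. -/
theorem logDeriv_chartOne_symm_comp_leftCoord :
    ∀ᶠ a in 𝓝 (origin E G), (logDeriv (E := E) (chartOne E G).symm a).comp
      (leftCoord (E := E) (G := G) a) = ContinuousLinearMap.id ℝ E := by
  filter_upwards [extChartAt_target_mem_nhds (I := 𝓘(ℝ, E)) (1 : G),
    differentiableAt_mulCoord_right (E := E) (G := G)] with a ha hd
  have h0 : chartOne E G ((chartOne E G).symm a * (chartOne E G).symm (origin E G)) = a := by
    rw [chartOne_symm_origin, mul_one]; exact (chartOne E G).right_inv ha
  have h1 := differentiableAt_logDeriv_aux (contMDiffAt_chart_symm ha)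
  have hcomp := fderiv_comp (𝕜 := ℝ) (origin E G)
    (g := fun x => chartOne E G (((chartOne E G).symm a)⁻¹ * (chartOne E G).symm x))
    (f := fun b => chartOne E G ((chartOne E G).symm a * (chartOne E G).symm b))
    (by rw [h0]; exact h1) hd
  rw [h0] at hcomp
  rw [logDeriv, leftCoord, ← hcomp, ← fderiv_chartOne_self (E := E) (G := G)]
  refine EventuallyEq.fderiv_eq ?_
  have hc : ContinuousAt (fun b => (chartOne E G).symm a * (chartOne E G).symm b)
      (origin E G) :=
    (contMDiffAt_const.mul (contMDiffAt_chartOne_symm (E := E) (G := G))).continuousAt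
  have hsrc : (chartOne E G).source ∈ 𝓝 ((chartOne E G).symm a *
      (chartOne E G).symm (origin E G)) := by
    rw [chartOne_symm_origin, mul_one]
    exact extChartAt_source_mem_nhds' ((chartOne E G).map_target ha)
  filter_upwards [hc.preimage_mem_nhds hsrc] with b hb
  simp only [Function.comp_apply]
  rw [(chartOne E G).left_inv hb, inv_mul_cancel_left]

theorem logDeriv_chartOne_symm_origin : logDeriv (E := E) (chartOne E G).symm (origin E G) =
    ContinuousLinearMap.id ℝ E := by
  rw [logDeriv_of_eq_one chartOne_symm_origin, fderiv_chartOne_self]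

theorem fderiv_logDeriv_chartOne_symm (ξ ζ : E) :
    fderiv ℝ (logDeriv (E := E) (chartOne E G).symm) (origin E G) ξ ζ =
      -fderiv ℝ (leftCoord (E := E) (G := G)) (origin E G) ξ ζ := by
  have hθ := (contDiffAt_logDeriv (contMDiffAt_chartOne_symm (E := E)
    (G := G))).differentiableAt (by simp)
  have hL := (contDiffAt_leftCoord (E := E) (G := G)).differentiableAt (by simp)
  have e : (fun a => (logDeriv (E := E) (chartOne E G).symm a).comp
      (leftCoord (E := E) (G := G) a)) =ᶠ[𝓝 (origin E G)] fun _ => ContinuousLinearMap.id ℝ E :=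
    logDeriv_chartOne_symm_comp_leftCoord
  have hd := congrArg (fun f => f ξ ζ) (e.fderiv_eq.symm.trans (fderiv_clm_comp hθ hL))
  simp only [fderiv_fun_const, Pi.zero_apply, zero_apply, add_apply,
    ContinuousLinearMap.comp_apply, ContinuousLinearMap.compL_apply,
    ContinuousLinearMap.flip_apply, logDeriv_chartOne_symm_origin, leftCoord_origin,
    ContinuousLinearMap.id_comp, ContinuousLinearMap.comp_id] at hd
  exact eq_neg_of_add_eq_zero_right hd.symm

/-- The Maurer-Cartan equation at a point with value `1`. -/
theorem maurerCartan_of_eq_one {Ψ : Z → G} {z : Z} (h : ContMDiffAt 𝓘(ℝ, Z) 𝓘(ℝ, E) ∞ Ψ z)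
    (h1 : Ψ z = 1) (hev : ∀ᶠ y in 𝓝 z, ContMDiffAt 𝓘(ℝ, Z) 𝓘(ℝ, E) ∞ Ψ y) (u v : Z) :
    fderiv ℝ (logDeriv (E := E) Ψ) z u v - fderiv ℝ (logDeriv (E := E) Ψ) z v u =
      -lieCoord G (logDeriv (E := E) Ψ z u) (logDeriv (E := E) Ψ z v) := by
  let ψ : Z → E := fun x => chartOne E G (Ψ x)
  have hψ : ContDiffAt ℝ ∞ ψ z := contDiffAt_chartOne_comp h h1
  have hψz : ψ z = origin E G := by simp only [ψ, h1]
  -- Near a point with value `1`, the logarithmic derivative is the pullback of the coordinate form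
  -- of `θ^L` by `ψ`.
  have hfac : logDeriv (E := E) Ψ =ᶠ[𝓝 z]
      fun y => (logDeriv (E := E) (chartOne E G).symm (ψ y)).comp (fderiv ℝ ψ y) := by
    have hsrc : (chartOne E G).source ∈ 𝓝 (Ψ z) := by rw [h1]; exact extChartAt_source_mem_nhds 1
    have hs := h.continuousAt.preimage_mem_nhds hsrc
    filter_upwards [eventually_eventually_nhds.2 hs, hev] with y hy hΨy
    have hyy := hy.self_of_nhds
    have hd : DifferentiableAt ℝ ψ y := (contDiffAt_chart_comp hΨy hyy).differentiableAt (by simp)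
    have ht : ψ y ∈ (chartOne E G).target := (chartOne E G).map_source hyy
    have hd' := differentiableAt_logDeriv_aux (contMDiffAt_chart_symm ht)
    rw [logDeriv, logDeriv, ← fderiv_comp y hd' hd]
    refine EventuallyEq.fderiv_eq ?_
    filter_upwards [hy] with x hx
    simp only [Function.comp_apply, ψ]
    rw [(chartOne E G).left_inv hx, (chartOne E G).left_inv hyy]
  have hθ : DifferentiableAt ℝ (logDeriv (E := E) (chartOne E G).symm) (ψ z) := by
    rw [hψz]
    exact (contDiffAt_logDeriv (contMDiffAt_chartOne_symm (E := E)
    (G := G))).differentiableAt   (by simp)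
  have hψd : DifferentiableAt ℝ ψ z := hψ.differentiableAt (by simp)
  have hψ2 : DifferentiableAt ℝ (fderiv ℝ ψ) z :=
    (hψ.fderiv_right (m := 1) (by norm_cast)).differentiableAt (by simp)
  have hd : ∀ u v, fderiv ℝ (logDeriv (E := E) Ψ) z u v =
      fderiv ℝ (logDeriv (E := E) (chartOne E G).symm) (origin E G) (fderiv ℝ ψ z u)
        (fderiv ℝ ψ z v) + fderiv ℝ (fderiv ℝ ψ) z u v := fun u v => by
    have hcomp : fderiv ℝ (fun y => logDeriv (E := E) (chartOne E G).symm (ψ y)) z =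
        (fderiv ℝ (logDeriv (E := E) (chartOne E G).symm) (ψ z)).comp (fderiv ℝ ψ z) :=
      fderiv_comp z hθ hψd
    have := congrArg (fun f => f u v) (hfac.fderiv_eq.trans
      (fderiv_clm_comp (hθ.comp z hψd) hψ2))
    simp only [add_apply, ContinuousLinearMap.comp_apply, ContinuousLinearMap.compL_apply,
      ContinuousLinearMap.flip_apply] at this
    rw [this, add_comm]
    congr 1
    · erw [hcomp]
      simp only [ContinuousLinearMap.comp_apply, hψz]
    · simp only [hψz, logDeriv_chartOne_symm_origin, ContinuousLinearMap.id_apply]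
  -- The second derivative of `ψ` is symmetric and drops out of the antisymmetrization.
  have hsym : IsSymmSndFDerivAt ℝ ψ z := hψ.isSymmSndFDerivAt (by simpa using ENat.LEInfty.out)
  have hz : logDeriv (E := E) Ψ z = fderiv ℝ ψ z := logDeriv_of_eq_one h1
  rw [hd, hd, hz, hsym u v, fderiv_logDeriv_chartOne_symm, fderiv_logDeriv_chartOne_symm,
    lieCoord_eq_leftCoord]
  abel

/-- The Maurer-Cartan equation. -/
theorem maurerCartan {Ψ : Z → G} {z : Z}
    (hev : ∀ᶠ y in 𝓝 z, ContMDiffAt 𝓘(ℝ, Z) 𝓘(ℝ, E) ∞ Ψ y) (u v : Z) :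
    fderiv ℝ (logDeriv (E := E) Ψ) z u v - fderiv ℝ (logDeriv (E := E) Ψ) z v u =
      -lieCoord G (logDeriv (E := E) Ψ z u) (logDeriv (E := E) Ψ z v) := by
  -- The logarithmic derivative is unchanged by a constant left factor, so the value at `z` may be
  -- moved to `1`.
  have hev' : ∀ᶠ y in 𝓝 z, ContMDiffAt 𝓘(ℝ, Z) 𝓘(ℝ, E) ∞ (fun x => (Ψ z)⁻¹ * Ψ x) y := by
    filter_upwards [hev] with y hy
    exact contMDiffAt_const.mul hy
  have := maurerCartan_of_eq_one hev'.self_of_nhds (by simp) hev' u v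
  rwa [logDeriv_mul_left] at this

theorem adjointCoord_mul (g h : G) :
    adjointCoord (E := E) (g * h) = (adjointCoord g).comp (adjointCoord h) := by
  have hf : ∀ g : G, ContMDiffAt 𝓘(ℝ, E) 𝓘(ℝ, E) ∞ (fun x => g * (chartOne E G).symm x * g⁻¹)
      (origin E G) := fun g =>
    (contMDiffAt_const.mul contMDiffAt_chartOne_symm).mul contMDiffAt_const
  have hf1 : ∀ g : G, g * (chartOne E G).symm (origin E G) * g⁻¹ = 1 := fun g => by
    rw [chartOne_symm_origin]; group
  have := fderiv_chartOne_symm_comp (hf h) (hf1 h) (k := fun x => chartOne E G (g * x * g⁻¹))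
    ((contDiffAt_chartOne_comp (hf g) (hf1 g)).differentiableAt (by simp))
  rw [adjointCoord, adjointCoord, adjointCoord, ← this]
  simp only [mul_assoc, mul_inv_rev]

/-- The derivative of `Ad_Ψ`. -/
theorem fderiv_adjointCoord_comp {Ψ : Z → G} {z : Z}
    (h : ContMDiffAt 𝓘(ℝ, Z) 𝓘(ℝ, E) ∞ Ψ z) (u : Z) (ζ : E) :
    fderiv ℝ (fun y => adjointCoord (E := E) (Ψ y)) z u ζ =
      adjointCoord (Ψ z) (lieCoord G (logDeriv (E := E) Ψ z u) ζ) := by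
  have h1 : ContMDiffAt 𝓘(ℝ, Z) 𝓘(ℝ, E) ∞ (fun x => (Ψ z)⁻¹ * Ψ x) z := contMDiffAt_const.mul h
  have hk := (contDiffAt_adjointCoord (contMDiffAt_chartOne_symm (E := E)
    (G := G))).differentiableAt (by simp)
  have h2 := fderiv_chartOne_symm_comp h1 (by simp) (k := fun g => adjointCoord (E := E) g) hk
  -- Splitting off the constant factor `Ad_{Ψ z}` leaves the adjoint action along a map with value
  -- `1` at `z`, where its derivative is the bracket.
  have h3 : (fun y => adjointCoord (E := E) (Ψ y)) =
      fun y => (adjointCoord (Ψ z)).comp (adjointCoord ((Ψ z)⁻¹ * Ψ y)) := by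
    funext y; rw [← adjointCoord_mul, mul_inv_cancel_left]
  have h4 := (contDiffAt_adjointCoord h1).differentiableAt (by simp)
  rw [h3, fderiv_clm_comp (by fun_prop) h4]
  simp only [fderiv_fun_const, Pi.zero_apply, ContinuousLinearMap.comp_zero, add_zero,
    ContinuousLinearMap.comp_apply, ContinuousLinearMap.compL_apply]
  rw [h2, ContinuousLinearMap.comp_apply, fderiv_adjointCoord]
  rfl

/-- The bracket as a bilinear map. -/
def lieLin (E : Type*) [NormedAddCommGroup E] [NormedSpace ℝ E] (G : Type*) [TopologicalSpace G]
    [ChartedSpace E G] [Group G] : E →ₗ[ℝ] E →ₗ[ℝ] E :=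
  -- Taking the derivative of `Ad` at the identity as the definition makes bilinearity automatic.
  ContinuousLinearMap.coeLM ℝ ∘ₗ
    (fderiv ℝ (fun a => adjointCoord (E := E) ((chartOne E G).symm a)) (origin E G)).toLinearMap

theorem lieLin_apply (ξ ζ : E) : lieLin E G ξ ζ = lieCoord G ξ ζ := fderiv_adjointCoord ξ ζ

theorem lieLin_antisymm (ξ ζ : E) : lieLin E G ξ ζ = -lieLin E G ζ ξ := by
  rw [lieLin_apply, lieLin_apply, lieCoord_eq_leftCoord, lieCoord_eq_leftCoord]
  abel

theorem adjointCoord_inv_apply (g : G) (ξ : E) : adjointCoord g⁻¹ (adjointCoord g ξ) = ξ := by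
  rw [← ContinuousLinearMap.comp_apply, ← adjointCoord_mul, inv_mul_cancel, adjointCoord_one]
  rfl

theorem adjointCoord_apply_inv (g : G) (ξ : E) : adjointCoord g (adjointCoord g⁻¹ ξ) = ξ := by
  rw [← ContinuousLinearMap.comp_apply, ← adjointCoord_mul, mul_inv_cancel, adjointCoord_one]
  rfl

/-- Two derivatives at `x = 1` of `Ad_{g x g⁻¹} = Ad_g Ad_x Ad_{g⁻¹}`, evaluated on `Ad_g ζ`. -/
theorem adjointCoord_lie (g : G) (ξ ζ : E) :
    adjointCoord g (lieLin E G ξ ζ) = lieLin E G (adjointCoord g ξ) (adjointCoord g ζ) := by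
  have hf : ContMDiffAt 𝓘(ℝ, E) 𝓘(ℝ, E) ∞ (fun x => g * (chartOne E G).symm x * g⁻¹)
      (origin E G) :=
    (contMDiffAt_const.mul contMDiffAt_chartOne_symm).mul contMDiffAt_const
  have hf1 : g * (chartOne E G).symm (origin E G) * g⁻¹ = 1 := by
    rw [chartOne_symm_origin]; group
  have h1 := fderiv_adjointCoord_comp hf ξ (adjointCoord g ζ)
  rw [logDeriv_of_eq_one (Ψ := fun x => g * (chartOne E G).symm x * g⁻¹) hf1, hf1,
    adjointCoord_one] at h1
  have hA := (contDiffAt_adjointCoord (contMDiffAt_chartOne_symm (E := E)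
    (G := G))).differentiableAt (by simp)
  have h3 : (fun x => adjointCoord (E := E) (g * (chartOne E G).symm x * g⁻¹)) =
      fun x => (adjointCoord g).comp ((adjointCoord ((chartOne E G).symm x)).comp
        (adjointCoord g⁻¹)) := by
    funext x; rw [adjointCoord_mul, adjointCoord_mul]; rfl
  rw [h3, fderiv_clm_comp (by fun_prop) (hA.clm_comp (by fun_prop)),
    fderiv_clm_comp hA (by fun_prop)] at h1
  simp only [fderiv_fun_const, Pi.zero_apply, ContinuousLinearMap.comp_zero, add_zero, zero_add,
    ContinuousLinearMap.comp_apply, ContinuousLinearMap.compL_apply,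
    ContinuousLinearMap.flip_apply, fderiv_adjointCoord, adjointCoord_inv_apply] at h1
  rw [lieLin_apply, lieLin_apply, h1]
  rfl

/-- Derivative at the identity of the constant function `B(Ad_a ξ, Ad_a ζ)` of `a`. -/
theorem lie_invariant {B : E →L[ℝ] E →L[ℝ] ℝ}
    (hB : ∀ (g : G) ξ ζ, B (adjointCoord g ξ) (adjointCoord g ζ) = B ξ ζ) (x ξ ζ : E) :
    B (lieLin E G x ξ) ζ = -B ξ (lieLin E G x ζ) := by
  have hA := (contDiffAt_adjointCoord (contMDiffAt_chartOne_symm (E := E)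
    (G := G))).differentiableAt (by simp)
  have e : (fun a => B (adjointCoord (E := E) ((chartOne E G).symm a) ξ)
      (adjointCoord (E := E) ((chartOne E G).symm a) ζ)) = fun _ => B ξ ζ := by
    funext a; exact hB _ _ _
  have h1 : ∀ ξ, HasFDerivAt (fun a => adjointCoord (E := E) ((chartOne E G).symm a) ξ) _
      (origin E G) := fun ξ => hA.hasFDerivAt.clm_apply (hasFDerivAt_const ξ _)
  have h2 := (((hasFDerivAt_const (𝕜 := ℝ) B (origin E G)).clm_apply (h1 ξ)).clm_apply
    (h1 ζ)).fderiv
  rw [e] at h2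
  have h3 := congrArg (fun f => f x) h2
  simp only [fderiv_fun_const, Pi.zero_apply, zero_apply, add_apply,
    ContinuousLinearMap.comp_apply, ContinuousLinearMap.flip_apply, map_zero, zero_add, add_zero,
    chartOne_symm_origin, adjointCoord_one, ContinuousLinearMap.id_apply,
    fderiv_adjointCoord] at h3
  rw [lieLin_apply, lieLin_apply]
  linarith

end MaurerCartan

/-! ### Derivatives of products and inverses at the identity. -/

section Product

variable {E : Type*} [NormedAddCommGroup E] [NormedSpace ℝ E]
  {G : Type*} [TopologicalSpace G] [ChartedSpace E G] [Group G] [LieGroup 𝓘(ℝ, E) ∞ G]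
  {Z : Type*} [NormedAddCommGroup Z] [NormedSpace ℝ Z]

/-- The tangent map of the multiplication at `(1, 1)` is addition, because it restricts to the
identity on each factor. -/
theorem fderiv_chartOne_mul {f₁ f₂ : Z → G} {z : Z} (h₁ : ContMDiffAt 𝓘(ℝ, Z) 𝓘(ℝ, E) ∞ f₁ z)
    (h₂ : ContMDiffAt 𝓘(ℝ, Z) 𝓘(ℝ, E) ∞ f₂ z) (e₁ : f₁ z = 1) (e₂ : f₂ z = 1) (u : Z) :
    fderiv ℝ (fun x => chartOne E G (f₁ x * f₂ x)) z u =
      fderiv ℝ (fun x => chartOne E G (f₁ x)) z u +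
        fderiv ℝ (fun x => chartOne E G (f₂ x)) z u := by
  have hμ := (contDiffAt_mulCoord (E := E) (G := G)).differentiableAt (by simp)
  have d₁ := (contDiffAt_chartOne_comp h₁ e₁).differentiableAt (by simp)
  have d₂ := (contDiffAt_chartOne_comp h₂ e₂).differentiableAt (by simp)
  have hpair : (chartOne E G (f₁ z), chartOne E G (f₂ z)) = (origin E G, origin E G) := by
    simp only [e₁, e₂, origin]
  have e : (fun x => chartOne E G (f₁ x * f₂ x)) =ᶠ[𝓝 z]
      (fun p : E × E => chartOne E G ((chartOne E G).symm p.1 * (chartOne E G).symm p.2)) ∘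
        fun x => (chartOne E G (f₁ x), chartOne E G (f₂ x)) := by
    filter_upwards [chartOne_left_inv_of_continuousAt (E := E) h₁.continuousAt e₁,
      chartOne_left_inv_of_continuousAt (E := E) h₂.continuousAt e₂] with x hx₁ hx₂
    simp only [Function.comp_apply]
    rw [hx₁, hx₂]
  rw [e.fderiv_eq, fderiv_comp z (by rw [hpair]; exact hμ) (d₁.prodMk d₂), hpair,
    d₁.fderiv_prodMk d₂]
  have l := fderiv_prod_left hμ (fderiv ℝ (fun x => chartOne E G (f₁ x)) z u)
  have r := fderiv_prod_right hμ (fderiv ℝ (fun x => chartOne E G (f₂ x)) z u)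
  simp only [chartOne_symm_origin, mul_one, one_mul, fderiv_chartOne_self,
    ContinuousLinearMap.id_apply] at l r
  rw [ContinuousLinearMap.comp_apply, ContinuousLinearMap.prod_apply]
  have key : ∀ (L : E × E →L[ℝ] E) (a b : E), L (a, b) = L (a, 0) + L (0, b) := fun L a b => by
    rw [← map_add]; simp
  rw [key, ← l, ← r]

theorem fderiv_chartOne_inv {f : Z → G} {z : Z} (h : ContMDiffAt 𝓘(ℝ, Z) 𝓘(ℝ, E) ∞ f z)
    (e : f z = 1) (u : Z) :
    fderiv ℝ (fun x => chartOne E G (f x)⁻¹) z u = -fderiv ℝ (fun x => chartOne E G (f x)) z u := by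
  have := fderiv_chartOne_mul h h.inv e (by simp [e]) u
  simp only [mul_inv_cancel, fderiv_fun_const, Pi.zero_apply, zero_apply] at this
  exact eq_neg_of_add_eq_zero_right this.symm

end Product

/-! ### The adjoint action and the Maurer-Cartan forms. -/

section LieGroup

variable {E : Type*} [NormedAddCommGroup E] [NormedSpace ℝ E]
  {G : Type*} [TopologicalSpace G] [ChartedSpace E G] [Group G] [LieGroup 𝓘(ℝ, E) ∞ G]

theorem Ad_apply (g : G) (ξ : LieAlg E G) : @Eq E (Ad g ξ) (adjointCoord (E := E) g ξ) :=
  congrArg (fun f : E →L[ℝ] E => f ξ) (Ad_eq_adjointCoord g)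

theorem Ad_mul_apply (g h : G) (ξ : LieAlg E G) : Ad (g * h) ξ = Ad g (Ad h ξ) := by
  have h1 := congrArg (fun f : E →L[ℝ] E => f ξ) (adjointCoord_mul (E := E) g h)
  have h2 := congrArg (fun x : E => adjointCoord (E := E) g x) (Ad_apply h ξ)
  exact (Ad_apply (g * h) ξ).trans (h1.trans (h2.symm.trans (Ad_apply g (Ad h ξ)).symm))

theorem Ad_one_apply (ξ : LieAlg E G) : Ad (1 : G) ξ = ξ :=
  (Ad_apply 1 ξ).trans (congrArg (fun f : E →L[ℝ] E => f ξ) adjointCoord_one)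

theorem Ad_inv_Ad (g : G) (ξ : LieAlg E G) : Ad g⁻¹ (Ad g ξ) = ξ := by
  rw [← Ad_mul_apply, inv_mul_cancel, Ad_one_apply]

theorem Ad_Ad_inv (g : G) (ξ : LieAlg E G) : Ad g (Ad g⁻¹ ξ) = ξ := by
  rw [← Ad_mul_apply, mul_inv_cancel, Ad_one_apply]

theorem mdiff_mul_left (g x : G) : MDifferentiableAt 𝓘(ℝ, E) 𝓘(ℝ, E) (fun y : G => g * y) x :=
  (contMDiff_mul_left (n := ∞)).mdifferentiableAt (by simp)

theorem mdiff_mul_right (g x : G) : MDifferentiableAt 𝓘(ℝ, E) 𝓘(ℝ, E) (fun y : G => y * g) x :=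
  (contMDiff_mul_right (n := ∞)).mdifferentiableAt (by simp)

theorem mdiff_conj (g x : G) :
    MDifferentiableAt 𝓘(ℝ, E) 𝓘(ℝ, E) (fun y : G => g * y * g⁻¹) x :=
  (contMDiffAt_const.mul (contMDiffAt_id (n := ∞)) |>.mul contMDiffAt_const).mdifferentiableAt
      (by simp)

theorem thetaR_eq (g : G) (w : Tan E g) : thetaR g w = Ad g (thetaL g w) := by
  have h := mfderiv_comp_apply_of_eq (x := g) (mdiff_conj (E := E) g 1) (mdiff_mul_left g⁻¹ g)
    (inv_mul_cancel g) w
  have e : (fun y : G => g * y * g⁻¹) ∘ (fun y => g⁻¹ * y) = fun y => y * g⁻¹ := by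
    funext y; simp
  rw [e] at h
  exact h

theorem leftField_thetaL (g : G) (w : Tan E g) : leftField (thetaL g w) g = w := by
  have h := mfderiv_comp_apply_of_eq (x := g) (mdiff_mul_left (E := E) g 1) (mdiff_mul_left g⁻¹ g)
    (inv_mul_cancel g) w
  have e : (fun y : G => g * y) ∘ (fun y => g⁻¹ * y) = id := by
    funext y; simp
  rw [e, mfderiv_id] at h
  exact h.symm

theorem thetaL_leftField (g : G) (ξ : LieAlg E G) : thetaL g (leftField ξ g) = ξ := by
  have h := mfderiv_comp_apply_of_eq (x := (1 : G)) (mdiff_mul_left (E := E) g⁻¹ g)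
    (mdiff_mul_left g 1) (mul_one g) ξ
  have e : (fun y : G => g⁻¹ * y) ∘ (fun y => g * y) = id := by
    funext y; simp
  rw [e, mfderiv_id] at h
  exact h.symm

theorem thetaL_rightField (g : G) (ξ : LieAlg E G) : thetaL g (rightField ξ g) = Ad g⁻¹ ξ := by
  have h := mfderiv_comp_apply_of_eq (x := (1 : G)) (mdiff_mul_left (E := E) g⁻¹ g)
    (mdiff_mul_right g 1) (one_mul g) ξ
  have e : (fun y : G => g⁻¹ * y) ∘ (fun y => y * g) = fun y => g⁻¹ * y * g⁻¹⁻¹ := by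
    funext y; simp [mul_assoc]
  rw [e] at h
  exact h.symm

end LieGroup

/-! ### Generating vector fields and the equivariance of the moment map. -/

section Action

variable {E : Type*} [NormedAddCommGroup E] [NormedSpace ℝ E]
  {G : Type*} [TopologicalSpace G] [ChartedSpace E G] [Group G] [LieGroup 𝓘(ℝ, E) ∞ G]
  {F : Type*} [NormedAddCommGroup F] [NormedSpace ℝ F]
  {M : Type*} [TopologicalSpace M] [ChartedSpace F M] [IsManifold 𝓘(ℝ, F) ∞ M]
  [MulAction G M] [ContMDiffSMul 𝓘(ℝ, E) 𝓘(ℝ, F) ∞ G M]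

/-- `θ^L ∘ dΦ`. -/
def momT (E : Type*) [NormedAddCommGroup E] [NormedSpace ℝ E]
    {G : Type*} [TopologicalSpace G] [ChartedSpace E G] [Group G]
    {F : Type*} [NormedAddCommGroup F] [NormedSpace ℝ F]
    {M : Type*} [TopologicalSpace M] [ChartedSpace F M] (Φ : M → G) (m : M) :
    Tan F m →L[ℝ] LieAlg E G :=
  (thetaL (Φ m)).comp (tmap F E Φ m)

theorem momT_apply (Φ : M → G) (m : M) (v : Tan F m) :
    momT E Φ m v = thetaL (Φ m) (tmap F E Φ m v) := rfl

/-- The generating vector fields, linear in the Lie algebra variable. -/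
def genLin (E G : Type*) [NormedAddCommGroup E] [NormedSpace ℝ E]
    [TopologicalSpace G] [ChartedSpace E G] [Group G]
    {F : Type*} [NormedAddCommGroup F] [NormedSpace ℝ F]
    {M : Type*} [TopologicalSpace M] [ChartedSpace F M] [MulAction G M] (m : M) :
    LieAlg E G →ₗ[ℝ] Tan F m where
  toFun ξ := gen ξ m
  map_add' ξ ζ := by
    have h : -(ξ + ζ) = -ξ + -ζ := by abel
    have := (tmap E F (fun g : G => g • m) 1).map_add (-ξ) (-ζ)
    rw [← h] at this
    exact this
  map_smul' c ξ := by
    have h : -(c • ξ) = c • -ξ := by rw [smul_neg]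
    have := (tmap E F (fun g : G => g • m) 1).map_smul c (-ξ)
    rw [← h] at this
    exact this

theorem genLin_apply (ξ : LieAlg E G) (m : M) : genLin E G (F := F) m ξ = gen ξ m := rfl

theorem contMDiff_orbit (m : M) : ContMDiff 𝓘(ℝ, E) 𝓘(ℝ, F) ∞ (fun g : G => g • m) :=
  contMDiff_id.smul contMDiff_const

theorem contMDiff_act (E : Type*) [NormedAddCommGroup E] [NormedSpace ℝ E]
    [ChartedSpace E G] [LieGroup 𝓘(ℝ, E) ∞ G] [ContMDiffSMul 𝓘(ℝ, E) 𝓘(ℝ, F) ∞ G M]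
    (g : G) : ContMDiff 𝓘(ℝ, F) 𝓘(ℝ, F) ∞ (fun m : M => g • m) :=
  ContMDiffSMul.contMDiff_const_smul (I := 𝓘(ℝ, E)) g

variable {Φ : M → G}

theorem momT_eq_mfderiv (hΦ : IsEquivariantMap E F Φ) (m : M) (v : Tan F m) :
    @Eq E (momT E Φ m v) (tmap F E (fun x => (Φ m)⁻¹ * Φ x) m v) := by
  have h := mfderiv_comp_apply (I := 𝓘(ℝ, F)) (x := m) (mdiff_mul_left (E := E) (Φ m)⁻¹ (Φ m))
    (hΦ.smooth.contMDiffAt.mdifferentiableAt (by simp)) v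
  exact h.symm

/-- By equivariance `Φ(m)⁻¹ Φ(g m) = (Φ(m)⁻¹ g Φ(m)) g⁻¹`. Its derivative at `g = 1` is `Ad_{Φ(m)⁻¹}
- 1`, and the generating field uses `-ξ`. -/
theorem momT_gen (hΦ : IsEquivariantMap E F Φ) (m : M) (ξ : LieAlg E G) :
    momT E Φ m (gen (F := F) ξ m) = ξ - Ad (Φ m)⁻¹ ξ := by
  have hs : ContMDiffAt 𝓘(ℝ, F) 𝓘(ℝ, E) ∞ (fun x => (Φ m)⁻¹ * Φ x) m :=
    contMDiffAt_const.mul hΦ.smooth.contMDiffAt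
  have h1 := mfderiv_comp_apply_of_eq (x := (1 : G)) (hs.mdifferentiableAt (by simp))
    ((contMDiff_orbit (E := E) (F := F) m).mdifferentiableAt (by simp)) (one_smul G m) (-ξ)
  have e : (fun x => (Φ m)⁻¹ * Φ x) ∘ (fun g : G => g • m) =
      fun g : G => ((Φ m)⁻¹ * g * (Φ m)⁻¹⁻¹) * g⁻¹ := by
    funext g
    simp only [Function.comp_apply, hΦ.equivariant]
    group
  rw [e] at h1
  have hd1 : ContMDiffAt 𝓘(ℝ, E) 𝓘(ℝ, E) ∞ (fun g : G => (Φ m)⁻¹ * g * (Φ m)⁻¹⁻¹) 1 :=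
    (contMDiffAt_const.mul contMDiffAt_id).mul contMDiffAt_const
  have hd2 : MDifferentiableAt 𝓘(ℝ, E) 𝓘(ℝ, E)
      (fun g : G => ((Φ m)⁻¹ * g * (Φ m)⁻¹⁻¹) * g⁻¹) 1 :=
    (hd1.mul contMDiffAt_id.inv).mdifferentiableAt (by simp)
  have h2 := congrArg (fun f : E →L[ℝ] E => f (-ξ : LieAlg E G)) (mfderiv_eq_fderiv hd2 (y := 1)
    (by group))
  have hc1 : ContMDiffAt 𝓘(ℝ, E) 𝓘(ℝ, E) ∞
      (fun x => (Φ m)⁻¹ * (chartOne E G).symm x * (Φ m)⁻¹⁻¹) (origin E G) :=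
    (contMDiffAt_const.mul contMDiffAt_chartOne_symm).mul contMDiffAt_const
  have h3 := fderiv_chartOne_mul hc1 (contMDiffAt_chartOne_symm (E := E) (G := G)).inv
    (by simp only [chartOne_symm_origin]; group) (by simp only [chartOne_symm_origin, inv_one])
    (-ξ : LieAlg E G)
  have h4 := fderiv_chartOne_inv (contMDiffAt_chartOne_symm (E := E) (G := G))
    chartOne_symm_origin (-ξ : LieAlg E G)
  rw [fderiv_chartOne_self] at h4
  have h5 := Ad_apply (Φ m)⁻¹ (-ξ)
  have h6 : @Eq E (momT E Φ m (gen (F := F) ξ m)) (Ad (Φ m)⁻¹ (-ξ) + - -ξ : LieAlg E G) := by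
    refine (momT_eq_mfderiv hΦ m (gen ξ m)).trans (h1.symm.trans (h2.trans (h3.trans ?_)))
    exact congrArg₂ (fun a b : E => a + b) h5.symm h4
  refine h6.trans ?_
  have : (Ad (Φ m)⁻¹ (-ξ) + - -ξ : LieAlg E G) = ξ - Ad (Φ m)⁻¹ ξ := by
    rw [map_neg]; abel
  exact this

theorem momT_act (hΦ : IsEquivariantMap E F Φ) (g : G) (m : M) (v : Tan F m) :
    momT E Φ (g • m) (tmap F F (fun x : M => g • x) m v) = Ad g (momT E Φ m v) := by
  have hs : ∀ m, ContMDiffAt 𝓘(ℝ, F) 𝓘(ℝ, E) ∞ (fun x => (Φ m)⁻¹ * Φ x) m := fun m =>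
    contMDiffAt_const.mul hΦ.smooth.contMDiffAt
  have h1 := mfderiv_comp_apply (x := m) ((hs (g • m)).mdifferentiableAt (by simp))
    ((contMDiff_act (F := F) E g).mdifferentiableAt (by simp)) v
  have h2 := mfderiv_comp_apply_of_eq (x := m) (mdiff_conj (E := E) g 1)
    ((hs m).mdifferentiableAt (by simp)) (inv_mul_cancel (Φ m)) v
  have e : (fun x => (Φ (g • m))⁻¹ * Φ x) ∘ (fun x : M => g • x) =
      (fun y : G => g * y * g⁻¹) ∘ (fun x => (Φ m)⁻¹ * Φ x) := by
    funext x
    simp only [Function.comp_apply, hΦ.equivariant]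
    group
  rw [e] at h1
  have h3 := congrArg (fun x : E => (Ad g : LieAlg E G →L[ℝ] LieAlg E G) x)
    (momT_eq_mfderiv hΦ m v)
  exact (momT_eq_mfderiv hΦ _ _).trans (h1.symm.trans (h2.trans h3.symm))

theorem Ad_moment_act (hΦ : IsEquivariantMap E F Φ) (g : G) (m : M) (ξ : LieAlg E G) :
    Ad (Φ (g • m)) (Ad g ξ) = Ad g (Ad (Φ m) ξ) := by
  rw [← Ad_mul_apply, ← Ad_mul_apply, hΦ.equivariant, inv_mul_cancel_right]

theorem gen_act (g : G) (m : M) (ξ : LieAlg E G) :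
    tmap F F (fun x : M => g • x) m (gen (F := F) ξ m) = gen (Ad g ξ) (g • m) := by
  have h1 := mfderiv_comp_apply_of_eq (x := (1 : G))
    ((contMDiff_act (F := F) E g).mdifferentiableAt (by simp))
    ((contMDiff_orbit (E := E) (F := F) m).mdifferentiableAt (by simp)) (one_smul G m) (-ξ)
  have h2 := mfderiv_comp_apply_of_eq (x := (1 : G))
    ((contMDiff_orbit (E := E) (F := F) (g • m)).mdifferentiableAt (x := 1) (by simp))
    (mdiff_conj (E := E) g 1) (by group) (-ξ)
  have e : (fun x : M => g • x) ∘ (fun k : G => k • m) =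
      (fun k : G => k • g • m) ∘ (fun y : G => g * y * g⁻¹) := by
    funext k
    simp only [Function.comp_apply, smul_smul]
    group
  rw [e] at h1
  have h3 : Ad g (-ξ) = -Ad g ξ := map_neg _ _
  have h4 := congrArg (fun x : LieAlg E G => (tmap E F (fun k : G => k • g • m) 1 x : F)) h3
  exact h1.symm.trans (h2.trans h4)

theorem act_injective (E : Type*) [NormedAddCommGroup E] [NormedSpace ℝ E]
    [ChartedSpace E G] [LieGroup 𝓘(ℝ, E) ∞ G] [ContMDiffSMul 𝓘(ℝ, E) 𝓘(ℝ, F) ∞ G M]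
    (g : G) (m : M) (v : Tan F m)
    (h : tmap F F (fun x : M => g • x) m v = 0) : v = 0 := by
  have h1 := mfderiv_comp_apply_of_eq (x := m)
    ((contMDiff_act (F := F) E g⁻¹).mdifferentiableAt (x := g • m) (by simp))
    ((contMDiff_act (F := F) E g).mdifferentiableAt (by simp)) rfl v
  have e : (fun x : M => g⁻¹ • x) ∘ (fun x : M => g • x) = id := by
    funext x; simp
  rw [e, mfderiv_id] at h1
  have h2 := congrArg (fun w : Tan F (g • m) => (tmap F F (fun x : M => g⁻¹ • x) (g • m) w : F)) h
  exact h1.trans (h2.trans (map_zero _))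

end Action

/-! ### Expansions in an orthonormal basis. -/

section Orthonormal

variable {E : Type*} [NormedAddCommGroup E] [NormedSpace ℝ E]
  {G : Type*} [TopologicalSpace G] [ChartedSpace E G] [Group G] {ι : Type*} [Fintype ι]
  {B : LinearMap.BilinForm ℝ (LieAlg E G)} {e : Module.Basis ι ℝ (LieAlg E G)}

theorem IsOrthonormalBasis.apply_eq_repr (he : IsOrthonormalBasis B e) (a : ι) (ζ : LieAlg E G) :
    B (e a) ζ = e.repr ζ a := by
  classical
  conv_lhs => rw [← e.sum_repr ζ]
  rw [map_sum, Finset.sum_eq_single a]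
  · rw [map_smul, he.1, smul_eq_mul, mul_one]
  · intro b _ hb
    rw [map_smul, he.2 a b hb.symm, smul_zero]
  · simp

theorem IsOrthonormalBasis.sum_apply_smul (he : IsOrthonormalBasis B e) (ζ : LieAlg E G) :
    ∑ a, B (e a) ζ • e a = ζ := by
  simp only [he.apply_eq_repr, e.sum_repr]

end Orthonormal

/-! ### Covectors as differentials of global functions. -/

section Covectors

variable {E : Type*} [NormedAddCommGroup E] [NormedSpace ℝ E] [FiniteDimensional ℝ E]
  {N : Type*} [TopologicalSpace N] [ChartedSpace E N] [IsManifold 𝓘(ℝ, E) ∞ N] [T2Space N]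

/-- Every covector is the differential of a globally defined smooth function. -/
theorem exists_diff_eq (x : N) (β : Cotan E x) :
    ∃ f : N → ℝ, ContMDiff 𝓘(ℝ, E) 𝓘(ℝ, ℝ) ∞ f ∧ diff f x = β := by
  -- The function is `β` in the chart at `x`, cut off by a bump function equal to `1` near `x`; the
  -- chart has identity tangent map at its centre.
  let χ : SmoothBumpFunction 𝓘(ℝ, E) x := Classical.choice inferInstance
  let β' : E →L[ℝ] ℝ := β
  have hs : ContMDiffOn 𝓘(ℝ, E) 𝓘(ℝ, ℝ) ∞ (fun y => β' (extChartAt 𝓘(ℝ, E) x y))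
      (chartAt E x).source :=
    β'.contMDiff.comp_contMDiffOn contMDiffOn_extChartAt
  refine ⟨fun y => χ y • β' (extChartAt 𝓘(ℝ, E) x y), χ.contMDiff_smul hs, ?_⟩
  have he : (fun y => χ y • β' (extChartAt 𝓘(ℝ, E) x y)) =ᶠ[𝓝 x]
      β' ∘ extChartAt 𝓘(ℝ, E) x := by
    filter_upwards [χ.eventuallyEq_one] with y hy
    rw [hy]; simp
  have h1 : mfderiv 𝓘(ℝ, E) 𝓘(ℝ, ℝ) (fun y => χ y • β' (extChartAt 𝓘(ℝ, E) x y)) x = _ :=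
    he.mfderiv_eq
  refine ContinuousLinearMap.ext fun v => ?_
  have h2 := mfderiv_comp_apply (I := 𝓘(ℝ, E)) (x := x)
    (β'.differentiableAt.mdifferentiableAt)
    ((contMDiffAt_extChartAt (I := 𝓘(ℝ, E)) (n := ∞) (x := x)).mdifferentiableAt (by simp)) v
  have h3 := congrArg (fun f : E →L[ℝ] E => f v)
    (mfderiv_extChartAt_self (I := 𝓘(ℝ, E)) (x := x))
  have h4 : mfderiv 𝓘(ℝ, E) 𝓘(ℝ, ℝ) β' (extChartAt 𝓘(ℝ, E) x x) = β' := by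
    rw [_root_.mfderiv_eq_fderiv, ContinuousLinearMap.fderiv]
  refine (congrArg (fun f : E →L[ℝ] ℝ => f v) h1).trans (h2.trans ?_)
  refine (congrArg (fun f : E →L[ℝ] ℝ => f _) h4).trans ?_
  exact congrArg (fun w : E => β' w) h3

end Covectors

/-! ### The moment and compatibility conditions without bases and test functions. -/

section Pointwise

variable {E : Type*} [NormedAddCommGroup E] [NormedSpace ℝ E] [FiniteDimensional ℝ E]
  {G : Type*} [TopologicalSpace G] [ChartedSpace E G] [Group G] [LieGroup 𝓘(ℝ, E) ∞ G]
  {F : Type*} [NormedAddCommGroup F] [NormedSpace ℝ F] [FiniteDimensional ℝ F]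
  {M : Type*} [TopologicalSpace M] [ChartedSpace F M] [IsManifold 𝓘(ℝ, F) ∞ M]
  [MulAction G M] [ContMDiffSMul 𝓘(ℝ, E) 𝓘(ℝ, F) ∞ G M]
  {ι : Type*} [Fintype ι]

/-- `ζ ↦ ζ · Φ^* θ^L`. -/
def momCov (F : Type*) [NormedAddCommGroup F] [NormedSpace ℝ F] {M : Type*} [TopologicalSpace M]
    [ChartedSpace F M] (B : LinearMap.BilinForm ℝ (LieAlg E G)) (Φ : M → G) (m : M) :
    LieAlg E G →ₗ[ℝ] Cotan F m where
  toFun ζ := (LinearMap.toContinuousLinearMap (B ζ)).comp (momT E Φ m)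
  map_add' ξ ζ := by
    refine ContinuousLinearMap.ext fun v => ?_
    have := congrArg (fun f : LieAlg E G →ₗ[ℝ] ℝ => f (momT E Φ m v)) (map_add B ξ ζ)
    exact this
  map_smul' c ζ := by
    refine ContinuousLinearMap.ext fun v => ?_
    have := congrArg (fun f : LieAlg E G →ₗ[ℝ] ℝ => f (momT E Φ m v)) (map_smul B c ζ)
    exact this

theorem momCov_apply (B : LinearMap.BilinForm ℝ (LieAlg E G)) (Φ : M → G) (m : M)
    (ζ : LieAlg E G) (v : Tan F m) : momCov F B Φ m ζ v = B ζ (momT E Φ m v) := rfl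

/-- `α ↦ α((e_a)_M) e_a`, the adjoint of the infinitesimal action. -/
def genAdj (e : Module.Basis ι ℝ (LieAlg E G)) (m : M) : Cotan F m →ₗ[ℝ] LieAlg E G where
  toFun α := ∑ a, α (gen (e a) m) • e a
  map_add' α β := by
    simp only [add_apply, add_smul, Finset.sum_add_distrib]
  map_smul' c α := by
    simp only [smul_apply, smul_eq_mul, mul_smul, Finset.smul_sum, RingHom.id_apply]

/-- The pairing of covectors and vectors. -/
def pairing (F : Type*) [NormedAddCommGroup F] [NormedSpace ℝ F] {M : Type*} [TopologicalSpace M]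
    [ChartedSpace F M] (m : M) : Cotan F m →ₗ[ℝ] Tan F m →ₗ[ℝ] ℝ :=
  LinearMap.mk₂ ℝ (fun α v => α v) (fun _ _ _ => rfl) (fun _ _ _ => rfl)
    (fun α _ _ => map_add α _ _) (fun c α _ => map_smul α c _)

theorem pairing_apply (m : M) (α : Cotan F m) (v : Tan F m) : pairing F m α v = α v := rfl

variable {B : LinearMap.BilinForm ℝ (LieAlg E G)} {e : Module.Basis ι ℝ (LieAlg E G)}

theorem genAdj_apply (he : IsOrthonormalBasis B e)
    (m : M) (α : Cotan F m) (ξ : LieAlg E G) : B (genAdj e m α) ξ = α (gen ξ m) := by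
  have h1 : gen (F := F) ξ m = ∑ a, B (e a) ξ • gen (F := F) (e a) m := by
    have := congrArg (genLin E G (F := F) m) (he.sum_apply_smul ξ)
    simp only [map_sum, map_smul] at this
    exact this.symm
  have h2 : genAdj e m α = ∑ a, α (gen (e a) m) • e a := rfl
  rw [h1, h2]
  simp only [map_sum, LinearMap.sum_apply, map_smul, LinearMap.smul_apply, smul_eq_mul, mul_comm]

variable {Φ : M → G}

/-- Here the geometry enters the linear algebra: orthonormality makes `genAdj` the adjoint of the
action, invariance of `B` makes `Ad` an isometry, and equivariance of `Φ` gives the last relation.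
-/
theorem dualityData (hB : IsInvariantInnerProduct B) (he : IsOrthonormalBasis B e)
    (hΦ : IsEquivariantMap E F Φ) (m : M) :
    DualityData B (pairing F m) (genLin E G m) (momCov F B Φ m) (genAdj e m)
      (momT E Φ m).toLinearMap (Ad (Φ m)).toLinearMap (Ad (Φ m)⁻¹).toLinearMap where
  sepL w h := ContinuousLinearMap.ext h
  sepR v h := by
    by_contra hv
    have h1 : ∀ f : Module.Dual ℝ (Tan F m), f v = 0 := fun f =>
      h (LinearMap.toContinuousLinearMap f)
    exact hv ((Module.forall_dual_apply_eq_zero_iff ℝ v).1 h1)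
  symm := hB.symm
  nondeg ξ h := by
    by_contra hξ
    exact (hB.pos ξ hξ).ne' (h ξ)
  adj_rho w ξ := genAdj_apply he m w ξ
  adj_tau v ζ := hB.symm _ _
  isom := hB.invariant (Φ m)
  left_inv := Ad_inv_Ad (Φ m)
  right_inv := Ad_Ad_inv (Φ m)
  tau_rho ξ := momT_gen hΦ m ξ

theorem thetaLComp_apply (he : IsOrthonormalBasis B e) (a : ι) (m : M) (v : Tan F m) :
    thetaLComp e a (Φ m) (tmap F E Φ m v) = B (e a) (momT E Φ m v) :=
  (he.apply_eq_repr a (momT E Φ m v)).symm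

theorem thetaRComp_apply (he : IsOrthonormalBasis B e) (a : ι) (m : M) (v : Tan F m) :
    thetaRComp e a (Φ m) (tmap F E Φ m v) = B (e a) (Ad (Φ m) (momT E Φ m v)) := by
  rw [he.apply_eq_repr, momT_apply, ← thetaR_eq]
  rfl

/-- The moment condition for a 2-form at a point. -/
def FormMoment (B : LinearMap.BilinForm ℝ (LieAlg E G)) (Φ : M → G) (m : M)
    (om : Tan F m [⋀^Fin 2]→L[ℝ] ℝ) : Prop :=
  ∀ ξ v, om ![gen ξ m, v] = 1 / 2 * B ξ (momT E Φ m v + Ad (Φ m) (momT E Φ m v))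

/-- The moment condition for a bivector at a point. -/
def BivectorMoment (B : LinearMap.BilinForm ℝ (LieAlg E G)) (Φ : M → G) (m : M)
    (P : Cotan F m [⋀^Fin 2]→L[ℝ] ℝ) : Prop :=
  ∀ ζ, sharp P (momCov F B Φ m ζ) = (1 / 2 : ℝ) • gen (ζ + Ad (Φ m) ζ) m

/-- Compatibility of a bivector and a 2-form at a point. -/
def CompatibleAt (E : Type*) [NormedAddCommGroup E] [NormedSpace ℝ E]
    {G : Type*} [TopologicalSpace G] [ChartedSpace E G] [Group G] [MulAction G M] (Φ : M → G)
    (m : M) (P : Cotan F m [⋀^Fin 2]→L[ℝ] ℝ) (om : Tan F m [⋀^Fin 2]→L[ℝ] ℝ) : Prop :=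
  ∀ v, sharp P (flat om v) =
    v - (1 / 4 : ℝ) • gen (momT E Φ m v - Ad (Φ m) (momT E Φ m v)) m

theorem compatible_iff (he : IsOrthonormalBasis B e) {P : MultivectorField F M 2}
    {om : FormField F M 2} : Compatible e P om Φ ↔ ∀ m, CompatibleAt E Φ m (P m) (om m) := by
  have key : ∀ (m : M) (v : Tan F m), ∑ a,
      (thetaLComp e a (Φ m) - thetaRComp e a (Φ m)) (tmap F E Φ m v) • gen (F := F) (e a) m =
        gen (momT E Φ m v - Ad (Φ m) (momT E Φ m v)) m := fun m v => by
    have := congrArg (genLin E G (F := F) m)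
      (he.sum_apply_smul (momT E Φ m v - Ad (Φ m) (momT E Φ m v)))
    simp only [map_sum, map_smul] at this
    rw [← genLin_apply, ← this]
    refine Finset.sum_congr rfl fun a _ => ?_
    rw [sub_apply, thetaLComp_apply he, thetaRComp_apply he, map_sub, genLin_apply]
  unfold Compatible CompatibleAt
  simp only [key]

theorem formMoment_iff (he : IsOrthonormalBasis B e) {om : FormField F M 2} (m : M) :
    FormMoment B Φ m (om m) ↔ ∀ a : ι, flat (om m) (gen (e a) m) =
      (1 / 2 : ℝ) • (thetaLComp e a (Φ m) + thetaRComp e a (Φ m)).comp (tmap F E Φ m) := by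
  have key : ∀ (a : ι) (v : Tan F m),
      ((1 / 2 : ℝ) • (thetaLComp e a (Φ m) + thetaRComp e a (Φ m)).comp (tmap F E Φ m)) v =
        1 / 2 * B (e a) (momT E Φ m v + Ad (Φ m) (momT E Φ m v)) := fun a v => by
    rw [map_add, ← thetaLComp_apply he, ← thetaRComp_apply he]
    rfl
  constructor
  · intro h a
    refine ContinuousLinearMap.ext fun v => ?_
    rw [key, flat_apply, h]
  · intro h ξ v
    have h1 : ∀ a, om m ![gen (e a) m, v] =
        1 / 2 * B (e a) (momT E Φ m v + Ad (Φ m) (momT E Φ m v)) := fun a => by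
      rw [← key, ← h, flat_apply]
    have h2 : (flat (om m) (genLin E G m ξ)) v =
        1 / 2 * B ξ (momT E Φ m v + Ad (Φ m) (momT E Φ m v)) := by
      have h3 := he.sum_apply_smul ξ
      rw [← h3]
      simp only [map_sum, map_smul, LinearMap.sum_apply, LinearMap.smul_apply,
        sum_apply, smul_apply, genLin_apply, flat_apply, h1, smul_eq_mul,
        Finset.mul_sum]
      refine Finset.sum_congr rfl fun a _ => ?_
      ring
    exact h2

/-- Both conditions depend only on the covector `df` at `Φ m`. Every such covector has the form `ζ ·
θ^L`, and each of these is the differential of a global smooth function. Evaluating it on `e_a^L +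
e_a^R` gives `e_a · (ζ + Ad_Φ ζ)`. -/
theorem momentCondition_iff [T2Space G] (hB : IsInvariantInnerProduct B)
    (he : IsOrthonormalBasis B e) (hΦ : IsEquivariantMap E F Φ) {P : MultivectorField F M 2} :
    MomentCondition e P Φ ↔ ∀ m, BivectorMoment B Φ m (P m) := by
  have chain : ∀ (f : G → ℝ), ContMDiff 𝓘(ℝ, E) 𝓘(ℝ, ℝ) ∞ f → ∀ (m : M) (v : Tan F m),
      diff (fun x => f (Φ x)) m v = diff f (Φ m) (tmap F E Φ m v) := fun f hf m v =>
    mfderiv_comp_apply (I := 𝓘(ℝ, F)) (x := m) (hf.contMDiffAt.mdifferentiableAt (by simp))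
      (hΦ.smooth.contMDiffAt.mdifferentiableAt (by simp)) v
  have key : ∀ (m : M) (ζ : LieAlg E G) (β : Cotan E (Φ m)),
      (∀ w, β w = B ζ (thetaL (Φ m) w)) →
      ∑ a, (1 / 2 * β (leftField (e a) (Φ m) + rightField (e a) (Φ m))) • gen (F := F) (e a) m =
        (1 / 2 : ℝ) • gen (ζ + Ad (Φ m) ζ) m := fun m ζ β hβ => by
    have h1 : ∀ a, β (leftField (e a) (Φ m) + rightField (e a) (Φ m)) =
        B (e a) (ζ + Ad (Φ m) ζ) := fun a => by
      rw [map_add, hβ, hβ, thetaL_leftField, thetaL_rightField, map_add, hB.symm ζ (e a),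
        ← hB.invariant (Φ m) ζ, Ad_Ad_inv, hB.symm _ (e a)]
    have := congrArg (genLin E G (F := F) m) (he.sum_apply_smul (ζ + Ad (Φ m) ζ))
    simp only [map_sum, map_smul] at this
    simp only [h1, mul_smul, ← Finset.smul_sum]
    rw [← genLin_apply (ζ + _), ← this]
    rfl
  constructor
  · intro h m ζ
    obtain ⟨f, hf, hfβ⟩ := exists_diff_eq (Φ m)
      ((LinearMap.toContinuousLinearMap (B ζ)).comp (thetaL (Φ m)))
    have h1 := h f hf m
    rw [key m ζ _ fun w => by rw [hfβ]; rfl] at h1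
    rw [← h1]
    congr 1
    refine ContinuousLinearMap.ext fun v => ?_
    rw [chain f hf, hfβ]
    rfl
  · intro h f hf m
    obtain ⟨ζ, hζ⟩ : ∃ ζ, ∀ w, diff f (Φ m) w = B ζ (thetaL (Φ m) w) := by
      -- The components of `df` on the left-invariant frame, which is dual to the `θ^L_a`.
      refine ⟨∑ a, diff f (Φ m) (leftField (e a) (Φ m)) • e a, fun w => ?_⟩
      let L : LieAlg E G →ₗ[ℝ] ℝ :=
        (diff f (Φ m)).toLinearMap ∘ₗ (tmap E E (fun x : G => Φ m * x) 1).toLinearMap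
      have h1 : diff f (Φ m) w = L (thetaL (Φ m) w) := by
        conv_lhs => rw [← leftField_thetaL (Φ m) w]
        rfl
      rw [h1]
      conv_lhs => rw [← he.sum_apply_smul (thetaL (Φ m) w)]
      simp only [map_sum, map_smul, LinearMap.sum_apply, LinearMap.smul_apply, smul_eq_mul]
      refine Finset.sum_congr rfl fun a _ => mul_comm _ _
    rw [key m ζ _ hζ, ← h m ζ]
    congr 1
    refine ContinuousLinearMap.ext fun v => ?_
    rw [chain f hf, hζ]
    rfl

end Pointwise

/-! ### Existence and uniqueness of the dual tensor at a point. -/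

section PointwiseDuality

variable {E : Type*} [NormedAddCommGroup E] [NormedSpace ℝ E] [FiniteDimensional ℝ E]
  {G : Type*} [TopologicalSpace G] [ChartedSpace E G] [Group G] [LieGroup 𝓘(ℝ, E) ∞ G]
  {F : Type*} [NormedAddCommGroup F] [NormedSpace ℝ F] [FiniteDimensional ℝ F]
  {M : Type*} [TopologicalSpace M] [ChartedSpace F M] [IsManifold 𝓘(ℝ, F) ∞ M]
  [MulAction G M] [ContMDiffSMul 𝓘(ℝ, E) 𝓘(ℝ, F) ∞ G M]
  {ι : Type*} [Fintype ι]
  {B : LinearMap.BilinForm ℝ (LieAlg E G)} {e : Module.Basis ι ℝ (LieAlg E G)}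
  {Φ : M → G} {m : M} {P : Cotan F m [⋀^Fin 2]→L[ℝ] ℝ} {om : Tan F m [⋀^Fin 2]→L[ℝ] ℝ}

instance (m : M) : FiniteDimensional ℝ (Cotan F m) :=
  inferInstanceAs (FiniteDimensional ℝ (F →L[ℝ] ℝ))

theorem pairing_sharp (P : Cotan F m [⋀^Fin 2]→L[ℝ] ℝ) (a b : Cotan F m) :
    pairing F m b (sharp P a) = -pairing F m a (sharp P b) := by
  rw [pairing_apply, pairing_apply, apply_sharp, apply_sharp, alt_two_swap]

theorem pairing_flat (om : Tan F m [⋀^Fin 2]→L[ℝ] ℝ) (u v : Tan F m) :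
    pairing F m (flat om u) v = -pairing F m (flat om v) u := by
  rw [pairing_apply, pairing_apply, flat_apply, flat_apply, alt_two_swap]

theorem FormMoment.flat_gen (hB : IsInvariantInnerProduct B) (h : FormMoment B Φ m om)
    (ξ : LieAlg E G) :
    flat om (genLin E G m ξ) = (1 / 2 : ℝ) • momCov F B Φ m (ξ + Ad (Φ m)⁻¹ ξ) := by
  refine ContinuousLinearMap.ext fun v => ?_
  have h1 := hB.invariant (Φ m) (Ad (Φ m)⁻¹ ξ) (momT E Φ m v)
  rw [Ad_Ad_inv] at h1
  rw [flat_apply, genLin_apply, h, smul_apply, momCov_apply, map_add, h1, map_add,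
    LinearMap.add_apply, smul_eq_mul]

theorem formMoment_of_flat_gen (hB : IsInvariantInnerProduct B)
    (h : ∀ ξ, flat om (genLin E G m ξ) = (1 / 2 : ℝ) • momCov F B Φ m (ξ + Ad (Φ m)⁻¹ ξ)) :
    FormMoment B Φ m om := by
  intro ξ v
  have h1 := hB.invariant (Φ m) (Ad (Φ m)⁻¹ ξ) (momT E Φ m v)
  rw [Ad_Ad_inv] at h1
  have h2 := congrArg (fun f : Cotan F m => f v) (h ξ)
  simp only [flat_apply, genLin_apply, smul_apply, momCov_apply, map_add, add_apply,
    smul_eq_mul] at h2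
  rw [h2, map_add, h1]

/-- A subspace of the cotangent space that separates vectors is everything. -/
theorem exists_flat_add_momCov (hB : IsInvariantInnerProduct B)
    (h : ∀ v, flat om v = 0 → momT E Φ m v = 0 → v = 0) (w : Cotan F m) :
    ∃ v ζ, w = flat om v + momCov F B Φ m ζ := by
  let S : Tan F m × LieAlg E G →ₗ[ℝ] Cotan F m := (flat om).coprod (momCov F B Φ m)
  suffices hS : LinearMap.range S = ⊤ by
    obtain ⟨⟨v, ζ⟩, hv⟩ := (LinearMap.range_eq_top.1 hS) w
    exact ⟨v, ζ, hv.symm⟩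
  by_contra hne
  obtain ⟨f, hf0, hf⟩ := Submodule.exists_le_ker_of_lt_top _ (lt_top_iff_ne_top.2 hne)
  -- A functional vanishing on the range is evaluation at a vector `v`. Vanishing on `ω♭ u` for all
  -- `u` puts `v` in `ker ω`, and vanishing on the moment covector of `momT v` itself gives `momT v
  -- = 0` by positivity.
  let v : Tan F m := (Module.evalEquiv ℝ (Tan F m)).symm
    (f ∘ₗ (LinearMap.toContinuousLinearMap (𝕜 := ℝ) (E := Tan F m) (F' := ℝ)).toLinearMap)
  have hv : ∀ a : Cotan F m, a v = f a := fun a =>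
    Module.apply_evalEquiv_symm_apply ℝ (Tan F m) a.toLinearMap _
  have hS : ∀ u ζ, f (flat om u + momCov F B Φ m ζ) = 0 := fun u ζ => hf ⟨(u, ζ), rfl⟩
  have h1 : flat om v = 0 := by
    refine ContinuousLinearMap.ext fun u => ?_
    have := hS u 0
    rw [map_zero, add_zero, ← hv, flat_apply, alt_two_swap, neg_eq_zero] at this
    exact this
  have h2 : momT E Φ m v = 0 := by
    by_contra h0
    have := hS 0 (momT E Φ m v)
    rw [map_zero, zero_add, ← hv, momCov_apply] at this
    exact (hB.pos _ h0).ne' this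
  have h3 := h v h1 h2
  refine hf0 (LinearMap.ext fun a => ?_)
  rw [← hv, h3, map_zero]
  rfl

/-- A covector annihilating the image of `P♯` and the orbit directions lies in `ker P♯` by skewness,
hence vanishes under the hypothesis; so the sum is everything. -/
theorem exists_sharp_add_gen
    (h : ∀ a, sharp P a = 0 → (∀ ξ : LieAlg E G, a (gen ξ m) = 0) → a = 0) (v : Tan F m) :
    ∃ (a : Cotan F m) (ξ : LieAlg E G), v = sharp P a + gen ξ m := by
  let S : Cotan F m × LieAlg E G →ₗ[ℝ] Tan F m := (sharp P).coprod (genLin E G m)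
  suffices hS : LinearMap.range S = ⊤ by
    obtain ⟨⟨a, ξ⟩, hv⟩ := (LinearMap.range_eq_top.1 hS) v
    exact ⟨a, ξ, hv.symm⟩
  by_contra hne
  obtain ⟨f, hf0, hf⟩ := Submodule.exists_le_ker_of_lt_top _ (lt_top_iff_ne_top.2 hne)
  let a : Cotan F m := LinearMap.toContinuousLinearMap f
  have hS : ∀ b (ξ : LieAlg E G), a (sharp P b + genLin E G m ξ) = 0 := fun b ξ => hf ⟨(b, ξ), rfl⟩
  have h1 : sharp P a = 0 := by
    refine (Module.forall_dual_apply_eq_zero_iff ℝ _).1 fun f => ?_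
    have h2 := hS (LinearMap.toContinuousLinearMap f) 0
    rw [map_zero, add_zero, apply_sharp, alt_two_swap, neg_eq_zero, ← apply_sharp] at h2
    exact h2
  have h2 : a = 0 := h a h1 fun ξ => by
    have h2 := hS 0 ξ
    rw [map_zero, zero_add] at h2
    exact h2
  refine hf0 (LinearMap.ext fun u => ?_)
  exact congrArg (fun b : Cotan F m => b u) h2

theorem exists_form (hB : IsInvariantInnerProduct B) (he : IsOrthonormalBasis B e)
    (hΦ : IsEquivariantMap E F Φ) (hP : BivectorMoment B Φ m P)
    (hnd : ∀ v, ∃ (a : Cotan F m) (ξ : LieAlg E G), v = sharp P a + gen ξ m) :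
    ∃ om, FormMoment B Φ m om ∧ CompatibleAt E Φ m P om := by
  obtain ⟨Ω, h1, h2, h3⟩ := (dualityData hB he hΦ m).exists_dual (pairing_sharp P) hP hnd
  obtain ⟨om, hom⟩ := exists_alt_two (pairing F m ∘ₗ Ω) h1
  have hflat : flat om = Ω := LinearMap.ext fun u => ContinuousLinearMap.ext fun v => hom u v
  refine ⟨om, formMoment_of_flat_gen hB fun ξ => ?_, fun v => ?_⟩
  · rw [hflat]; exact h3 ξ
  · rw [hflat]; exact h2 v

theorem form_ker (hB : IsInvariantInnerProduct B) (he : IsOrthonormalBasis B e)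
    (hΦ : IsEquivariantMap E F Φ) (hom : FormMoment B Φ m om) (hC : CompatibleAt E Φ m P om)
    (v : Tan F m) :
    flat om v = 0 ↔ ∃ ξ : LieAlg E G, ξ + Ad (Φ m) ξ = 0 ∧ gen ξ m = v :=
  (dualityData hB he hΦ m).ker_dual (pairing_flat om) hC (hom.flat_gen hB) v

/-- The transpose of the compatibility relation. -/
theorem flat_sharp (hB : IsInvariantInnerProduct B) (he : IsOrthonormalBasis B e)
    (hΦ : IsEquivariantMap E F Φ) (hC : CompatibleAt E Φ m P om) (a : Cotan F m) :
    flat om (sharp P a) =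
      a - (1 / 4 : ℝ) • momCov F B Φ m (genAdj e m a - Ad (Φ m)⁻¹ (genAdj e m a)) :=
  (dualityData hB he hΦ m).sharp_flat_transpose (pairing_sharp P) (pairing_flat om) hC a

theorem form_sharp_apply (hB : IsInvariantInnerProduct B) (he : IsOrthonormalBasis B e)
    (hΦ : IsEquivariantMap E F Φ) (hC : CompatibleAt E Φ m P om) (a : Cotan F m) (v : Tan F m) :
    om ![sharp P a, v] =
      a v - 1 / 4 * B (genAdj e m a) (momT E Φ m v - Ad (Φ m) (momT E Φ m v)) := by
  have h1 := hB.invariant (Φ m) (Ad (Φ m)⁻¹ (genAdj e m a)) (momT E Φ m v)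
  rw [Ad_Ad_inv] at h1
  have h2 := congrArg (fun f : Cotan F m => f v) (flat_sharp hB he hΦ hC a)
  simp only [flat_apply, sub_apply, smul_apply, momCov_apply, map_sub,
    smul_eq_mul] at h2
  rw [h2, map_sub, h1]

theorem Ad_momT_sharp (hB : IsInvariantInnerProduct B) (he : IsOrthonormalBasis B e)
    (hΦ : IsEquivariantMap E F Φ) (hP : BivectorMoment B Φ m P) (a : Cotan F m) :
    Ad (Φ m) (momT E Φ m (sharp P a)) =
      -((1 / 2 : ℝ) • (genAdj e m a + Ad (Φ m) (genAdj e m a))) := by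
  have h := (dualityData hB he hΦ m).tau_sharp (pairing_sharp P) hP a
  have h' : momT E Φ m (sharp P a) =
    -((1 / 2 : ℝ) • (genAdj e m a + Ad (Φ m)⁻¹ (genAdj e m a))) := h
  rw [h', map_neg, map_smul, map_add, Ad_Ad_inv, add_comm]

/-- On `P♯ a` the value of `ω♭` is forced by the transpose of (*), on orbit directions by the moment
condition. -/
theorem form_unique (hB : IsInvariantInnerProduct B) (he : IsOrthonormalBasis B e)
    (hΦ : IsEquivariantMap E F Φ)
    (hnd : ∀ v, ∃ (a : Cotan F m) (ξ : LieAlg E G), v = sharp P a + gen ξ m)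
    {om' : Tan F m [⋀^Fin 2]→L[ℝ] ℝ}
    (h₁ : FormMoment B Φ m om) (h₂ : CompatibleAt E Φ m P om)
    (h₁' : FormMoment B Φ m om') (h₂' : CompatibleAt E Φ m P om') : om = om' := by
  have : flat om = flat om' := by
    refine LinearMap.ext fun v => ?_
    obtain ⟨a, ξ, rfl⟩ := hnd v
    rw [← genLin_apply, map_add, map_add, flat_sharp hB he hΦ h₂, flat_sharp hB he hΦ h₂',
      h₁.flat_gen hB, h₁'.flat_gen hB]
  refine alt_two_ext fun u v => ?_
  rw [← flat_apply, this, flat_apply]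

/-- A kernel vector is `ξ_M` with `Ad_Φ ξ = -ξ`, and `dΦ(ξ_M) = 0` means `Ad_Φ ξ = ξ`; hence `ξ =
0`. -/
theorem separates (hΦ : IsEquivariantMap E F Φ)
    (hker : ∀ v, flat om v = 0 ↔ ∃ ξ : LieAlg E G, ξ + Ad (Φ m) ξ = 0 ∧ gen ξ m = v)
    (v : Tan F m) (h1 : flat om v = 0) (h2 : momT E Φ m v = 0) : v = 0 := by
  obtain ⟨ξ, h3, rfl⟩ := (hker v).1 h1
  rw [momT_gen hΦ, sub_eq_zero] at h2
  have h4 : Ad (Φ m) ξ = ξ := by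
    conv_lhs => rw [h2]
    exact Ad_Ad_inv _ _
  rw [h4, ← two_smul ℝ, smul_eq_zero] at h3
  rw [h3.resolve_left (by norm_num), ← genLin_apply, map_zero]

/-- The construction of `exists_form` with vectors and covectors exchanged. It yields the transpose
of (*), which is transposed once more at the end. -/
theorem exists_bivector (hB : IsInvariantInnerProduct B) (he : IsOrthonormalBasis B e)
    (hΦ : IsEquivariantMap E F Φ) (hom : FormMoment B Φ m om)
    (hker : ∀ v, flat om v = 0 ↔ ∃ ξ : LieAlg E G, ξ + Ad (Φ m) ξ = 0 ∧ gen ξ m = v) :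
    ∃ P : Cotan F m [⋀^Fin 2]→L[ℝ] ℝ, BivectorMoment B Φ m P ∧ CompatibleAt E Φ m P om := by
  have D := dualityData hB he hΦ m
  obtain ⟨Q, h1, h2, h3⟩ := D.swap.exists_dual
    (P := flat om) (fun a b => pairing_flat om a b) (hom.flat_gen hB)
    (fun w => exists_flat_add_momCov hB (separates hΦ hker) w)
  obtain ⟨P, hP⟩ := exists_alt_two ((pairing F m).flip ∘ₗ Q) h1
  have hsharp : sharp P = Q := LinearMap.ext fun a => by
    rw [← sub_eq_zero]
    refine D.sepR _ fun b => ?_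
    have := hP a b
    rw [← apply_sharp] at this
    rw [map_sub, pairing_apply, this]
    exact sub_self _
  refine ⟨P, fun ζ => ?_, fun v => ?_⟩
  · rw [hsharp]; exact h3 ζ
  · rw [hsharp]
    exact D.swap.sharp_flat_transpose (P := flat om) (fun a b => pairing_flat om a b) h1 h2 v

/-- If `P♯ a = 0` and `a` kills the orbit directions, both sides of the transpose of (*) reduce to
`0 = a`. -/
theorem bivector_nondegenerate (hB : IsInvariantInnerProduct B) (he : IsOrthonormalBasis B e)
    (hΦ : IsEquivariantMap E F Φ) (hC : CompatibleAt E Φ m P om) (v : Tan F m) :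
    ∃ (a : Cotan F m) (ξ : LieAlg E G), v = sharp P a + gen ξ m := by
  refine exists_sharp_add_gen (fun a h1 h2 => ?_) v
  have h3 : genAdj e m a = 0 := (dualityData hB he hΦ m).nondeg _ fun ξ => by
    rw [genAdj_apply he, h2]
  have h4 := flat_sharp hB he hΦ hC a
  rw [h1, h3] at h4
  simpa using h4.symm

/-- `P♯` is forced on `ω♭ v` by (*) and on moment covectors by the moment condition; the kernel
condition makes these span. -/
theorem bivector_unique (hB : IsInvariantInnerProduct B)
    (hΦ : IsEquivariantMap E F Φ)
    (hker : ∀ v, flat om v = 0 ↔ ∃ ξ : LieAlg E G, ξ + Ad (Φ m) ξ = 0 ∧ gen ξ m = v)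
    {P' : Cotan F m [⋀^Fin 2]→L[ℝ] ℝ}
    (h₁ : BivectorMoment B Φ m P) (h₂ : CompatibleAt E Φ m P om)
    (h₁' : BivectorMoment B Φ m P') (h₂' : CompatibleAt E Φ m P' om) : P = P' := by
  have : sharp P = sharp P' := by
    refine LinearMap.ext fun w => ?_
    obtain ⟨v, ζ, rfl⟩ := exists_flat_add_momCov (B := B) hB (separates hΦ hker) w
    rw [map_add, map_add, h₁, h₁', h₂, h₂']
  refine alt_two_ext fun a b => ?_
  rw [← apply_sharp, this, apply_sharp]

end PointwiseDuality

/-! ### Sharp and flat under linear maps. -/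

section Pushforward

variable {V V' : Type*} [AddCommGroup V] [Module ℝ V] [TopologicalSpace V]
  [IsTopologicalAddGroup V] [ContinuousSMul ℝ V] [T2Space V] [FiniteDimensional ℝ V]
  [AddCommGroup V'] [Module ℝ V'] [TopologicalSpace V']
  [IsTopologicalAddGroup V'] [ContinuousSMul ℝ V'] [T2Space V'] [FiniteDimensional ℝ V']

theorem sharp_pushforward (P : (V →L[ℝ] ℝ) [⋀^Fin 2]→L[ℝ] ℝ) (κ : V →L[ℝ] V') (a : V' →L[ℝ] ℝ) :
    sharp (P.compContinuousLinearMap (ContinuousLinearMap.precomp ℝ κ)) a =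
      κ (sharp P (a.comp κ)) := by
  rw [← sub_eq_zero]
  refine (Module.forall_dual_apply_eq_zero_iff ℝ _).1 fun f => ?_
  let b : V' →L[ℝ] ℝ := LinearMap.toContinuousLinearMap f
  have h1 : b (sharp (P.compContinuousLinearMap (ContinuousLinearMap.precomp ℝ κ)) a) =
      P ![a.comp κ, b.comp κ] := by
    rw [apply_sharp, ContinuousAlternatingMap.compContinuousLinearMap_apply]
    congr 1
    ext i : 1
    fin_cases i <;> rfl
  have h2 : b (κ (sharp P (a.comp κ))) = P ![a.comp κ, b.comp κ] := apply_sharp P _ (b.comp κ)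
  have h3 : b (sharp (P.compContinuousLinearMap (ContinuousLinearMap.precomp ℝ κ)) a -
      κ (sharp P (a.comp κ))) = 0 := by rw [map_sub, h1, h2, sub_self]
  exact h3

theorem pullback_two_apply (om : V' [⋀^Fin 2]→L[ℝ] ℝ) (κ : V →L[ℝ] V') (u v : V) :
    om.compContinuousLinearMap κ ![u, v] = om ![κ u, κ v] := by
  rw [ContinuousAlternatingMap.compContinuousLinearMap_apply]
  congr 1
  ext i : 1
  fin_cases i <;> rfl

theorem flat_pullback (om : V' [⋀^Fin 2]→L[ℝ] ℝ) (κ : V →L[ℝ] V') (u : V) :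
    flat (om.compContinuousLinearMap κ) u = (flat om (κ u)).comp κ :=
  ContinuousLinearMap.ext fun v => pullback_two_apply om κ u v

end Pushforward

/-! ### Invariance of the dual tensor from pointwise uniqueness. -/

section Invariance

variable {E : Type*} [NormedAddCommGroup E] [NormedSpace ℝ E] [FiniteDimensional ℝ E]
  {G : Type*} [TopologicalSpace G] [ChartedSpace E G] [Group G] [LieGroup 𝓘(ℝ, E) ∞ G]
  {F : Type*} [NormedAddCommGroup F] [NormedSpace ℝ F] [FiniteDimensional ℝ F]
  {M : Type*} [TopologicalSpace M] [ChartedSpace F M] [IsManifold 𝓘(ℝ, F) ∞ M]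
  [MulAction G M] [ContMDiffSMul 𝓘(ℝ, E) 𝓘(ℝ, F) ∞ G M]
  {ι : Type*} [Fintype ι]
  {B : LinearMap.BilinForm ℝ (LieAlg E G)} {e : Module.Basis ι ℝ (LieAlg E G)}
  {Φ : M → G} {P : MultivectorField F M 2} {om : FormField F M 2}

theorem act_surjective (E : Type*) [NormedAddCommGroup E] [NormedSpace ℝ E]
    [ChartedSpace E G] [LieGroup 𝓘(ℝ, E) ∞ G] [ContMDiffSMul 𝓘(ℝ, E) 𝓘(ℝ, F) ∞ G M]
    (g : G) (m : M) (w : Tan F (g • m)) : ∃ v, tmap F F (fun x : M => g • x) m v = w := by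
  let κ : F →L[ℝ] F := tmap F F (fun x : M => g • x) m
  have h : Function.Injective κ.toLinearMap :=
    (injective_iff_map_eq_zero _).2 fun v hv => act_injective E g m v hv
  exact LinearMap.injective_iff_surjective.1 h w

/-- The parameter covers both combinations that occur: `c = 1` in the moment condition and `c = -1`
in (*). -/
theorem moment_shift_act (hΦ : IsEquivariantMap E F Φ) (c : ℝ) (g : G) (m : M) (v : Tan F m) :
    momT E Φ (g • m) (tmap F F (fun x : M => g • x) m v) + c • Ad (Φ (g • m)) (momT E Φ (g • m)
      (tmap F F (fun x : M => g • x) m v)) =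
      Ad g (momT E Φ m v + c • Ad (Φ m) (momT E Φ m v)) := by
  rw [momT_act hΦ, Ad_moment_act hΦ, map_add, map_smul]

theorem compatible_act (hΦ : IsEquivariantMap E F Φ) (g : G) (m : M) (v : Tan F m) :
    tmap F F (fun x : M => g • x) m
      (v - (1 / 4 : ℝ) • gen (momT E Φ m v - Ad (Φ m) (momT E Φ m v)) m) =
      tmap F F (fun x : M => g • x) m v - (1 / 4 : ℝ) •
        gen (momT E Φ (g • m) (tmap F F (fun x : M => g • x) m v) - Ad (Φ (g • m))
          (momT E Φ (g • m) (tmap F F (fun x : M => g • x) m v))) (g • m) := by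
  have h := moment_shift_act hΦ (-1) g m v
  rw [neg_one_smul, neg_one_smul, ← sub_eq_add_neg, ← sub_eq_add_neg] at h
  rw [h, map_sub, map_smul, gen_act]

/-- The pullback of `ω` by `g` satisfies the same moment condition and, `P` being invariant, the
same relation (*) at `m`; so it equals `ω` there. -/
theorem form_invariant (hB : IsInvariantInnerProduct B) (he : IsOrthonormalBasis B e)
    (hΦ : IsEquivariantMap E F Φ) (hnd : IsNondegenerate E G P)
    (hP : ∀ (g : G) (m : M), pushMultivector (fun x : M => g • x) P m = P (g • m))
    (h₁ : ∀ m, FormMoment B Φ m (om m)) (h₂ : ∀ m, CompatibleAt E Φ m (P m) (om m))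
    (g : G) (m : M) : pullForm (fun x : M => g • x) om m = om m := by
  refine form_unique hB he hΦ (hnd m) (fun ξ v => ?_) (fun v => ?_) (h₁ m) (h₂ m)
  · have h3 := h₁ (g • m) (Ad g ξ) (tmap F F (fun x : M => g • x) m v)
    have h := moment_shift_act hΦ 1 g m v
    rw [one_smul, one_smul] at h
    rw [h, hB.invariant, ← gen_act] at h3
    exact (pullback_two_apply _ _ _ _).trans h3
  · have h3 := h₂ (g • m) (tmap F F (fun x : M => g • x) m v)
    have h4 := sharp_pushforward (P m) (tmap F F (fun x : M => g • x) m)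
      (flat (om (g • m)) (tmap F F (fun x : M => g • x) m v))
    have h5 := congrArg (fun Q => sharp Q (flat (om (g • m)) (tmap F F (fun x : M => g • x) m v)))
      (hP g m)
    have h6 := flat_pullback (om (g • m)) (tmap F F (fun x : M => g • x) m) v
    have h7 : flat (pullForm (fun x : M => g • x) om m) v = _ := h6
    rw [h7, ← sub_eq_zero]
    -- Relation (*) at `m` is verified after applying the injective tangent map of `g`, where it
    -- becomes (*) at `g • m`.
    refine act_injective E g m _ ?_
    rw [map_sub, sub_eq_zero, compatible_act hΦ, ← h3]
    exact h4.symm.trans h5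

theorem bivector_invariant (hB : IsInvariantInnerProduct B)
    (hΦ : IsEquivariantMap E F Φ)
    (hker : ∀ m v, flat (om m) v = 0 ↔ ∃ ξ : LieAlg E G, ξ + Ad (Φ m) ξ = 0 ∧ gen ξ m = v)
    (hom : ∀ (g : G) (m : M), pullForm (fun x : M => g • x) om m = om m)
    (h₁ : ∀ m, BivectorMoment B Φ m (P m)) (h₂ : ∀ m, CompatibleAt E Φ m (P m) (om m))
    (g : G) (m : M) : pushMultivector (fun x : M => g • x) P m = P (g • m) := by
  refine bivector_unique hB hΦ (hker (g • m)) (fun ζ => ?_) (fun w => ?_) (h₁ _) (h₂ _)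
  · have h4 := sharp_pushforward (P m) (tmap F F (fun x : M => g • x) m)
      (momCov F B Φ (g • m) ζ)
    have h5 : (momCov F B Φ (g • m) ζ).comp (tmap F F (fun x : M => g • x) m) =
        momCov F B Φ m (Ad g⁻¹ ζ) := by
      refine ContinuousLinearMap.ext fun v => ?_
      have h6 : B ζ (momT E Φ (g • m) (tmap F F (fun x : M => g • x) m v)) =
          B (Ad g⁻¹ ζ) (momT E Φ m v) := by
        rw [momT_act hΦ, ← hB.invariant g (Ad g⁻¹ ζ), Ad_Ad_inv]
      exact h6
    rw [h5, h₁ m, map_smul, gen_act, map_add, ← Ad_moment_act hΦ, Ad_Ad_inv] at h4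
    exact h4
  · obtain ⟨v, rfl⟩ := act_surjective E g m w
    have h4 := sharp_pushforward (P m) (tmap F F (fun x : M => g • x) m)
      (flat (om (g • m)) (tmap F F (fun x : M => g • x) m v))
    have h6 := flat_pullback (om (g • m)) (tmap F F (fun x : M => g • x) m) v
    have h7 : flat (pullForm (fun x : M => g • x) om m) v = _ := h6
    rw [hom] at h7
    rw [← h7, h₂ m v, compatible_act hΦ] at h4
    exact h4

end Invariance

/-! ### Antisymmetric trilinear forms in a basis. -/

section Trilinear

variable {g : Type*} [AddCommGroup g] [Module ℝ g] {ι : Type*} [Fintype ι]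

theorem sum_repr_trilinear (e : Module.Basis ι ℝ g) (T : g →ₗ[ℝ] g →ₗ[ℝ] g →ₗ[ℝ] ℝ) (x y z : g) :
    ∑ a, ∑ b, ∑ c, T (e a) (e b) (e c) * (e.repr x a * e.repr y b * e.repr z c) = T x y z := by
  have hl : ∀ (f : g →ₗ[ℝ] ℝ) (z : g), ∑ c, f (e c) * e.repr z c = f z := fun f z => by
    conv_rhs => rw [← e.sum_repr z]
    simp only [map_sum, map_smul, smul_eq_mul, mul_comm]
  have h1 : ∀ a b, ∑ c, T (e a) (e b) (e c) * (e.repr x a * e.repr y b * e.repr z c) =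
      T (e a) (e b) z * e.repr y b * e.repr x a := fun a b => by
    rw [← hl (T (e a) (e b)) z, Finset.sum_mul, Finset.sum_mul]
    exact Finset.sum_congr rfl fun c _ => by ring
  have h2 : ∀ a, ∑ b, T (e a) (e b) z * e.repr y b = T (e a) y z := fun a =>
    hl ((T (e a)).flip z) y
  simp only [h1, ← Finset.sum_mul, h2]
  exact hl ((T.flip y).flip z) x

/-- Each of the six permutations in the determinant contributes the same value, its sign being
undone by the antisymmetry of `T`. -/
theorem sum_repr_det (e : Module.Basis ι ℝ g) (T : g →ₗ[ℝ] g →ₗ[ℝ] g →ₗ[ℝ] ℝ)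
    (h₁ : ∀ x y z, T x y z = -T y x z) (h₂ : ∀ x y z, T x y z = -T x z y) (x : Fin 3 → g) :
    ∑ a, ∑ b, ∑ c, T (e a) (e b) (e c) *
      Matrix.det (Matrix.of fun i j : Fin 3 => e.repr (x i) (![a, b, c] j)) =
        6 * T (x 0) (x 1) (x 2) := by
  have key : ∀ a b c, T (e a) (e b) (e c) *
      Matrix.det (Matrix.of fun i j : Fin 3 => e.repr (x i) (![a, b, c] j)) =
      T (e a) (e b) (e c) * (e.repr (x 0) a * e.repr (x 1) b * e.repr (x 2) c) -
      T (e a) (e b) (e c) * (e.repr (x 0) a * e.repr (x 2) b * e.repr (x 1) c) -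
      T (e a) (e b) (e c) * (e.repr (x 1) a * e.repr (x 0) b * e.repr (x 2) c) +
      T (e a) (e b) (e c) * (e.repr (x 2) a * e.repr (x 0) b * e.repr (x 1) c) +
      T (e a) (e b) (e c) * (e.repr (x 1) a * e.repr (x 2) b * e.repr (x 0) c) -
      T (e a) (e b) (e c) * (e.repr (x 2) a * e.repr (x 1) b * e.repr (x 0) c) := fun a b c => by
    rw [Matrix.det_fin_three]
    simp only [Matrix.of_apply, Matrix.cons_val_zero, Matrix.cons_val_one, Matrix.cons_val]
    ring
  simp only [key, Finset.sum_add_distrib, Finset.sum_sub_distrib, sum_repr_trilinear]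
  have e1 := h₂ (x 0) (x 2) (x 1)
  have e2 := h₁ (x 1) (x 0) (x 2)
  have e3 := h₁ (x 2) (x 0) (x 1)
  have e4 := h₂ (x 1) (x 2) (x 0)
  have e5 := h₁ (x 2) (x 1) (x 0)
  linarith

end Trilinear

/-! ### The Cartan 3-form and 3-tensor without bases. -/

section Cartan

variable {E : Type*} [NormedAddCommGroup E] [NormedSpace ℝ E] [FiniteDimensional ℝ E]
  {G : Type*} [TopologicalSpace G] [ChartedSpace E G] [Group G] [LieGroup 𝓘(ℝ, E) ∞ G]
  {F : Type*} [NormedAddCommGroup F] [NormedSpace ℝ F] [FiniteDimensional ℝ F]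
  {M : Type*} [TopologicalSpace M] [ChartedSpace F M] [IsManifold 𝓘(ℝ, F) ∞ M]
  [MulAction G M] [ContMDiffSMul 𝓘(ℝ, E) 𝓘(ℝ, F) ∞ G M]
  {ι : Type*} [Fintype ι]

theorem wedgeCovectors_apply {V : Type*} [AddCommGroup V] [Module ℝ V] [TopologicalSpace V] {k : ℕ}
    (β : Fin k → V →L[ℝ] ℝ) (v : Fin k → V) :
    wedgeCovectors β v = Matrix.det (Matrix.of fun i j => β j (v i)) := rfl

theorem alternating_sum_apply {V κ : Type*} [AddCommGroup V] [Module ℝ V] {k : ℕ} (s : Finset κ)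
    (f : κ → V [⋀^Fin k]→ₗ[ℝ] ℝ) (v : Fin k → V) : (∑ i ∈ s, f i) v = ∑ i ∈ s, f i v :=
  map_sum ({ toFun := fun f => f v, map_zero' := rfl, map_add' := fun _ _ => rfl } :
    V [⋀^Fin k]→ₗ[ℝ] ℝ →+ ℝ) f s

theorem wedgeVectors_apply {V : Type*} [AddCommGroup V] [Module ℝ V] [TopologicalSpace V] {k : ℕ}
    (v : Fin k → V) (α : Fin k → V →L[ℝ] ℝ) :
    wedgeVectors v α = Matrix.det (Matrix.of fun i j => α i (v j)) := rfl

/-- The inner product on the model space of the Lie algebra. -/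
def innerCoord (B : LinearMap.BilinForm ℝ (LieAlg E G)) : E →L[ℝ] E →L[ℝ] ℝ :=
  LinearMap.toContinuousLinearMap (E := E) (F' := E →L[ℝ] ℝ)
    ((LinearMap.toContinuousLinearMap (𝕜 := ℝ) (E := E) (F' := ℝ)).toLinearMap ∘ₗ
      (B : E →ₗ[ℝ] E →ₗ[ℝ] ℝ))

/-- The trilinear form `ξ · [ζ, ν]`. -/
def cartanForm (B : LinearMap.BilinForm ℝ (LieAlg E G)) : E →ₗ[ℝ] E →ₗ[ℝ] E →ₗ[ℝ] ℝ :=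
  LinearMap.mk₂ ℝ (fun ξ ζ => (innerCoord B ξ).toLinearMap ∘ₗ lieLin E G ζ)
    (fun ξ ξ' ζ => by ext; simp) (fun c ξ ζ => by ext; simp)
    (fun ξ ζ ζ' => by ext; simp) (fun c ξ ζ => by ext; simp)

theorem cartanForm_apply (B : LinearMap.BilinForm ℝ (LieAlg E G)) (ξ ζ ν : E) :
    cartanForm B ξ ζ ν = innerCoord B ξ (lieLin E G ζ ν) := rfl

variable {B : LinearMap.BilinForm ℝ (LieAlg E G)} {e : Module.Basis ι ℝ (LieAlg E G)}

theorem innerCoord_symm (hB : IsInvariantInnerProduct B) (ξ ζ : E) :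
    innerCoord B ξ ζ = innerCoord B ζ ξ := hB.symm ξ ζ

theorem innerCoord_adjoint (hB : IsInvariantInnerProduct B) (g : G) (ξ ζ : E) :
    innerCoord B (adjointCoord g ξ) (adjointCoord g ζ) = innerCoord B ξ ζ := by
  have h1 : @Eq E _ _ := Ad_apply g (ξ : LieAlg E G)
  have h2 : @Eq E _ _ := Ad_apply g (ζ : LieAlg E G)
  rw [← h1, ← h2]
  exact hB.invariant g ξ ζ

theorem cartanForm_swap_right (ξ ζ ν : E) : cartanForm B ξ ζ ν = -cartanForm B ξ ν ζ := by
  rw [cartanForm_apply, cartanForm_apply, lieLin_antisymm, map_neg]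

theorem cartanForm_swap_left (hB : IsInvariantInnerProduct B) (ξ ζ ν : E) :
    cartanForm B ξ ζ ν = -cartanForm B ζ ξ ν := by
  have h := lie_invariant (innerCoord_adjoint hB) ν ξ ζ
  rw [cartanForm_apply, cartanForm_apply, innerCoord_symm hB ζ, lieLin_antisymm ζ,
    lieLin_antisymm ξ, map_neg, map_neg, neg_apply, h]
  ring

theorem cartanForm_adjoint (hB : IsInvariantInnerProduct B) (g : G) (ξ ζ ν : E) :
    cartanForm B (adjointCoord g ξ) (adjointCoord g ζ) (adjointCoord g ν) = cartanForm B ξ ζ ν := by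
  rw [cartanForm_apply, ← adjointCoord_lie, innerCoord_adjoint hB, cartanForm_apply]

theorem structureConst_eq (a b c : ι) :
    structureConst B e a b c = cartanForm B (e a) (e b) (e c) := by
  have := congrArg (fun x : E => innerCoord B (e a) x) (lieLin_apply (E := E) (G := G) (e b) (e c))
  exact this.symm

theorem sum_structureConst_det (hB : IsInvariantInnerProduct B) (x : Fin 3 → E) :
    ∑ a, ∑ b, ∑ c, structureConst B e a b c *
      Matrix.det (Matrix.of fun i j : Fin 3 => e.repr (x i) (![a, b, c] j)) =
        6 * cartanForm B (x 0) (x 1) (x 2) := by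
  simp only [structureConst_eq]
  exact sum_repr_det (g := E) e (cartanForm B) (cartanForm_swap_left hB) cartanForm_swap_right x

/-- The constant is `6/12`. Passing from `θ^R` to `θ^L` costs nothing, since `θ^R = Ad_g θ^L` and
the trilinear form is `Ad`-invariant. -/
theorem etaForm_apply (hB : IsInvariantInnerProduct B) (g : G) (v : Fin 3 → Tan E g) :
    etaForm B e g v = 1 / 2 * cartanForm B (thetaL g (v 0)) (thetaL g (v 1)) (thetaL g (v 2)) := by
  have h1 := sum_structureConst_det (E := E) (e := e) hB (fun i => (thetaR g (v i) : E))
  have h2 : ∀ i, @Eq E (thetaR g (v i)) (adjointCoord (E := E) g (thetaL g (v i))) := fun i =>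
    (thetaR_eq g (v i)).trans (Ad_apply (E := E) g _)
  have h3 : cartanForm B (thetaR g (v 0)) (thetaR g (v 1)) (thetaR g (v 2)) =
      cartanForm B (thetaL g (v 0)) (thetaL g (v 1)) (thetaL g (v 2)) := by
    have h5 : ∀ a b c a' b' c' : E, a = adjointCoord g a' → b = adjointCoord g b' →
        c = adjointCoord g c' → cartanForm B a b c = cartanForm B a' b' c' := by
      rintro _ _ _ a b c rfl rfl rfl
      exact cartanForm_adjoint hB g a b c
    exact h5 _ _ _ _ _ _ (h2 0) (h2 1) (h2 2)
  rw [← h3]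
  have h4 : ∀ a b c, wedgeCovectors ![thetaRComp e a g, thetaRComp e b g, thetaRComp e c g] v =
      Matrix.det (Matrix.of fun i j : Fin 3 => e.repr (thetaR g (v i)) (![a, b, c] j)) :=
        fun a b c => by
    rw [wedgeCovectors_apply]
    congr 2
    ext i j
    fin_cases j <;> rfl
  have h6 : etaForm B e g v = 1 / 12 * ∑ a, ∑ b, ∑ c, structureConst B e a b c *
      Matrix.det (Matrix.of fun i j : Fin 3 => e.repr (thetaR g (v i)) (![a, b, c] j)) := by
    simp only [etaForm, AlternatingMap.smul_apply, alternating_sum_apply, h4, smul_eq_mul]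
  refine h6.trans ?_
  linarith [h1]

theorem cartanTrivector_apply (hB : IsInvariantInnerProduct B) (he : IsOrthonormalBasis B e)
    (m : M) (α : Fin 3 → Cotan F m) :
    cartanTrivector B e m α =
      1 / 2 * cartanForm B (genAdj e m (α 0)) (genAdj e m (α 1)) (genAdj e m (α 2)) := by
  have h1 := sum_structureConst_det (E := E) (e := e) hB (fun i => (genAdj e m (α i) : E))
  have h4 : ∀ a b c, wedgeVectors ![gen (F := F) (e a) m, gen (F := F) (e b) m,
      gen (F := F) (e c) m] α =
      Matrix.det (Matrix.of fun i j : Fin 3 => e.repr (genAdj e m (α i)) (![a, b, c] j)) :=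
        fun a b c => by
    have h5 : ∀ i a, e.repr (genAdj e m (α i)) a = α i (gen (e a) m) := fun i a => by
      rw [← he.apply_eq_repr, hB.symm, genAdj_apply he]
    rw [wedgeVectors_apply]
    congr 2
    ext i j
    fin_cases j <;> exact (h5 i _).symm
  have h6 : cartanTrivector B e m α = 1 / 12 * ∑ a, ∑ b, ∑ c, structureConst B e a b c *
      Matrix.det (Matrix.of fun i j : Fin 3 => e.repr (genAdj e m (α i)) (![a, b, c] j)) := by
    simp only [cartanTrivector, AlternatingMap.smul_apply, alternating_sum_apply, h4, smul_eq_mul]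
  refine h6.trans ?_
  linarith [h1]

end Cartan

/-! ### Forms and bivectors in a chart of the manifold. -/

section Chart

variable {F : Type*} [NormedAddCommGroup F] [NormedSpace ℝ F]
  {M : Type*} [TopologicalSpace M] [ChartedSpace F M]

/-- The tangent map of the inverse of a chart. -/
def chartOut (F : Type*) [NormedAddCommGroup F] [NormedSpace ℝ F]
    {M : Type*} [TopologicalSpace M] [ChartedSpace F M] (m₀ : M) (y : F) :
    F →L[ℝ] Tan F ((extChartAt 𝓘(ℝ, F) m₀).symm y) :=
  tmap F F (M := F) (N := M) (extChartAt 𝓘(ℝ, F) m₀).symm y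

/-- The tangent map of a chart. -/
def chartIn (F : Type*) [NormedAddCommGroup F] [NormedSpace ℝ F]
    {M : Type*} [TopologicalSpace M] [ChartedSpace F M] (m₀ : M) (y : F) :
    Tan F ((extChartAt 𝓘(ℝ, F) m₀).symm y) →L[ℝ] F :=
  tmap F F (M := M) (N := F) (extChartAt 𝓘(ℝ, F) m₀) ((extChartAt 𝓘(ℝ, F) m₀).symm y)

theorem formInChart_apply [FiniteDimensional ℝ F] (om : FormField F M 2) (m₀ : M) (y u v : F) :
    formInChart om m₀ y ![u, v] =
      om ((extChartAt 𝓘(ℝ, F) m₀).symm y) ![chartOut F m₀ y u, chartOut F m₀ y v] :=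
  pullback_two_apply _ (chartOut F m₀ y) u v

theorem flat_formInChart [FiniteDimensional ℝ F] (om : FormField F M 2) (m₀ : M) (y u : F) :
    flat (formInChart om m₀ y) u =
      (flat (om ((extChartAt 𝓘(ℝ, F) m₀).symm y)) (chartOut F m₀ y u)).comp (chartOut F m₀ y) :=
  flat_pullback _ (chartOut F m₀ y) u

theorem sharp_multivectorInChart [FiniteDimensional ℝ F] (P : MultivectorField F M 2) (m₀ : M)
    (y : F) (a : F →L[ℝ] ℝ) :
    sharp (multivectorInChart P m₀ y) a =
      chartIn F m₀ y (sharp (P ((extChartAt 𝓘(ℝ, F) m₀).symm y)) (a.comp (chartIn F m₀ y))) :=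
  sharp_pushforward _ (chartIn F m₀ y) a

variable [IsManifold 𝓘(ℝ, F) ∞ M] {m₀ : M} {y : F}

theorem mdiff_chart_symm (hy : y ∈ (extChartAt 𝓘(ℝ, F) m₀).target) :
    MDifferentiableAt 𝓘(ℝ, F) 𝓘(ℝ, F) (extChartAt 𝓘(ℝ, F) m₀).symm y :=
  (contMDiffAt_chart_symm hy).mdifferentiableAt (by simp)

theorem contMDiffAt_chart (hy : y ∈ (extChartAt 𝓘(ℝ, F) m₀).target) :
    ContMDiffAt 𝓘(ℝ, F) 𝓘(ℝ, F) ∞ (extChartAt 𝓘(ℝ, F) m₀)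
      ((extChartAt 𝓘(ℝ, F) m₀).symm y) :=
  contMDiffAt_extChartAt' (by
    rw [← extChartAt_source 𝓘(ℝ, F)]; exact (extChartAt 𝓘(ℝ, F) m₀).map_target hy)

theorem mdiff_chart (hy : y ∈ (extChartAt 𝓘(ℝ, F) m₀).target) :
    MDifferentiableAt 𝓘(ℝ, F) 𝓘(ℝ, F) (extChartAt 𝓘(ℝ, F) m₀)
      ((extChartAt 𝓘(ℝ, F) m₀).symm y) :=
  (contMDiffAt_chart hy).mdifferentiableAt (by simp)

theorem chartIn_chartOut (hy : y ∈ (extChartAt 𝓘(ℝ, F) m₀).target) (u : F) :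
    chartIn F m₀ y (chartOut F m₀ y u) = u := by
  have h := mfderiv_comp_apply (I := 𝓘(ℝ, F)) (x := y) (mdiff_chart hy) (mdiff_chart_symm hy) u
  have e : extChartAt 𝓘(ℝ, F) m₀ ∘ (extChartAt 𝓘(ℝ, F) m₀).symm =ᶠ[𝓝 y] id := by
    filter_upwards [(isOpen_extChartAt_target m₀).mem_nhds hy] with z hz
    exact (extChartAt 𝓘(ℝ, F) m₀).right_inv hz
  have h1 := congrArg (fun f : F →L[ℝ] F => f u) (e.mfderiv_eq (I := 𝓘(ℝ, F)) (I' := 𝓘(ℝ, F)))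
  have h2 := congrArg (fun f : F →L[ℝ] F => f u) (mfderiv_id (I := 𝓘(ℝ, F)) (x := y))
  exact h.symm.trans (h1.trans h2)

theorem chartOut_chartIn (hy : y ∈ (extChartAt 𝓘(ℝ, F) m₀).target)
    (v : Tan F ((extChartAt 𝓘(ℝ, F) m₀).symm y)) : chartOut F m₀ y (chartIn F m₀ y v) = v := by
  have hr := (extChartAt 𝓘(ℝ, F) m₀).right_inv hy
  have h := mfderiv_comp_apply_of_eq (I := 𝓘(ℝ, F)) (x := (extChartAt 𝓘(ℝ, F) m₀).symm y)
    (mdiff_chart_symm hy) (mdiff_chart hy) hr v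
  have e : (extChartAt 𝓘(ℝ, F) m₀).symm ∘ extChartAt 𝓘(ℝ, F) m₀
      =ᶠ[𝓝 ((extChartAt 𝓘(ℝ, F) m₀).symm y)] id := by
    filter_upwards [(isOpen_extChartAt_source m₀).mem_nhds
      ((extChartAt 𝓘(ℝ, F) m₀).map_target hy)] with z hz
    exact (extChartAt 𝓘(ℝ, F) m₀).left_inv hz
  have h1 := congrArg (fun f : F →L[ℝ] F => f v) (e.mfderiv_eq (I := 𝓘(ℝ, F)) (I' := 𝓘(ℝ, F)))
  have h2 := congrArg (fun f : F →L[ℝ] F => f v) (mfderiv_id (I := 𝓘(ℝ, F))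
    (x := (extChartAt 𝓘(ℝ, F) m₀).symm y))
  exact h.symm.trans (h1.trans h2)

end Chart

/-! ### The moment map and the action in a chart. -/

section Coordinates

variable {E : Type*} [NormedAddCommGroup E] [NormedSpace ℝ E] [FiniteDimensional ℝ E]
  {G : Type*} [TopologicalSpace G] [ChartedSpace E G] [Group G] [LieGroup 𝓘(ℝ, E) ∞ G]
  {F : Type*} [NormedAddCommGroup F] [NormedSpace ℝ F] [FiniteDimensional ℝ F]
  {M : Type*} [TopologicalSpace M] [ChartedSpace F M] [IsManifold 𝓘(ℝ, F) ∞ M]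
  [MulAction G M] [ContMDiffSMul 𝓘(ℝ, E) 𝓘(ℝ, F) ∞ G M]
  {ι : Type*} [Fintype ι]
  {B : LinearMap.BilinForm ℝ (LieAlg E G)} {e : Module.Basis ι ℝ (LieAlg E G)}
  {Φ : M → G} {P : MultivectorField F M 2} {om : FormField F M 2} {m₀ : M} {y : F}

/-- The moment map in a chart. -/
def momChart (F : Type*) [NormedAddCommGroup F] [NormedSpace ℝ F]
    {M : Type*} [TopologicalSpace M] [ChartedSpace F M] (Φ : M → G) (m₀ : M) (y : F) : G :=
  Φ ((extChartAt 𝓘(ℝ, F) m₀).symm y)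

theorem contMDiffAt_momChart (hΦ : IsEquivariantMap E F Φ)
    (hy : y ∈ (extChartAt 𝓘(ℝ, F) m₀).target) :
    ContMDiffAt 𝓘(ℝ, F) 𝓘(ℝ, E) ∞ (momChart F Φ m₀) y :=
  hΦ.smooth.contMDiffAt.comp y (contMDiffAt_chart_symm hy)

theorem momT_chartOut (hΦ : IsEquivariantMap E F Φ)
    (hy : y ∈ (extChartAt 𝓘(ℝ, F) m₀).target) (u : F) :
    @Eq E (momT E Φ ((extChartAt 𝓘(ℝ, F) m₀).symm y) (chartOut F m₀ y u))
      (logDeriv (E := E) (momChart F Φ m₀) y u) := by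
  have hs : ∀ m, ContMDiffAt 𝓘(ℝ, F) 𝓘(ℝ, E) ∞ (fun x => (Φ m)⁻¹ * Φ x) m := fun m =>
    contMDiffAt_const.mul hΦ.smooth.contMDiffAt
  have h1 := mfderiv_comp_apply (I := 𝓘(ℝ, F)) (x := y)
    ((hs ((extChartAt 𝓘(ℝ, F) m₀).symm y)).mdifferentiableAt (by simp)) (mdiff_chart_symm hy) u
  have hd : MDifferentiableAt 𝓘(ℝ, F) 𝓘(ℝ, E)
      ((fun x => (Φ ((extChartAt 𝓘(ℝ, F) m₀).symm y))⁻¹ * Φ x) ∘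
        (extChartAt 𝓘(ℝ, F) m₀).symm) y :=
    ((hs ((extChartAt 𝓘(ℝ, F) m₀).symm y)).comp y (contMDiffAt_chart_symm hy)).mdifferentiableAt
      (by simp)
  have h2 := congrArg (fun f : F →L[ℝ] E => f u)
    (mfderiv_eq_fderiv_source hd (y := 1) (by simp))
  exact (momT_eq_mfderiv hΦ _ _).trans (h1.symm.trans h2)

/-- The action in a chart, near the identity. -/
def actChart (E G : Type*) [NormedAddCommGroup E] [NormedSpace ℝ E]
    [TopologicalSpace G] [ChartedSpace E G] [Group G]
    {F : Type*} [NormedAddCommGroup F] [NormedSpace ℝ F]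
    {M : Type*} [TopologicalSpace M] [ChartedSpace F M] [MulAction G M] (m₀ : M)
    (x : E) (y : F) : F :=
  extChartAt 𝓘(ℝ, F) m₀ ((chartOne E G).symm x • (extChartAt 𝓘(ℝ, F) m₀).symm y)

theorem contMDiffAt_act_symm (hy : y ∈ (extChartAt 𝓘(ℝ, F) m₀).target) :
    ContMDiffAt 𝓘(ℝ, E × F) 𝓘(ℝ, F) ∞ (fun p : E × F =>
      (chartOne E G).symm p.1 • (extChartAt 𝓘(ℝ, F) m₀).symm p.2) (origin E G, y) := by
  have h1 : ContMDiffAt 𝓘(ℝ, E × F) 𝓘(ℝ, E) ∞ (fun p : E × F => (chartOne E G).symm p.1)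
      (origin E G, y) :=
    ContMDiffAt.comp (x := (origin E G, y)) (g := (chartOne E G).symm)
      contMDiffAt_chartOne_symm contDiffAt_fst.contMDiffAt
  have h2 : ContMDiffAt 𝓘(ℝ, E × F) 𝓘(ℝ, F) ∞
      (fun p : E × F => (extChartAt 𝓘(ℝ, F) m₀).symm p.2) (origin E G, y) :=
    ContMDiffAt.comp (x := (origin E G, y)) (g := (extChartAt 𝓘(ℝ, F) m₀).symm)
      (contMDiffAt_chart_symm hy) contDiffAt_snd.contMDiffAt
  exact h1.smul h2

theorem contDiffAt_actChart (hy : y ∈ (extChartAt 𝓘(ℝ, F) m₀).target) :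
    ContDiffAt ℝ ∞ (fun p : E × F => actChart E G m₀ p.1 p.2) (origin E G, y) :=
  contDiffAt_chart_comp (contMDiffAt_act_symm hy) (by
    simp only [chartOne_symm_origin, one_smul]
    exact (extChartAt 𝓘(ℝ, F) m₀).map_target hy)

/-- The generating vector fields in a chart. -/
def genChart (E G : Type*) [NormedAddCommGroup E] [NormedSpace ℝ E]
    [TopologicalSpace G] [ChartedSpace E G] [Group G]
    {F : Type*} [NormedAddCommGroup F] [NormedSpace ℝ F]
    {M : Type*} [TopologicalSpace M] [ChartedSpace F M] [MulAction G M] (m₀ : M) (y : F) :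
    E →L[ℝ] F :=
  -fderiv ℝ (fun x => actChart E G m₀ x y) (origin E G)

theorem contDiffAt_genChart (hy : y ∈ (extChartAt 𝓘(ℝ, F) m₀).target) :
    ContDiffAt ℝ ∞ (genChart E G m₀) y := by
  have h1 : ContDiffAt ℝ ∞ (fun y => fderiv ℝ (fun x => actChart E G m₀ x y) (origin E G)) y := by
    refine ContDiffAt.fderiv (f := fun y x => actChart E G m₀ x y)
      (g := fun _ => origin E G) (n := ∞) ?_ contDiffAt_const (by simp)
    exact ContDiffAt.comp (g := fun p : E × F => actChart E G m₀ p.1 p.2)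
      (f := fun p : F × E => (p.2, p.1)) (y, origin E G) (contDiffAt_actChart hy)
      (contDiffAt_snd.prodMk contDiffAt_fst)
  exact h1.neg

theorem chartIn_gen (hy : y ∈ (extChartAt 𝓘(ℝ, F) m₀).target) (ξ : LieAlg E G) :
    chartIn F m₀ y (gen ξ ((extChartAt 𝓘(ℝ, F) m₀).symm y)) = genChart E G m₀ y ξ := by
  have h1 := mfderiv_comp_apply_of_eq (I := 𝓘(ℝ, E)) (x := (1 : G)) (mdiff_chart hy)
    ((contMDiff_orbit (E := E) (G := G) (F := F)
      ((extChartAt 𝓘(ℝ, F) m₀).symm y)).contMDiffAt.mdifferentiableAt (by simp))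
    (one_smul G ((extChartAt 𝓘(ℝ, F) m₀).symm y)) (-ξ)
  have hd : MDifferentiableAt 𝓘(ℝ, E) 𝓘(ℝ, F) (extChartAt 𝓘(ℝ, F) m₀ ∘
      fun g : G => g • (extChartAt 𝓘(ℝ, F) m₀).symm y) 1 :=
    MDifferentiableAt.comp_of_eq (x := (1 : G)) (mdiff_chart hy)
      ((contMDiff_orbit (E := E) (G := G) (F := F)
        ((extChartAt 𝓘(ℝ, F) m₀).symm y)).contMDiffAt.mdifferentiableAt (by simp))
      (one_smul G ((extChartAt 𝓘(ℝ, F) m₀).symm y))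
  have h2 := congrArg (fun f : E →L[ℝ] F => f (-ξ : LieAlg E G)) (mfderiv_eq_fderiv_target hd)
  have h3 : fderiv ℝ (fun x => actChart E G m₀ x y) (origin E G) (-ξ : LieAlg E G) =
      genChart E G m₀ y ξ :=
    (fderiv ℝ (fun x => actChart E G m₀ x y) (origin E G)).map_neg ξ
  exact h1.symm.trans (h2.trans h3)

theorem chartOut_genChart (hy : y ∈ (extChartAt 𝓘(ℝ, F) m₀).target) (ξ : LieAlg E G) :
    chartOut F m₀ y (genChart E G m₀ y ξ) = gen ξ ((extChartAt 𝓘(ℝ, F) m₀).symm y) := by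
  rw [← chartIn_gen hy ξ, chartOut_chartIn hy]

/-- The adjoint of the infinitesimal action in a chart. -/
def genAdjChart (e : Module.Basis ι ℝ (LieAlg E G)) (m₀ : M) (y : F) : (F →L[ℝ] ℝ) →L[ℝ] E :=
  LinearMap.toContinuousLinearMap (E := F →L[ℝ] ℝ) (F' := E)
    { toFun := fun a => genAdj e ((extChartAt 𝓘(ℝ, F) m₀).symm y) (a.comp (chartIn F m₀ y))
      map_add' := fun a b => map_add (genAdj e ((extChartAt 𝓘(ℝ, F) m₀).symm y))
        (a.comp (chartIn F m₀ y)) (b.comp (chartIn F m₀ y))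
      map_smul' := fun c a => map_smul (genAdj e ((extChartAt 𝓘(ℝ, F) m₀).symm y)) c
        (a.comp (chartIn F m₀ y)) }

theorem genAdjChart_apply (e : Module.Basis ι ℝ (LieAlg E G)) (m₀ : M) (y : F) (a : F →L[ℝ] ℝ) :
    @Eq E (genAdjChart e m₀ y a)
      (genAdj e ((extChartAt 𝓘(ℝ, F) m₀).symm y) (a.comp (chartIn F m₀ y))) := rfl

theorem contDiffAt_genAdjChart (hy : y ∈ (extChartAt 𝓘(ℝ, F) m₀).target) :
    ContDiffAt ℝ ∞ (genAdjChart (F := F) e m₀) y := by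
  refine contDiffAt_clm_of_apply fun a => ?_
  let e' : ι → E := fun i => e i
  have h : ContDiffAt ℝ ∞ (fun y => ∑ i, a (genChart E G m₀ y (e' i)) • e' i) y := by
    refine ContDiffAt.sum fun i _ => ContDiffAt.smul ?_ contDiffAt_const
    exact a.contDiff.contDiffAt.comp y ((contDiffAt_genChart hy).clm_apply contDiffAt_const)
  refine h.congr_of_eventuallyEq ?_
  filter_upwards [(isOpen_extChartAt_target m₀).mem_nhds hy] with z hz
  refine (genAdjChart_apply e m₀ z a).trans ?_
  refine Finset.sum_congr rfl fun i _ => ?_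
  have := congrArg (fun v : F => a v • e' i) (chartIn_gen hz (e i))
  exact this

end Coordinates

/-! ### The pointwise relations transported to a chart. -/

section Relations

variable {E : Type*} [NormedAddCommGroup E] [NormedSpace ℝ E] [FiniteDimensional ℝ E]
  {G : Type*} [TopologicalSpace G] [ChartedSpace E G] [Group G] [LieGroup 𝓘(ℝ, E) ∞ G]
  {F : Type*} [NormedAddCommGroup F] [NormedSpace ℝ F] [FiniteDimensional ℝ F]
  {M : Type*} [TopologicalSpace M] [ChartedSpace F M] [IsManifold 𝓘(ℝ, F) ∞ M]
  [MulAction G M] [ContMDiffSMul 𝓘(ℝ, E) 𝓘(ℝ, F) ∞ G M]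
  {ι : Type*} [Fintype ι]
  {B : LinearMap.BilinForm ℝ (LieAlg E G)} {e : Module.Basis ι ℝ (LieAlg E G)}
  {Φ : M → G} {P : MultivectorField F M 2} {om : FormField F M 2} {m₀ : M} {y : F}

theorem Ad_momT_chartOut (hΦ : IsEquivariantMap E F Φ)
    (hy : y ∈ (extChartAt 𝓘(ℝ, F) m₀).target) (u : F) :
    @Eq E (Ad (Φ ((extChartAt 𝓘(ℝ, F) m₀).symm y))
      (momT E Φ ((extChartAt 𝓘(ℝ, F) m₀).symm y) (chartOut F m₀ y u)))
      (adjointCoord (momChart F Φ m₀ y) (logDeriv (E := E) (momChart F Φ m₀) y u)) :=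
  (Ad_apply (E := E) _ _).trans (congrArg (fun x : E => adjointCoord (E := E)
    (Φ ((extChartAt 𝓘(ℝ, F) m₀).symm y)) x) (momT_chartOut hΦ hy u))

theorem formInChart_genChart (hΦ : IsEquivariantMap E F Φ)
    (hy : y ∈ (extChartAt 𝓘(ℝ, F) m₀).target) (h : ∀ m, FormMoment B Φ m (om m)) (ξ : E) (v : F) :
    formInChart om m₀ y ![genChart E G m₀ y ξ, v] = 1 / 2 * innerCoord B ξ
      (logDeriv (E := E) (momChart F Φ m₀) y v + adjointCoord (momChart F Φ m₀ y)
        (logDeriv (E := E) (momChart F Φ m₀) y v)) := by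
  have h1 := fun ξ : LieAlg E G => h ((extChartAt 𝓘(ℝ, F) m₀).symm y) ξ (chartOut F m₀ y v)
  simp only [← chartOut_genChart hy, ← formInChart_apply] at h1
  exact (h1 ξ).trans (congrArg₂ (fun s t : E => 1 / 2 * innerCoord B ξ (s + t))
    (momT_chartOut hΦ hy v) (Ad_momT_chartOut hΦ hy v))

theorem chartOut_sharp (hy : y ∈ (extChartAt 𝓘(ℝ, F) m₀).target) (a : F →L[ℝ] ℝ) :
    chartOut F m₀ y (sharp (multivectorInChart P m₀ y) a) =
      sharp (P ((extChartAt 𝓘(ℝ, F) m₀).symm y)) (a.comp (chartIn F m₀ y)) := by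
  rw [sharp_multivectorInChart, chartOut_chartIn hy]

theorem formInChart_sharp (hB : IsInvariantInnerProduct B) (he : IsOrthonormalBasis B e)
    (hΦ : IsEquivariantMap E F Φ) (hy : y ∈ (extChartAt 𝓘(ℝ, F) m₀).target)
    (hC : ∀ m, CompatibleAt E Φ m (P m) (om m)) (a : F →L[ℝ] ℝ) (v : F) :
    formInChart om m₀ y ![sharp (multivectorInChart P m₀ y) a, v] =
      a v - 1 / 4 * innerCoord B (genAdjChart e m₀ y a)
      (logDeriv (E := E) (momChart F Φ m₀) y v - adjointCoord (momChart F Φ m₀ y)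
        (logDeriv (E := E) (momChart F Φ m₀) y v)) := by
  have h1 := form_sharp_apply hB he hΦ (hC ((extChartAt 𝓘(ℝ, F) m₀).symm y))
    (a.comp (chartIn F m₀ y)) (chartOut F m₀ y v)
  rw [← chartOut_sharp hy, ← formInChart_apply] at h1
  have h2 : (a.comp (chartIn F m₀ y)) (chartOut F m₀ y v) = a v :=
    congrArg a (chartIn_chartOut hy v)
  rw [h2] at h1
  exact h1.trans (congrArg₂ (fun s t : E => a v - 1 / 4 *
    innerCoord B (genAdjChart e m₀ y a) (s - t)) (momT_chartOut hΦ hy v) (Ad_momT_chartOut hΦ hy v))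

theorem adjointCoord_logDeriv_sharp (hB : IsInvariantInnerProduct B) (he : IsOrthonormalBasis B e)
    (hΦ : IsEquivariantMap E F Φ) (hy : y ∈ (extChartAt 𝓘(ℝ, F) m₀).target)
    (hP : ∀ m, BivectorMoment B Φ m (P m)) (a : F →L[ℝ] ℝ) :
    adjointCoord (momChart F Φ m₀ y) (logDeriv (E := E) (momChart F Φ m₀) y
      (sharp (multivectorInChart P m₀ y) a)) =
      -((1 / 2 : ℝ) • (genAdjChart e m₀ y a + adjointCoord (momChart F Φ m₀ y)
        (genAdjChart e m₀ y a))) := by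
  have h1 := Ad_momT_sharp hB he hΦ (hP ((extChartAt 𝓘(ℝ, F) m₀).symm y))
    (a.comp (chartIn F m₀ y))
  rw [← chartOut_sharp hy] at h1
  have h2 := Ad_apply (E := E) (Φ ((extChartAt 𝓘(ℝ, F) m₀).symm y))
    (genAdj e ((extChartAt 𝓘(ℝ, F) m₀).symm y) (a.comp (chartIn F m₀ y)))
  exact (Ad_momT_chartOut hΦ hy _).symm.trans (h1.trans
    (congrArg (fun t : E => -((1 / 2 : ℝ) • (genAdjChart e m₀ y a + t))) h2))

theorem sharp_formInChart (hΦ : IsEquivariantMap E F Φ)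
    (hy : y ∈ (extChartAt 𝓘(ℝ, F) m₀).target)
    (hC : ∀ m, CompatibleAt E Φ m (P m) (om m)) (v : F) :
    sharp (multivectorInChart P m₀ y) (flat (formInChart om m₀ y) v) =
      v - (1 / 4 : ℝ) • genChart E G m₀ y
        (logDeriv (E := E) (momChart F Φ m₀) y v - adjointCoord (momChart F Φ m₀ y)
          (logDeriv (E := E) (momChart F Φ m₀) y v)) := by
  have h1 := hC ((extChartAt 𝓘(ℝ, F) m₀).symm y) (chartOut F m₀ y v)
  have h2 : (flat (formInChart om m₀ y) v).comp (chartIn F m₀ y) =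
      flat (om ((extChartAt 𝓘(ℝ, F) m₀).symm y)) (chartOut F m₀ y v) := by
    rw [flat_formInChart]
    refine ContinuousLinearMap.ext fun w => ?_
    exact congrArg (flat (om ((extChartAt 𝓘(ℝ, F) m₀).symm y)) (chartOut F m₀ y v))
      (chartOut_chartIn hy w)
  rw [sharp_multivectorInChart, h2, h1, map_sub, map_smul, chartIn_gen hy, chartIn_chartOut hy]
  exact congrArg₂ (fun s t : E => v - (1 / 4 : ℝ) • genChart E G m₀ y (s - t))
    (momT_chartOut hΦ hy v) (Ad_momT_chartOut hΦ hy v)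

theorem comp_chartIn_logDeriv (hΦ : IsEquivariantMap E F Φ)
    (hy : y ∈ (extChartAt 𝓘(ℝ, F) m₀).target) (ζ : E) :
    ((innerCoord B ζ).comp (logDeriv (E := E) (momChart F Φ m₀) y)).comp (chartIn F m₀ y) =
      momCov F B Φ ((extChartAt 𝓘(ℝ, F) m₀).symm y) ζ := by
  refine ContinuousLinearMap.ext fun w => ?_
  have h1 := congrArg (fun t : E => innerCoord B ζ t) (momT_chartOut hΦ hy (chartIn F m₀ y w))
  rw [chartOut_chartIn hy] at h1
  exact h1.symm

theorem sharp_moment_inChart (hΦ : IsEquivariantMap E F Φ)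
    (hy : y ∈ (extChartAt 𝓘(ℝ, F) m₀).target) (hP : ∀ m, BivectorMoment B Φ m (P m)) (ζ : E) :
    sharp (multivectorInChart P m₀ y)
      ((innerCoord B ζ).comp (logDeriv (E := E) (momChart F Φ m₀) y)) =
      (1 / 2 : ℝ) • genChart E G m₀ y (ζ + adjointCoord (momChart F Φ m₀ y) ζ) := by
  have h1 := hP ((extChartAt 𝓘(ℝ, F) m₀).symm y) ζ
  rw [sharp_multivectorInChart, comp_chartIn_logDeriv hΦ hy, h1, map_smul, chartIn_gen hy]
  exact congrArg (fun t : E => (1 / 2 : ℝ) • genChart E G m₀ y (ζ + t))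
    (Ad_apply (E := E) (Φ ((extChartAt 𝓘(ℝ, F) m₀).symm y)) ζ)

theorem exists_sharp_add_genChart (hy : y ∈ (extChartAt 𝓘(ℝ, F) m₀).target)
    (hnd : IsNondegenerate E G P) (v : F) :
    ∃ (a : F →L[ℝ] ℝ) (ξ : E), v = sharp (multivectorInChart P m₀ y) a + genChart E G m₀ y ξ := by
  obtain ⟨a, ξ, h⟩ := hnd ((extChartAt 𝓘(ℝ, F) m₀).symm y) (chartOut F m₀ y v)
  refine ⟨a.comp (chartOut F m₀ y), ξ, ?_⟩
  have h2 : (a.comp (chartOut F m₀ y)).comp (chartIn F m₀ y) = a :=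
    ContinuousLinearMap.ext fun w => congrArg a (chartOut_chartIn hy w)
  rw [sharp_multivectorInChart, h2, ← chartIn_gen hy, ← map_add, ← h, chartIn_chartOut hy]

theorem exists_flat_add_logDeriv (hB : IsInvariantInnerProduct B) (hΦ : IsEquivariantMap E F Φ)
    (hy : y ∈ (extChartAt 𝓘(ℝ, F) m₀).target)
    (hker : ∀ m v, flat (om m) v = 0 ↔ ∃ ξ : LieAlg E G, ξ + Ad (Φ m) ξ = 0 ∧ gen ξ m = v)
    (w : F →L[ℝ] ℝ) : ∃ (v : F) (ζ : E), w = flat (formInChart om m₀ y) v +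
      (innerCoord B ζ).comp (logDeriv (E := E) (momChart F Φ m₀) y) := by
  obtain ⟨v, ζ, h⟩ := exists_flat_add_momCov hB (separates hΦ (hker _)) (w.comp (chartIn F m₀ y))
  refine ⟨chartIn F m₀ y v, ζ, ?_⟩
  refine ContinuousLinearMap.ext fun u => ?_
  have h1 := congrArg (fun f : Cotan F ((extChartAt 𝓘(ℝ, F) m₀).symm y) => f (chartOut F m₀ y u)) h
  have h2 : (w.comp (chartIn F m₀ y)) (chartOut F m₀ y u) = w u :=
    congrArg w (chartIn_chartOut hy u)
  have h3 := congrArg (fun t : E => innerCoord B ζ t) (momT_chartOut hΦ hy u)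
  rw [flat_formInChart, chartOut_chartIn hy]
  exact h2.symm.trans (h1.trans (congrArg (fun t : ℝ =>
    flat (om ((extChartAt 𝓘(ℝ, F) m₀).symm y)) v (chartOut F m₀ y u) + t) h3))

end Relations

/-! ### Smoothness of the dual tensor. -/

section Smoothness

variable {E : Type*} [NormedAddCommGroup E] [NormedSpace ℝ E] [FiniteDimensional ℝ E]
  {G : Type*} [TopologicalSpace G] [ChartedSpace E G] [Group G] [LieGroup 𝓘(ℝ, E) ∞ G]
  {F : Type*} [NormedAddCommGroup F] [NormedSpace ℝ F] [FiniteDimensional ℝ F]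
  {M : Type*} [TopologicalSpace M] [ChartedSpace F M] [IsManifold 𝓘(ℝ, F) ∞ M]
  [MulAction G M] [ContMDiffSMul 𝓘(ℝ, E) 𝓘(ℝ, F) ∞ G M]
  {ι : Type*} [Fintype ι]
  {B : LinearMap.BilinForm ℝ (LieAlg E G)} {e : Module.Basis ι ℝ (LieAlg E G)}
  {Φ : M → G} {P : MultivectorField F M 2} {om : FormField F M 2} {m₀ : M} {y : F}

theorem SmoothForm.contDiffAt (h : SmoothForm om) (hy : y ∈ (extChartAt 𝓘(ℝ, F) m₀).target) :
    ContDiffAt ℝ ∞ (formInChart om m₀) y :=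
  (h m₀).contDiffAt ((isOpen_extChartAt_target m₀).mem_nhds hy)

theorem SmoothMultivector.contDiffAt (h : SmoothMultivector P)
    (hy : y ∈ (extChartAt 𝓘(ℝ, F) m₀).target) : ContDiffAt ℝ ∞ (multivectorInChart P m₀) y :=
  (h m₀).contDiffAt ((isOpen_extChartAt_target m₀).mem_nhds hy)

theorem contDiffAt_adjoint_moment (hΦ : IsEquivariantMap E F Φ)
    (hy : y ∈ (extChartAt 𝓘(ℝ, F) m₀).target) (v : F) :
    ContDiffAt ℝ ∞ (fun z => adjointCoord (momChart F Φ m₀ z)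
      (logDeriv (E := E) (momChart F Φ m₀) z v)) y :=
  (contDiffAt_adjointCoord (contMDiffAt_momChart hΦ hy)).clm_apply
    ((contDiffAt_logDeriv (contMDiffAt_momChart hΦ hy)).clm_apply contDiffAt_const)

/-- The family `S z (a, ξ) = P♯ a + ξ_M` is smooth and surjective, and `ω♭ ∘ S` is given by the
transpose of (*) and the moment condition, which involve only smooth data. -/
theorem smoothForm_of_compatible (hB : IsInvariantInnerProduct B) (he : IsOrthonormalBasis B e)
    (hΦ : IsEquivariantMap E F Φ) (hP : SmoothMultivector P) (hnd : IsNondegenerate E G P)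
    (h₁ : ∀ m, FormMoment B Φ m (om m)) (h₂ : ∀ m, CompatibleAt E Φ m (P m) (om m)) :
    SmoothForm om := by
  intro m₀ y hy
  refine ContDiffAt.contDiffWithinAt (contDiffAt_of_flatCLM ?_)
  have hT := fun v : F => (contDiffAt_logDeriv (E := E) (contMDiffAt_momChart hΦ hy)).clm_apply
    (contDiffAt_const (c := v))
  have hAT := contDiffAt_adjoint_moment hΦ hy
  let S : F → (F →L[ℝ] ℝ) × E →L[ℝ] F := fun z =>
    (sharpCLM (multivectorInChart P m₀ z)).coprod (genChart E G m₀ z)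
  have hS : ContDiffAt ℝ ∞ S y := contDiffAt_clm_of_apply fun p =>
    ((contDiffAt_sharpCLM (hP.contDiffAt hy)).clm_apply contDiffAt_const).add
      ((contDiffAt_genChart hy).clm_apply contDiffAt_const)
  refine contDiffAt_of_comp_surjective hS (L := fun z => (flatCLM (formInChart om m₀ z)).comp (S z))
    (contDiffAt_clm_of_apply fun p => contDiffAt_clm_of_apply fun v => ?_) (fun v => ?_)
    (Eventually.of_forall fun _ => rfl)
  · have h : ContDiffAt ℝ ∞ (fun z => (p.1 v - 1 / 4 * innerCoord B (genAdjChart e m₀ z p.1)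
        (logDeriv (E := E) (momChart F Φ m₀) z v - adjointCoord (momChart F Φ m₀ z)
          (logDeriv (E := E) (momChart F Φ m₀) z v))) + 1 / 2 * innerCoord B p.2
        (logDeriv (E := E) (momChart F Φ m₀) z v + adjointCoord (momChart F Φ m₀ z)
          (logDeriv (E := E) (momChart F Φ m₀) z v))) y := by
      have h1 : ContDiffAt ℝ ∞ (fun z => innerCoord B (genAdjChart e m₀ z p.1)) y :=
        contDiffAt_const.clm_apply ((contDiffAt_genAdjChart hy).clm_apply contDiffAt_const)
      refine (contDiffAt_const.sub (contDiffAt_const.mul (h1.clm_apply ((hT v).sub (hAT v))))).add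
        (contDiffAt_const.mul ?_)
      exact contDiffAt_const.clm_apply ((hT v).add (hAT v))
    refine h.congr_of_eventuallyEq ?_
    filter_upwards [(isOpen_extChartAt_target m₀).mem_nhds hy] with z hz
    rw [← formInChart_sharp hB he hΦ hz h₂, ← formInChart_genChart hΦ hz h₁, ← flatCLM_apply,
      ← flatCLM_apply, ← add_apply, ← map_add]
    rfl
  · obtain ⟨a, ξ, h⟩ := exists_sharp_add_genChart hy hnd v
    exact ⟨(a, ξ), h.symm⟩

/-- The same argument with the surjection `(v, ζ) ↦ ω♭ v + ζ · T`, on which `P♯` is given by (*) and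
its moment condition. -/
theorem smoothMultivector_of_compatible (hB : IsInvariantInnerProduct B)
    (hΦ : IsEquivariantMap E F Φ) (hom : SmoothForm om)
    (hker : ∀ m v, flat (om m) v = 0 ↔ ∃ ξ : LieAlg E G, ξ + Ad (Φ m) ξ = 0 ∧ gen ξ m = v)
    (h₁ : ∀ m, BivectorMoment B Φ m (P m)) (h₂ : ∀ m, CompatibleAt E Φ m (P m) (om m)) :
    SmoothMultivector P := by
  intro m₀ y hy
  refine ContDiffAt.contDiffWithinAt (contDiffAt_of_sharpCLM ?_)
  have hA := contDiffAt_adjointCoord (E := E) (contMDiffAt_momChart hΦ hy)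
  have hT := contDiffAt_logDeriv (E := E) (contMDiffAt_momChart hΦ hy)
  have hAT := contDiffAt_adjoint_moment hΦ hy
  let τ : F → E →L[ℝ] F →L[ℝ] ℝ := fun z => LinearMap.toContinuousLinearMap (E := E)
    { toFun := fun ζ => (innerCoord B ζ).comp (logDeriv (E := E) (momChart F Φ m₀) z)
      map_add' := fun ζ ζ' => by rw [map_add, ContinuousLinearMap.add_comp]
      map_smul' := fun c ζ => by
        rw [map_smul, ContinuousLinearMap.smul_comp, RingHom.id_apply] }
  let S : F → F × E →L[ℝ] (F →L[ℝ] ℝ) := fun z => (flatCLM (formInChart om m₀ z)).coprod (τ z)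
  have hS : ContDiffAt ℝ ∞ S y := contDiffAt_clm_of_apply fun p =>
    ((contDiffAt_flatCLM (hom.contDiffAt hy)).clm_apply contDiffAt_const).add
      (contDiffAt_const.clm_comp hT)
  refine contDiffAt_of_comp_surjective hS
    (L := fun z => (sharpCLM (multivectorInChart P m₀ z)).comp (S z))
    (contDiffAt_clm_of_apply fun p => ?_) (fun w => ?_) (Eventually.of_forall fun _ => rfl)
  · have h : ContDiffAt ℝ ∞ (fun z => (p.1 - (1 / 4 : ℝ) • genChart E G m₀ z
        (logDeriv (E := E) (momChart F Φ m₀) z p.1 - adjointCoord (momChart F Φ m₀ z)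
          (logDeriv (E := E) (momChart F Φ m₀) z p.1))) +
        (1 / 2 : ℝ) • genChart E G m₀ z (p.2 + adjointCoord (momChart F Φ m₀ z) p.2)) y := by
      refine (contDiffAt_const.sub (contDiffAt_const.smul ((contDiffAt_genChart hy).clm_apply
        ((hT.clm_apply contDiffAt_const).sub (hAT p.1))))).add (contDiffAt_const.smul
        ((contDiffAt_genChart hy).clm_apply (contDiffAt_const.add (hA.clm_apply contDiffAt_const))))
    refine h.congr_of_eventuallyEq ?_
    filter_upwards [(isOpen_extChartAt_target m₀).mem_nhds hy] with z hz
    rw [← sharp_formInChart hΦ hz h₂, ← sharp_moment_inChart hΦ hz h₁, ← map_add]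
    rfl
  · obtain ⟨v, ζ, h⟩ := exists_flat_add_logDeriv hB hΦ hy hker w
    exact ⟨(v, ζ), h.symm⟩

/-- The point `m` and the equation `hm` appear separately because the inverse chart returns to `m`
only propositionally; substituting `hm` aligns the tangent spaces. The next two lemmas have the same
form for the same reason. -/
theorem logDeriv_tmap_chart (hΦ : IsEquivariantMap E F Φ)
    (hy : y ∈ (extChartAt 𝓘(ℝ, F) m₀).target) {m : M} (hm : (extChartAt 𝓘(ℝ, F) m₀).symm y = m)
    (v : Tan F m) : @Eq E (logDeriv (E := E) (momChart F Φ m₀) y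
      (tmap F F (M := M) (N := F) (extChartAt 𝓘(ℝ, F) m₀) m v)) (momT E Φ m v) := by
  subst hm
  have h1 := momT_chartOut hΦ hy (chartIn F m₀ y v)
  rw [chartOut_chartIn hy] at h1
  exact h1.symm

theorem formInChart_tmap_chart (hy : y ∈ (extChartAt 𝓘(ℝ, F) m₀).target) {m : M}
    (hm : (extChartAt 𝓘(ℝ, F) m₀).symm y = m) (v w : Tan F m) :
    formInChart om m₀ y ![tmap F F (M := M) (N := F) (extChartAt 𝓘(ℝ, F) m₀) m v,
      tmap F F (M := M) (N := F) (extChartAt 𝓘(ℝ, F) m₀) m w] = om m ![v, w] := by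
  subst hm
  have h1 := formInChart_apply om m₀ y (chartIn F m₀ y v) (chartIn F m₀ y w)
  rw [chartOut_chartIn hy, chartOut_chartIn hy] at h1
  exact h1

theorem genAdjChart_comp_chartOut (hy : y ∈ (extChartAt 𝓘(ℝ, F) m₀).target) {m : M}
    (hm : (extChartAt 𝓘(ℝ, F) m₀).symm y = m) (α : Cotan F m) :
    @Eq E (genAdjChart e m₀ y (ContinuousLinearMap.comp (M₂ := F) α
      (tmap F F (M := F) (N := M) (extChartAt 𝓘(ℝ, F) m₀).symm y))) (genAdj e m α) := by
  subst hm
  refine congrArg (genAdj e ((extChartAt 𝓘(ℝ, F) m₀).symm y)) ?_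
  exact ContinuousLinearMap.ext fun w => congrArg α (chartOut_chartIn hy w)

theorem logDeriv_genChart (hΦ : IsEquivariantMap E F Φ)
    (hy : y ∈ (extChartAt 𝓘(ℝ, F) m₀).target) (ξ : E) :
    logDeriv (E := E) (momChart F Φ m₀) y (genChart E G m₀ y ξ) =
      ξ - adjointCoord (momChart F Φ m₀ y)⁻¹ ξ := by
  have h1 := momT_chartOut hΦ hy (genChart E G m₀ y ξ)
  have h2 := congrArg (fun v : F => (momT E Φ ((extChartAt 𝓘(ℝ, F) m₀).symm y) v : E))
    (chartOut_genChart (E := E) (G := G) hy ξ)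
  have h3 := momT_gen hΦ ((extChartAt 𝓘(ℝ, F) m₀).symm y) ξ
  have h4 := Ad_apply (E := E) (Φ ((extChartAt 𝓘(ℝ, F) m₀).symm y))⁻¹ ξ
  exact h1.symm.trans (h2.trans (h3.trans (congrArg (fun t : E => ξ - t) h4)))

end Smoothness

/-! ### Infinitesimal invariance in a chart. -/

section LieDerivative

variable {E : Type*} [NormedAddCommGroup E] [NormedSpace ℝ E] [FiniteDimensional ℝ E]
  {G : Type*} [TopologicalSpace G] [ChartedSpace E G] [Group G] [LieGroup 𝓘(ℝ, E) ∞ G]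
  {F : Type*} [NormedAddCommGroup F] [NormedSpace ℝ F] [FiniteDimensional ℝ F]
  {M : Type*} [TopologicalSpace M] [ChartedSpace F M] [IsManifold 𝓘(ℝ, F) ∞ M]
  [MulAction G M] [ContMDiffSMul 𝓘(ℝ, E) 𝓘(ℝ, F) ∞ G M]
  {om : FormField F M 2} {m₀ : M} {y : F}

theorem actChart_origin (hy : y ∈ (extChartAt 𝓘(ℝ, F) m₀).target) :
    actChart E G m₀ (origin E G) y = y := by
  rw [actChart, chartOne_symm_origin, one_smul, (extChartAt 𝓘(ℝ, F) m₀).right_inv hy]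

theorem fderiv_actChart_origin (hy : y ∈ (extChartAt 𝓘(ℝ, F) m₀).target) (u : F) :
    fderiv ℝ (fun z => actChart E G m₀ (origin E G) z) y u = u := by
  have h : (fun z => actChart E G m₀ (origin E G) z) =ᶠ[𝓝 y] id := by
    filter_upwards [(isOpen_extChartAt_target m₀).mem_nhds hy] with z hz
    exact actChart_origin hz
  rw [h.fderiv_eq, fderiv_id]
  rfl

theorem fderiv_actChart (hy : y ∈ (extChartAt 𝓘(ℝ, F) m₀).target) {x : E}
    (hx : (chartOne E G).symm x • (extChartAt 𝓘(ℝ, F) m₀).symm y ∈ (extChartAt 𝓘(ℝ, F) m₀).source)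
    (u : F) :
    fderiv ℝ (fun z => actChart E G m₀ x z) y u =
      tmap F F (M := M) (N := F) (extChartAt 𝓘(ℝ, F) m₀) _
        (tmap F F (fun m : M => (chartOne E G).symm x • m) ((extChartAt 𝓘(ℝ, F) m₀).symm y)
          (chartOut F m₀ y u)) := by
  have hd : MDifferentiableAt 𝓘(ℝ, F) 𝓘(ℝ, F) (extChartAt 𝓘(ℝ, F) m₀)
      ((chartOne E G).symm x • (extChartAt 𝓘(ℝ, F) m₀).symm y) :=
    (contMDiffAt_extChartAt' (n := ∞) (by
      rwa [← extChartAt_source 𝓘(ℝ, F)])).mdifferentiableAt (by simp)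
  have ha := (contMDiff_act (F := F) (M := M) E
    ((chartOne E G).symm x)).contMDiffAt.mdifferentiableAt
    (x := (extChartAt 𝓘(ℝ, F) m₀).symm y) (by simp)
  have h1 := mfderiv_comp_apply (I := 𝓘(ℝ, F)) (x := y) ha (mdiff_chart_symm hy) u
  have h2 := mfderiv_comp_apply (I := 𝓘(ℝ, F)) (x := y) hd (ha.comp y (mdiff_chart_symm hy)) u
  have h3 := congrArg (fun f : F →L[ℝ] F => f u)
    (_root_.mfderiv_eq_fderiv (𝕜 := ℝ) (E := F) (E' := F)
      (f := fun z => actChart E G m₀ x z) (x := y))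
  refine h3.symm.trans (h2.trans ?_)
  exact congrArg (fun w : F => (tmap F F (M := M) (N := F) (extChartAt 𝓘(ℝ, F) m₀)
    ((chartOne E G).symm x • (extChartAt 𝓘(ℝ, F) m₀).symm y) w : F)) h1

theorem formInChart_actChart (hy : y ∈ (extChartAt 𝓘(ℝ, F) m₀).target)
    (hinv : ∀ (g : G) (m : M), pullForm (fun x : M => g • x) om m = om m) (u v : F) :
    ∀ᶠ x in 𝓝 (origin E G), formInChart om m₀ (actChart E G m₀ x y)
      ![fderiv ℝ (fun z => actChart E G m₀ x z) y u, fderiv ℝ (fun z => actChart E G m₀ x z) y v] =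
        formInChart om m₀ y ![u, v] := by
  have hc : ContinuousAt (fun x : E => (chartOne E G).symm x • (extChartAt 𝓘(ℝ, F) m₀).symm y)
      (origin E G) :=
    ContinuousAt.comp (g := fun p : E × F => (chartOne E G).symm p.1 •
      (extChartAt 𝓘(ℝ, F) m₀).symm p.2) (f := fun x : E => (x, y))
      (contMDiffAt_act_symm hy).continuousAt (by fun_prop)
  have hs : (extChartAt 𝓘(ℝ, F) m₀).source ∈
      𝓝 ((chartOne E G).symm (origin E G) • (extChartAt 𝓘(ℝ, F) m₀).symm y) := by
    rw [chartOne_symm_origin, one_smul]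
    exact (isOpen_extChartAt_source m₀).mem_nhds ((extChartAt 𝓘(ℝ, F) m₀).map_target hy)
  filter_upwards [hc.preimage_mem_nhds hs] with x hx
  rw [fderiv_actChart hy hx, fderiv_actChart hy hx]
  have h1 := formInChart_tmap_chart (om := om) (m₀ := m₀) (y := actChart E G m₀ x y)
    ((extChartAt 𝓘(ℝ, F) m₀).map_source hx) ((extChartAt 𝓘(ℝ, F) m₀).left_inv hx)
    (tmap F F (fun m : M => (chartOne E G).symm x • m) ((extChartAt 𝓘(ℝ, F) m₀).symm y)
          (chartOut F m₀ y u))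
    (tmap F F (fun m : M => (chartOne E G).symm x • m) ((extChartAt 𝓘(ℝ, F) m₀).symm y)
          (chartOut F m₀ y v))
  have h2 := pullback_two_apply (om ((chartOne E G).symm x • (extChartAt 𝓘(ℝ, F) m₀).symm y))
    (tmap F F (fun m : M => (chartOne E G).symm x • m) ((extChartAt 𝓘(ℝ, F) m₀).symm y))
    (chartOut F m₀ y u) (chartOut F m₀ y v)
  have h3 := congrArg (fun f : Tan F ((extChartAt 𝓘(ℝ, F) m₀).symm y) [⋀^Fin 2]→L[ℝ] ℝ =>
    f ![chartOut F m₀ y u, chartOut F m₀ y v])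
    (hinv ((chartOne E G).symm x) ((extChartAt 𝓘(ℝ, F) m₀).symm y))
  exact h1.trans (h2.symm.trans (h3.trans (formInChart_apply om m₀ y u v).symm))

/-- The Lie derivative of an invariant form along a generating vector field vanishes. -/
theorem lieDeriv_genChart (hy : y ∈ (extChartAt 𝓘(ℝ, F) m₀).target) (hom : SmoothForm om)
    (hinv : ∀ (g : G) (m : M), pullForm (fun x : M => g • x) om m = om m) (ξ : E) (u v : F) :
    fderiv ℝ (fun z => flatCLM (formInChart om m₀ z)) y (genChart E G m₀ y ξ) u v +
      formInChart om m₀ y ![fderiv ℝ (fun z => genChart E G m₀ z ξ) y u, v] +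
      formInChart om m₀ y ![u, fderiv ℝ (fun z => genChart E G m₀ z ξ) y v] = 0 := by
  have hs := contDiffAt_actChart (E := E) (G := G) hy
  have ha : ContDiffAt ℝ ∞ (fun x => actChart E G m₀ x y) (origin E G) :=
    ContDiffAt.comp (g := fun p : E × F => actChart E G m₀ p.1 p.2)
      (f := fun x : E => (x, y)) (origin E G) hs (by fun_prop)
  have hD : ContDiffAt ℝ ∞ (fun x => fderiv ℝ (fun z => actChart E G m₀ x z) y) (origin E G) :=
    ContDiffAt.fderiv (f := fun x z => actChart E G m₀ x z) (g := fun _ => y) (n := ∞)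
      hs contDiffAt_const (by simp)
  have hW : ContDiffAt ℝ ∞ (fun z => flatCLM (formInChart om m₀ z))
      (actChart E G m₀ (origin E G) y) := by
    rw [actChart_origin hy]; exact contDiffAt_flatCLM (hom.contDiffAt hy)
  have d1 := ((hW.differentiableAt (by simp)).hasFDerivAt.comp (origin E G)
    (ha.differentiableAt (by simp)).hasFDerivAt)
  have dD := fun w : F => ((hD.clm_apply (contDiffAt_const (c := w))).differentiableAt
    (by simp)).hasFDerivAt
  have d2 := ((d1.clm_apply (dD u)).clm_apply (dD v)).fderiv
  -- Invariance says that this function of the group coordinate is locally constant; its derivative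
  -- at the identity is minus the Lie derivative along the generating field.
  have hconst : (fun x => flatCLM (formInChart om m₀ (actChart E G m₀ x y))
      (fderiv ℝ (fun z => actChart E G m₀ x z) y u)
      (fderiv ℝ (fun z => actChart E G m₀ x z) y v)) =ᶠ[𝓝 (origin E G)]
      fun _ => formInChart om m₀ y ![u, v] := formInChart_actChart hy hinv u v
  have d3 := hconst.fderiv_eq (𝕜 := ℝ)
  have d4 := congrArg (fun f : E →L[ℝ] ℝ => f ξ) (d2.symm.trans d3)
  -- Exchanging the group and space derivatives of the action produces the derivative of the
  -- generating field, with the sign from `exp(-tξ)`.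
  have mixed : ∀ w : F, fderiv ℝ (fun x => fderiv ℝ (fun z => actChart E G m₀ x z) y w)
      (origin E G) ξ = -fderiv ℝ (fun z => genChart E G m₀ z ξ) y w := fun w => by
    have h := fderiv_mixed (a := fun p : E × F => actChart E G m₀ p.1 p.2) hs ξ w
    have h' : (fun z : F => genChart E G m₀ z ξ) =
        fun z : F => -fderiv ℝ (fun x => actChart E G m₀ x z) (origin E G) ξ := rfl
    rw [h', fderiv_fun_neg, neg_apply, neg_neg]
    exact h
  simp only [Function.comp_apply, actChart_origin hy, fderiv_actChart_origin hy, mixed,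
    fderiv_fun_const, ContinuousLinearMap.comp_apply, add_apply, ContinuousLinearMap.flip_apply,
    map_neg, neg_apply, Pi.zero_apply, zero_apply] at d4
  have h5 : fderiv ℝ (fun x => actChart E G m₀ x y) (origin E G) ξ = -genChart E G m₀ y ξ :=
    (neg_neg _).symm
  rw [h5, map_neg, neg_apply, neg_apply] at d4
  simp only [flatCLM_apply] at d4
  linarith

end LieDerivative

/-! ### Alternating 3-forms on a sum of two kinds of vectors. -/

section AlternatingThree

variable {V : Type*} [AddCommGroup V] [Module ℝ V] [TopologicalSpace V]

theorem alt_three_swap (D : V [⋀^Fin 3]→L[ℝ] ℝ) (u v w : V) : D ![u, v, w] = -D ![v, u, w] := by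
  have h := D.toAlternatingMap.map_swap ![v, u, w] (i := 0) (j := 1) (by simp)
  have e : ![v, u, w] ∘ Equiv.swap (0 : Fin 3) 1 = ![u, v, w] := by
    ext i; fin_cases i
    · simp
    · simp
    · simp [Equiv.swap_apply_of_ne_of_ne]
  rw [e] at h
  exact h

theorem alt_three_rotate (D : V [⋀^Fin 3]→L[ℝ] ℝ) (u v w : V) : D ![u, v, w] = D ![v, w, u] := by
  have h := D.toAlternatingMap.map_swap ![v, u, w] (i := 1) (j := 2) (by simp)
  have e : ![v, u, w] ∘ Equiv.swap (1 : Fin 3) 2 = ![v, w, u] := by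
    ext i; fin_cases i
    · simp [Equiv.swap_apply_of_ne_of_ne]
    · simp
    · simp
  rw [e] at h
  rw [alt_three_swap]
  exact h.symm

theorem alt_three_add (D : V [⋀^Fin 3]→L[ℝ] ℝ) (t u v w : V) :
    D ![t + u, v, w] = D ![t, v, w] + D ![u, v, w] :=
  D.toMultilinearMap.cons_add ![v, w] t u

/-- An alternating 3-form is determined by its contractions with one subspace and its values on a
complementary one. -/
theorem alt_three_eq_of_sum (D : V [⋀^Fin 3]→L[ℝ] ℝ) (K : V →ₗ[ℝ] V →ₗ[ℝ] V →ₗ[ℝ] ℝ)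
    (k₁ : ∀ u v w, K u v w = -K v u w) (k₂ : ∀ u v w, K u v w = -K u w v) (X Y : Set V)
    (hX : ∀ u ∈ X, ∀ v ∈ X, ∀ w ∈ X, D ![u, v, w] = K u v w)
    (hY : ∀ u ∈ Y, ∀ v w, D ![u, v, w] = K u v w)
    (hXY : ∀ u, ∃ x ∈ X, ∃ y ∈ Y, u = x + y) (u v w : V) : D ![u, v, w] = K u v w := by
  have krot : ∀ u v w, K u v w = K v w u := fun u v w => by rw [k₁, k₂, neg_neg]
  -- The slots are freed from membership in `X` one at a time, the last one first; a component in
  -- `Y` is rotated to the front, where `hY` applies.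
  have s₁ : ∀ u ∈ X, ∀ v ∈ X, ∀ w, D ![u, v, w] = K u v w := fun u hu v hv w => by
    obtain ⟨x, hx, y, hy, rfl⟩ := hXY w
    rw [alt_three_rotate, alt_three_rotate, krot, krot, alt_three_add, map_add,
      LinearMap.add_apply, LinearMap.add_apply, hY y hy, ← alt_three_rotate, ← alt_three_rotate,
      hX u hu v hv x hx, krot u v x, krot v x u]
  have s₂ : ∀ u ∈ X, ∀ v w, D ![u, v, w] = K u v w := fun u hu v w => by
    obtain ⟨x, hx, y, hy, rfl⟩ := hXY v
    have h := s₁ u hu x hx w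
    rw [alt_three_rotate, krot] at h
    rw [alt_three_rotate, krot, alt_three_add, map_add, LinearMap.add_apply, LinearMap.add_apply,
      hY y hy, h]
  obtain ⟨x, hx, y, hy, rfl⟩ := hXY u
  rw [alt_three_add, map_add, LinearMap.add_apply, LinearMap.add_apply, hY y hy, s₂ x hx]

end AlternatingThree

/-! ### Equivalence of `dω = Φ^*η` and `[P,P] = φ_M`. -/

section Differential

variable {E : Type*} [NormedAddCommGroup E] [NormedSpace ℝ E] [FiniteDimensional ℝ E]
  {G : Type*} [TopologicalSpace G] [ChartedSpace E G] [Group G] [LieGroup 𝓘(ℝ, E) ∞ G]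
  {F : Type*} [NormedAddCommGroup F] [NormedSpace ℝ F] [FiniteDimensional ℝ F]
  {M : Type*} [TopologicalSpace M] [ChartedSpace F M] [IsManifold 𝓘(ℝ, F) ∞ M]
  [MulAction G M] [ContMDiffSMul 𝓘(ℝ, E) 𝓘(ℝ, F) ∞ G M]
  {ι : Type*} [Fintype ι]
  {B : LinearMap.BilinForm ℝ (LieAlg E G)} {e : Module.Basis ι ℝ (LieAlg E G)}
  {Φ : M → G} {P : MultivectorField F M 2} {om : FormField F M 2} {m₀ : M} {y : F}

theorem eventually_contMDiffAt_momChart (hΦ : IsEquivariantMap E F Φ)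
    (hy : y ∈ (extChartAt 𝓘(ℝ, F) m₀).target) :
    ∀ᶠ z in 𝓝 y, ContMDiffAt 𝓘(ℝ, F) 𝓘(ℝ, E) ∞ (momChart F Φ m₀) z := by
  filter_upwards [(isOpen_extChartAt_target m₀).mem_nhds hy] with z hz
  exact contMDiffAt_momChart hΦ hz

theorem maurerCartan_momChart (hΦ : IsEquivariantMap E F Φ)
    (hy : y ∈ (extChartAt 𝓘(ℝ, F) m₀).target) (u v : F) :
    fderiv ℝ (logDeriv (E := E) (momChart F Φ m₀)) y u v -
      fderiv ℝ (logDeriv (E := E) (momChart F Φ m₀)) y v u =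
      -lieLin E G (logDeriv (E := E) (momChart F Φ m₀) y u)
        (logDeriv (E := E) (momChart F Φ m₀) y v) := by
  rw [maurerCartan (eventually_contMDiffAt_momChart hΦ hy), lieLin_apply]

theorem fderiv_adjoint_momChart (hΦ : IsEquivariantMap E F Φ)
    (hy : y ∈ (extChartAt 𝓘(ℝ, F) m₀).target) (u : F) (ζ : E) :
    fderiv ℝ (fun z => adjointCoord (E := E) (momChart F Φ m₀ z)) y u ζ =
      adjointCoord (momChart F Φ m₀ y)
        (lieLin E G (logDeriv (E := E) (momChart F Φ m₀) y u) ζ) := by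
  rw [fderiv_adjointCoord_comp (contMDiffAt_momChart hΦ hy), lieLin_apply]

theorem extDeriv_formInChart_sharp (hB : IsInvariantInnerProduct B) (he : IsOrthonormalBasis B e)
    (hΦ : IsEquivariantMap E F Φ) (hy : y ∈ (extChartAt 𝓘(ℝ, F) m₀).target)
    (hom : SmoothForm om) (hP : SmoothMultivector P)
    (h₁ : ∀ m, BivectorMoment B Φ m (P m)) (h₂ : ∀ m, CompatibleAt E Φ m (P m) (om m))
    (α : Fin 3 → F →L[ℝ] ℝ) :
    extDeriv (formInChart om m₀) y (fun i => sharp (multivectorInChart P m₀ y) (α i)) =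
      1 / 2 * schoutenModel (multivectorInChart P m₀) (multivectorInChart P m₀) y α -
        1 / 4 * cartanForm B (genAdjChart e m₀ y (α 0)) (genAdjChart e m₀ y (α 1))
          (genAdjChart e m₀ y (α 2)) +
        1 / 2 * cartanForm B
          (logDeriv (momChart F Φ m₀) y (sharp (multivectorInChart P m₀ y) (α 0)))
          (logDeriv (momChart F Φ m₀) y (sharp (multivectorInChart P m₀ y) (α 1)))
          (logDeriv (momChart F Φ m₀) y (sharp (multivectorInChart P m₀ y) (α 2))) := by
  have hev := (isOpen_extChartAt_target (I := 𝓘(ℝ, F)) m₀).mem_nhds hy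
  have hΨ := contMDiffAt_momChart hΦ hy
  exact extDeriv_sharp (B := innerCoord B) (br := lieLin E G)
    (A := fun z => adjointCoord (E := E) (momChart F Φ m₀ z))
    (innerCoord_symm hB) lieLin_antisymm
    (lie_invariant (innerCoord_adjoint hB)) (hom.contDiffAt hy) (hP.contDiffAt hy)
    ((contDiffAt_logDeriv hΨ).differentiableAt (by simp))
    ((contDiffAt_adjointCoord hΨ).differentiableAt (by simp))
    ((contDiffAt_genAdjChart (e := e) hy).differentiableAt (by simp))
    (maurerCartan_momChart hΦ hy) (fderiv_adjoint_momChart hΦ hy)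
    (adjointCoord_lie _) (fun _ => innerCoord_adjoint hB _)
    (by filter_upwards [hev] with z hz; exact formInChart_sharp hB he hΦ hz h₂)
    (by filter_upwards [hev] with z hz; exact adjointCoord_logDeriv_sharp hB he hΦ hz h₁) α

/-- Cartan's formula gives `½ ξ · (1 - Ad_Φ)[T u, T v]`; moving the operator to the other side turns
`ξ` into `ξ - Ad_Φ⁻¹ ξ = T(ξ_M)`. -/
theorem extDeriv_formInChart_gen (hB : IsInvariantInnerProduct B)
    (hΦ : IsEquivariantMap E F Φ) (hy : y ∈ (extChartAt 𝓘(ℝ, F) m₀).target)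
    (hom : SmoothForm om) (h₁ : ∀ m, FormMoment B Φ m (om m))
    (hinv : ∀ (g : G) (m : M), pullForm (fun x : M => g • x) om m = om m) (ξ : E) (u v : F) :
    extDeriv (formInChart om m₀) y ![genChart E G m₀ y ξ, u, v] =
      1 / 2 * cartanForm B (logDeriv (momChart F Φ m₀) y (genChart E G m₀ y ξ))
        (logDeriv (momChart F Φ m₀) y u) (logDeriv (momChart F Φ m₀) y v) := by
  have hev := (isOpen_extChartAt_target (I := 𝓘(ℝ, F)) m₀).mem_nhds hy
  have hΨ := contMDiffAt_momChart hΦ hy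
  have h := extDeriv_symmetry (B := innerCoord B) (br := lieLin E G)
    (T := logDeriv (E := E) (momChart F Φ m₀))
    (A := fun z => adjointCoord (E := E) (momChart F Φ m₀ z))
    (ρ := fun z => genChart E G m₀ z ξ) (ξ := ξ) lieLin_antisymm (hom.contDiffAt hy)
    ((contDiffAt_logDeriv hΨ).differentiableAt (by simp))
    ((contDiffAt_adjointCoord hΨ).differentiableAt (by simp))
    (((contDiffAt_genChart hy).clm_apply contDiffAt_const).differentiableAt (by simp))
    (maurerCartan_momChart hΦ hy) (fderiv_adjoint_momChart hΦ hy)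
    (by filter_upwards [hev] with z hz; exact formInChart_genChart hΦ hz h₁ ξ)
    (lieDeriv_genChart hy hom hinv ξ) u v
  have h2 := innerCoord_adjoint hB (momChart F Φ m₀ y)
    (adjointCoord (E := E) (momChart F Φ m₀ y)⁻¹ ξ)
    (lieLin E G (logDeriv (momChart F Φ m₀) y u) (logDeriv (momChart F Φ m₀) y v))
  rw [adjointCoord_apply_inv] at h2
  rw [h, cartanForm_apply, logDeriv_genChart hΦ hy, map_sub, map_sub, sub_apply, h2]

theorem comp_tmap_chart (hy : y ∈ (extChartAt 𝓘(ℝ, F) m₀).target) {m : M}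
    (hm : (extChartAt 𝓘(ℝ, F) m₀).symm y = m) (a : F →L[ℝ] ℝ) {α : Cotan F m}
    (hα : α = a.comp (tmap F F (M := M) (N := F) (extChartAt 𝓘(ℝ, F) m₀) m)) :
    @Eq (F →L[ℝ] ℝ) (ContinuousLinearMap.comp (M₂ := F) α
      (tmap F F (M := F) (N := M) (extChartAt 𝓘(ℝ, F) m₀).symm y)) a := by
  subst hm hα
  exact ContinuousLinearMap.ext fun u => congrArg a (chartIn_chartOut hy u)

theorem dForm_eq_eta (hB : IsInvariantInnerProduct B) (he : IsOrthonormalBasis B e)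
    (hΦ : IsEquivariantMap E F Φ) (hom : SmoothForm om) (hP : IsQuasiPoisson B e P)
    (hnd : IsNondegenerate E G P)
    (h₁ : ∀ m, BivectorMoment B Φ m (P m)) (h₂ : ∀ m, CompatibleAt E Φ m (P m) (om m))
    (h₃ : ∀ m, FormMoment B Φ m (om m))
    (hinv : ∀ (g : G) (m : M), pullForm (fun x : M => g • x) om m = om m)
    (m : M) (v : Fin 3 → Tan F m) :
    dForm om m v = etaForm B e (Φ m) (fun i => tmap F E Φ m (v i)) := by
  have hy := mem_extChartAt_target (I := 𝓘(ℝ, F)) m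
  have hm := extChartAt_to_inv (I := 𝓘(ℝ, F)) m
  set y := extChartAt 𝓘(ℝ, F) m m with hydef
  let T : F →ₗ[ℝ] E := (logDeriv (E := E) (momChart F Φ m) y).toLinearMap
  -- `K` is `Φ^*η` in the chart. It is compared with `dω` on vectors `P♯ a` and along generating
  -- fields, which together span by non-degeneracy.
  let K : F →ₗ[ℝ] F →ₗ[ℝ] F →ₗ[ℝ] ℝ := (1 / 2 : ℝ) • (((cartanForm B).compr₂
    (LinearMap.lcomp ℝ ℝ T)).compl₁₂ T T)
  have hK : ∀ u v w, K u v w = 1 / 2 * cartanForm B (logDeriv (momChart F Φ m) y u)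
      (logDeriv (momChart F Φ m) y v) (logDeriv (momChart F Φ m) y w) := fun u v w => rfl
  have key := alt_three_eq_of_sum (extDeriv (formInChart om m) y) K
    (fun u v w => by rw [hK, hK, cartanForm_swap_left hB]; ring)
    (fun u v w => by rw [hK, hK, cartanForm_swap_right]; ring)
    (Set.range (sharp (multivectorInChart P m y))) (Set.range (genChart E G m y))
    (by
      rintro _ ⟨a, rfl⟩ _ ⟨b, rfl⟩ _ ⟨c, rfl⟩
      have h := extDeriv_formInChart_sharp hB he hΦ hy hom hP.smooth h₁ h₂ ![a, b, c]
      -- Half of this value cancels the `-1/4` term of `extDeriv_formInChart_sharp`, leaving exactly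
      -- `K`.
      have hs : schoutenModel (multivectorInChart P m) (multivectorInChart P m) y ![a, b, c] =
          1 / 2 * cartanForm B (genAdjChart e m y a) (genAdjChart e m y b)
            (genAdjChart e m y c) := by
        let α : Fin 3 → Cotan F m := fun i =>
          (![a, b, c] i).comp (tmap F F (M := M) (N := F) (extChartAt 𝓘(ℝ, F) m) m)
        have hα : ∀ i, @Eq (F →L[ℝ] ℝ) (ContinuousLinearMap.comp (M₂ := F) (α i)
            (tmap F F (M := F) (N := M) (extChartAt 𝓘(ℝ, F) m).symm y)) (![a, b, c] i) :=
          fun i => comp_tmap_chart hy hm _ rfl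
        have hR : ∀ i, @Eq E (genAdj e m (α i)) (genAdjChart e m y (![a, b, c] i)) := fun i =>
          (genAdjChart_comp_chartOut hy hm (α i)).symm.trans
            (congrArg (fun t : F →L[ℝ] ℝ => genAdjChart e m y t) (hα i))
        have h1 := (hP.schouten_eq m α).trans (cartanTrivector_apply hB he m α)
        have h2 : schouten P P m α = schoutenModel (multivectorInChart P m)
            (multivectorInChart P m) y ![a, b, c] :=
          congrArg (schoutenModel (multivectorInChart P m) (multivectorInChart P m) y)
            (funext hα)
        rw [← h2, h1]
        have hc : ∀ x x' z z' w w' : E, x = x' → z = z' → w = w' →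
            1 / 2 * cartanForm B x z w = 1 / 2 * cartanForm B x' z' w' := by
          rintro x _ z _ w _ rfl rfl rfl; rfl
        exact hc _ _ _ _ _ _ (hR 0) (hR 1) (hR 2)
      rw [hs] at h
      have ev : (fun i => sharp (multivectorInChart P m y) (![a, b, c] i)) =
          ![sharp (multivectorInChart P m y) a, sharp (multivectorInChart P m y) b,
            sharp (multivectorInChart P m y) c] := by
        ext i : 1; fin_cases i <;> rfl
      rw [ev] at h
      rw [h, hK]
      simp only [Matrix.cons_val_zero, Matrix.cons_val_one, Matrix.cons_val]
      ring)
    (by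
      rintro _ ⟨ξ, rfl⟩ v w
      exact extDeriv_formInChart_gen hB hΦ hy hom h₃ hinv ξ v w)
    (fun u => by
      obtain ⟨a, ξ, h⟩ := exists_sharp_add_genChart (y := y) hy hnd u
      exact ⟨_, ⟨a, rfl⟩, _, ⟨ξ, rfl⟩, h⟩)
  let w : Fin 3 → F := fun i => tmap F F (M := M) (N := F) (extChartAt 𝓘(ℝ, F) m) m (v i)
  have hw : w = ![w 0, w 1, w 2] := by ext i : 1; fin_cases i <;> rfl
  have h5 : dForm om m v = extDeriv (formInChart om m) y w := rfl
  have h6 : ∀ i, @Eq E (logDeriv (E := E) (momChart F Φ m) y (w i)) (momT E Φ m (v i)) :=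
    fun i => logDeriv_tmap_chart hΦ hy hm (v i)
  rw [h5, hw, key, hK, h6, h6, h6]
  exact (etaForm_apply hB (Φ m) fun i => tmap F E Φ m (v i)).symm

/-- With `dω = Φ^*η` the identity for `dω` on the image of `P♯` can be solved for `[P,P]` on
arbitrary covectors, so no spanning argument is needed. -/
theorem schouten_eq_cartan (hB : IsInvariantInnerProduct B) (he : IsOrthonormalBasis B e)
    (hom : IsQuasiHamiltonian B e om Φ) (hP : SmoothMultivector P)
    (h₁ : ∀ m, BivectorMoment B Φ m (P m)) (h₂ : ∀ m, CompatibleAt E Φ m (P m) (om m))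
    (m : M) (α : Fin 3 → Cotan F m) : schouten P P m α = cartanTrivector B e m α := by
  have hc : ∀ x x' z z' w w' : E, x = x' → z = z' → w = w' →
      cartanForm B x z w = cartanForm B x' z' w' := by
    rintro x _ z _ w _ rfl rfl rfl; rfl
  have hΦ := hom.equivariantMap
  have hy := mem_extChartAt_target (I := 𝓘(ℝ, F)) m
  have hm := extChartAt_to_inv (I := 𝓘(ℝ, F)) m
  set y := extChartAt 𝓘(ℝ, F) m m with hydef
  let a : Fin 3 → F →L[ℝ] ℝ := fun i => ContinuousLinearMap.comp (M₂ := F) (α i)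
    (tmap F F (M := F) (N := M) (extChartAt 𝓘(ℝ, F) m).symm y)
  have h := extDeriv_formInChart_sharp hB he hΦ hy hom.smooth hP h₁ h₂ a
  -- The chart is centred at `m`, so coordinate vectors serve directly as tangent vectors at `m`.
  have hid : ∀ u : F, @Eq F (tmap F F (M := M) (N := F) (extChartAt 𝓘(ℝ, F) m) m u) u := fun u =>
    congrArg (fun f : F →L[ℝ] F => f u) (mfderiv_extChartAt_self (I := 𝓘(ℝ, F)) (x := m))
  let u : Fin 3 → F := fun i => sharp (multivectorInChart P m y) (a i)
  have hd : extDeriv (formInChart om m) y u = 1 / 2 * cartanForm B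
      (logDeriv (momChart F Φ m) y (u 0)) (logDeriv (momChart F Φ m) y (u 1))
      (logDeriv (momChart F Φ m) y (u 2)) := by
    have h5 : dForm om m u = extDeriv (formInChart om m) y u :=
      congrArg (fun t : Fin 3 → F => extDeriv (formInChart om m) y t) (funext fun i => hid (u i))
    have h6 : ∀ i, @Eq E (logDeriv (E := E) (momChart F Φ m) y (u i)) (momT E Φ m (u i)) :=
      fun i => (congrArg (fun t : F => logDeriv (E := E) (momChart F Φ m) y t)
        (hid (u i)).symm).trans (logDeriv_tmap_chart hΦ hy hm (u i))
    have h7 := etaForm_apply (e := e) hB (Φ m) fun i => tmap F E Φ m (u i)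
    have h8 := hc _ _ _ _ _ _ (h6 0) (h6 1) (h6 2)
    refine h5.symm.trans ((hom.d_eq m u).trans (h7.trans ?_))
    exact (congrArg (fun t : ℝ => 1 / 2 * t) h8).symm
  have hR : ∀ i, @Eq E (genAdjChart e m y (a i)) (genAdj e m (α i)) := fun i =>
    genAdjChart_comp_chartOut hy hm (α i)
  have h2 : schouten P P m α = schoutenModel (multivectorInChart P m)
      (multivectorInChart P m) y a := rfl
  rw [h2]
  refine Eq.trans ?_ (cartanTrivector_apply hB he m α).symm
  have h3 := hc _ _ _ _ _ _ (hR 0) (hR 1) (hR 2)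
  have h4 := h.symm.trans hd
  linarith

end Differential

end QuasiPoisson

end

/-! ### The correspondence. -/

theorem theorem10p1
    {E : Type*} [NormedAddCommGroup E] [NormedSpace ℝ E] [FiniteDimensional ℝ E]
    {G : Type*} [TopologicalSpace G] [ChartedSpace E G] [Group G]
    [LieGroup 𝓘(ℝ, E) ∞ G] [T2Space G] [CompactSpace G]
    (B : LinearMap.BilinForm ℝ (LieAlg E G)) (hB : IsInvariantInnerProduct B)
    {ι : Type*} [Fintype ι] (e : Module.Basis ι ℝ (LieAlg E G)) (he : IsOrthonormalBasis B e)
    {F : Type*} [NormedAddCommGroup F] [NormedSpace ℝ F] [FiniteDimensional ℝ F]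
    {M : Type*} [TopologicalSpace M] [ChartedSpace F M] [IsManifold 𝓘(ℝ, F) ∞ M]
    [T2Space M] [SecondCountableTopology M]
    [MulAction G M] [ContMDiffSMul 𝓘(ℝ, E) 𝓘(ℝ, F) ∞ G M]
    (Φ : M → G) :
    (∀ P : MultivectorField F M 2,
      IsHamiltonianQuasiPoisson B e P Φ → IsNondegenerate E G P →
        ∃! om : FormField F M 2, IsQuasiHamiltonian B e om Φ ∧ Compatible e P om Φ) ∧
    (∀ om : FormField F M 2,
      IsQuasiHamiltonian B e om Φ →
        ∃! P : MultivectorField F M 2,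
          (IsHamiltonianQuasiPoisson B e P Φ ∧ IsNondegenerate E G P) ∧
            Compatible e P om Φ) := by
  constructor
  · intro P hP hnd
    have hΦ := hP.equivariantMap
    have hPm := (momentCondition_iff hB he hΦ).1 hP.moment
    -- The choice is made point by point without regard to regularity; the values are forced, and
    -- smoothness and invariance are deduced afterwards.
    choose om hom hC using fun m => exists_form hB he hΦ (hPm m) (hnd m)
    have hs := smoothForm_of_compatible hB he hΦ hP.quasiPoisson.smooth hnd hom hC
    have hinv := form_invariant hB he hΦ hnd hP.quasiPoisson.invariant hom hC
    refine ⟨om, ⟨⟨hs, hinv, hΦ, ?_, fun a m => (formMoment_iff he m).1 (hom m) a,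
      fun m => form_ker hB he hΦ (hom m) (hC m)⟩, (compatible_iff he).2 hC⟩, ?_⟩
    · exact dForm_eq_eta hB he hΦ hs hP.quasiPoisson hnd hPm hC hom hinv
    · rintro om' ⟨h₁, h₂⟩
      funext m
      exact form_unique hB he hΦ (hnd m) ((formMoment_iff he m).2 fun a => h₁.moment a m)
        ((compatible_iff he).1 h₂ m) (hom m) (hC m)
  · intro om hom
    have hΦ := hom.equivariantMap
    have hm : ∀ m, FormMoment B Φ m (om m) := fun m =>
      (formMoment_iff he m).2 fun a => hom.moment a m
    choose P hP hC using fun m => exists_bivector hB he hΦ (hm m) (hom.kernel m)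
    have hs := smoothMultivector_of_compatible hB hΦ hom.smooth hom.kernel hP hC
    have hinv := bivector_invariant hB hΦ hom.kernel hom.invariant hP hC
    refine ⟨P, ⟨⟨⟨⟨hs, hinv, schouten_eq_cartan hB he hom hs hP hC⟩, hΦ,
      (momentCondition_iff hB he hΦ).2 hP⟩, fun m => bivector_nondegenerate hB he hΦ (hC m)⟩,
      (compatible_iff he).2 hC⟩, ?_⟩
    rintro P' ⟨⟨h₁, -⟩, h₂⟩
    funext m
    exact bivector_unique hB hΦ (hom.kernel m) ((momentCondition_iff hB he hΦ).1 h₁.moment m)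
      ((compatible_iff he).1 h₂ m) (hP m) (hC m)
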